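/- Let $d\ge 3$ and let $\mathbb B^d\subset\mathbb R^d$ be the open unit ball, with boundary $\mathbb S^{d-1}$ carrying its (not normalized) surface measure. For pairs $\mathbf f=(f_1,f_2)$, $\mathbf g=(g_1,g_2)\in C^\infty(\overline{\mathbb B^d},\mathbb C^d)^2$ set $$(\mathbf f|\mathbf g)_{\mathcal H^1}=\sum_{i=1}^d(\partial_i f_1|\partial_i g_1)_{L^2(\mathbb B^d,\mathbb C^d)}+(f_2|g_2)_{L^2(\mathbb B^d,\mathbb C^d)}+(f_1|g_1)_{L^2(\mathbb S^{d-1},\mathbb C^d)},$$ and for $k\ge2$ $$(\mathbf f|\mathbf g)_{\dot{\mathcal H}^k}=\sum_{i_1,\dots,i_{k-1}=1}^d(\partial_{i_1}\cdots\partial_{i_{k-1}}\mathbf f\,|\,\partial_{i_1}\cdots\partial_{i_{k-1}}\mathbf g)_{\mathcal H^1},\qquad (\mathbf f|\mathbf g)_{\mathcal H^k}=(\mathbf f|\mathbf g)_{\dot{\mathcal H}^k}+(\mathbf f|\mathbf g)_{\mathcal H^1},$$ with induced (semi)norms $\|\cdot\|_{\dot{\mathcal H}^k}$ and $\|\cdot\|_{\mathcal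 H^k}$; let $\mathcal H^k$ be the Hilbert space obtained as the completion of $C^\infty(\overline{\mathbb B^d},\mathbb C^d)^2$ under $\|\cdot\|_{\mathcal H^k}$. With $(\Lambda f)(\xi)=\sum_j\xi_j\partial_jf(\xi)$ and $(Kf)^n(\xi)=\sum_j\big(\xi_n\partial_jf^j(\xi)-\xi_j\partial_nf^j(\xi)\big)$, let $\mathbf L_0=\mathbf L+\mathbf L_0'$ on $C^\infty(\overline{\mathbb B^d},\mathbb C^d)^2$, where $$\mathbf L\begin{pmatrix}f_1\\f_2\end{pmatrix}=\begin{pmatrix}-\Lambda f_1+f_2\\ \Delta f_1-\Lambda f_2-f_2\end{pmatrix},$$ $$\mathbf L_0'\begin{pmatrix}f_1\\f_2\end{pmatrix}(\xi)=\begin{pmatrix}0\\ \frac{2(d-2-|\xi|^2)}{d-2+|\xi|^2}f_1(\xi)+\frac{4}{d-2+|\xi|^2}\big(|\xi|^2f_2(\xi)-\Lambda f_1(\xi)+Kf_1(\xi)\big)\end{pmatrix}.$$ There is a constant $C=C(d)>0$, independent of $k$, with the following property: for all $k\ge2$ there is $c_k>0$ such that $$|(\mathbf L_0'\mathbf f|\mathbf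 f)_{\dot{\mathcal H}^k}|\le C\|\mathbf f\|_{\dot{\mathcal H}^k}^2+c_k\|\mathbf f\|_{\mathcal H^{k-1}}^2\quad\text{for all }\mathbf f\in C^\infty(\overline{\mathbb B^d},\mathbb C^d)^2.\tag{$*$}$$ Moreover, let $C>0$ be any constant with this property and put $k_0=\lceil\frac d2+1+C\rceil$. Then for each integer $k\ge k_0$ there exist $C_k,w_k>0$ and a finite-rank projection $\mathbf P$ on $\mathcal H^k$, orthogonal with respect to $(\cdot|\cdot)_{\mathcal H^k}$, such that $$\mathrm{Re}\,\big((\mathbf L_0-C_k\mathbf P)\mathbf f\,|\,\mathbf f\big)_{\mathcal H^k}\le-w_k\|\mathbf f\|_{\mathcal H^k}^2\quad\text{for all }\mathbf f\in C^\infty(\overline{\mathbb B^d},\mathbb C^d)^2.$$ -/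

import Mathlib

open scoped ContDiff ComplexConjugate
open MeasureTheory

noncomputable section

namespace WaveMaps

/-- Euclidean space `ℝ^d`. -/
abbrev Euc (d : ℕ) : Type := EuclideanSpace ℝ (Fin d)

/-- The closed unit ball of `ℝ^d`. -/
abbrev cball (d : ℕ) : Set (Euc d) := Metric.closedBall 0 1

theorem uniqueDiffOn_cball (d : ℕ) : UniqueDiffOn ℝ (cball d) := by
  refine uniqueDiffOn_convex (convex_closedBall 0 1) ?_
  exact ⟨0, Metric.ball_subset_interior_closedBall (by simp)⟩

/-- The algebra `C^∞` of the closed unit ball: complex-valued functions that are smooth up to the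
boundary.  Its elements are represented by functions on `ℝ^d`, but only the values on
the closed ball enter the definitions below. -/
def Smooth (d : ℕ) : Subalgebra ℂ (Euc d → ℂ) where
  carrier := {f | ContDiffOn ℝ ∞ f (cball d)}
  mul_mem' hf hg := ContDiffOn.mul hf hg
  add_mem' hf hg := ContDiffOn.add hf hg
  algebraMap_mem' _ := contDiffOn_const

instance (d : ℕ) : CommRing (Smooth d) := inferInstance

instance (d : ℕ) : AddCommGroup (Smooth d) := inferInstance

instance (d : ℕ) : Module ℂ (Smooth d) := inferInstance

/-- `ℂ^d`-valued functions, smooth up to the boundary of the ball. -/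
abbrev SmoothVec (d : ℕ) : Type := Fin d → Smooth d

/-- Pairs `(f₁, f₂)` of `ℂ^d`-valued functions that are smooth up to the boundary of the ball. -/
abbrev SmoothPair (d : ℕ) : Type := SmoothVec d × SmoothVec d

instance (d : ℕ) : AddCommGroup (SmoothPair d) := inferInstance

instance (d : ℕ) : Module ℂ (SmoothPair d) := inferInstance

/-! ### Differential operators -/

theorem differentiableWithinAt {d : ℕ} (f : Smooth d) {x : Euc d} (hx : x ∈ cball d) :
    DifferentiableWithinAt ℝ (f : Euc d → ℂ) (cball d) x :=
  (f.2 : ContDiffOn ℝ ∞ _ _).differentiableOn (by simp) x hx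

theorem fderivWithin_off {d : ℕ} (f : Euc d → ℂ) {x : Euc d} (hx : x ∉ cball d) :
    fderivWithin ℝ f (cball d) x = 0 := by
  apply fderivWithin_zero_of_notMem_closure
  rwa [Metric.isClosed_closedBall.closure_eq]

/-- The partial derivative `∂_i` (one-sided at the boundary of the ball). -/
def pd {d : ℕ} (i : Fin d) : Smooth d →ₗ[ℂ] Smooth d where
  toFun f := ⟨fun x => fderivWithin ℝ (f : Euc d → ℂ) (cball d) x (EuclideanSpace.single i 1),
    (ContDiffOn.fderivWithin (m := ∞) f.2 (uniqueDiffOn_cball d) (by simp)).clm_apply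
      contDiffOn_const⟩
  map_add' f g := by
    ext x
    by_cases hx : x ∈ cball d
    · simp [fderivWithin_add (uniqueDiffOn_cball d x hx) (differentiableWithinAt f hx)
        (differentiableWithinAt g hx)]
    · simp [fderivWithin_off _ hx]
  map_smul' c f := by
    ext x
    by_cases hx : x ∈ cball d
    · simp [fderivWithin_const_smul (uniqueDiffOn_cball d x hx) (differentiableWithinAt f hx) c]
    · simp [fderivWithin_off _ hx]

/-- `∂_i` acting on every component of a pair. -/
def pdPair {d : ℕ} (i : Fin d) : Module.End ℂ (SmoothPair d) where
  toFun f := (fun n => pd i (f.1 n), fun n => pd i (f.2 n))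
  map_add' f g := by
    ext1 <;> funext n <;> exact map_add (pd i) _ _
  map_smul' c f := by
    ext1 <;> funext n <;> exact map_smul (pd i) _ _

/-- The iterated derivative `∂_{i_1} ⋯ ∂_{i_n}` of a pair. -/
def pdIter {d n : ℕ} (i : Fin n → Fin d) : Module.End ℂ (SmoothPair d) :=
  (List.ofFn fun a => pdPair (i a)).prod

/-- The coordinate function `ξ_i`. -/
def coord {d : ℕ} (i : Fin d) : Smooth d :=
  ⟨fun x => ((x i : ℝ) : ℂ), by
    have h : ContDiff ℝ ∞ fun x : Euc d => ((x i : ℝ) : ℂ) :=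
      Complex.ofRealCLM.contDiff.comp (EuclideanSpace.proj (𝕜 := ℝ) i).contDiff
    exact h.contDiffOn⟩

/-- `Λ f = ξ^j ∂_j f`, acting componentwise. -/
def lam {d : ℕ} (f : SmoothVec d) : SmoothVec d := fun n => ∑ j, coord j * pd j (f n)

/-- The Laplacian, acting componentwise. -/
def lap {d : ℕ} (f : SmoothVec d) : SmoothVec d := fun n => ∑ j, pd j (pd j (f n))

/-- `(K f)^n = ξ^n ∂_j f^j - ξ_j ∂^n f^j`. -/
def kop {d : ℕ} (f : SmoothVec d) : SmoothVec d :=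
  fun n => ∑ j, (coord n * pd j (f j) - coord j * pd n (f j))

/-- `|ξ|²`. -/
def normSq (d : ℕ) : Smooth d := ∑ j, coord j * coord j

theorem normSq_apply {d : ℕ} (x : Euc d) : (normSq d : Euc d → ℂ) x = ((‖x‖ ^ 2 : ℝ) : ℂ) := by
  rw [EuclideanSpace.norm_sq_eq]
  simp [normSq, coord, pow_two]

/-- The function `1 / (d - 2 + |ξ|²)`. -/
def pot {d : ℕ} (hd : 3 ≤ d) : Smooth d :=
  ⟨fun x => (((d : ℝ) - 2 + ‖x‖ ^ 2 : ℝ) : ℂ)⁻¹, by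
    have h3 : (3 : ℝ) ≤ d := by exact_mod_cast hd
    have h : ContDiff ℝ ∞ fun x : Euc d => (((d : ℝ) - 2 + ‖x‖ ^ 2 : ℝ) : ℂ) :=
      Complex.ofRealCLM.contDiff.comp (contDiff_const.add (contDiff_norm_sq ℝ))
    refine (h.inv fun x => ?_).contDiffOn
    have : 0 < (d : ℝ) - 2 + ‖x‖ ^ 2 := by nlinarith [sq_nonneg ‖x‖]
    exact_mod_cast this.ne'⟩

/-- The free generator on smooth pairs: `(f₁, f₂) ↦ (-Λ f₁ + f₂, Δ f₁ - Λ f₂ - f₂)`. -/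
def freeGen {d : ℕ} (f : SmoothPair d) : SmoothPair d :=
  (-lam f.1 + f.2, lap f.1 - lam f.2 - f.2)

/-- The first-order perturbation `L₀'`: it sends `(f₁, f₂)` to `(0, g)` with
`g = 2 (d - 2 - |ξ|²) / (d - 2 + |ξ|²) f₁ + 4 / (d - 2 + |ξ|²) (|ξ|² f₂ - Λ f₁ + K f₁)`. -/
def perturb {d : ℕ} (hd : 3 ≤ d) (f : SmoothPair d) : SmoothPair d :=
  (0, fun n =>
    2 * (algebraMap ℂ (Smooth d) ((d : ℂ) - 2) - normSq d) * pot hd * f.1 n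
      + 4 * pot hd * (normSq d * f.2 n - lam f.1 n + kop f.1 n))

/-- The linearized generator `L₀` on smooth pairs. -/
def linGen {d : ℕ} (hd : 3 ≤ d) (f : SmoothPair d) : SmoothPair d :=
  freeGen f + perturb hd f

/-! ### The perturbation is the linearization of the wave maps nonlinearity -/

/-- The Christoffel symbols `Γ_{ij}^n` of the round sphere in stereographic coordinates,
with `|z|²` continued analytically as `∑ z_l²`. -/
def christoffel {d : ℕ} (n i j : Fin d) (z : Fin d → ℂ) : ℂ :=
  -2 / (1 + ∑ l, z l ^ 2) *
    (z i * (if j = n then 1 else 0) + z j * (if i = n then 1 else 0)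
      - z n * (if i = j then 1 else 0))

/-- `F^n(z, M, w) = Γ_{ij}^n(z) (w^i w^j - M^i_m M^j_m)`; the second component of the
nonlinearity at `(f₁, f₂)` is `-F(f₁, D f₁, f₂)`. -/
def nonlin {d : ℕ} (z : Fin d → ℂ) (M : Fin d → Fin d → ℂ) (w : Fin d → ℂ) (n : Fin d) : ℂ :=
  ∑ i, ∑ j, christoffel n i j z * (w i * w j - ∑ m, M i m * M j m)

/-- The blowup profile in stereographic coordinates, `v₀(ξ) = ξ / √(d - 2)`. -/
def profile (d : ℕ) : SmoothVec d := fun n => (((√((d : ℝ) - 2))⁻¹ : ℝ) : ℂ) • coord n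

theorem pd_coord {d : ℕ} (m n : Fin d) {x : Euc d} (hx : x ∈ cball d) :
    (pd m (coord n) : Euc d → ℂ) x = if n = m then 1 else 0 := by
  let L : Euc d →L[ℝ] ℂ := Complex.ofRealCLM.comp (EuclideanSpace.proj (𝕜 := ℝ) n)
  have h : fderivWithin ℝ (coord n : Euc d → ℂ) (cball d) x = L :=
    (L.hasFDerivAt.hasFDerivWithinAt).fderivWithin (uniqueDiffOn_cball d x hx)
  change fderivWithin ℝ (coord n : Euc d → ℂ) (cball d) x (EuclideanSpace.single m 1) = _
  rw [h]
  by_cases hnm : n = m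
  · subst hnm
    simp [L]
  · simp [L, hnm]

theorem nonlin_eq {d : ℕ} (z : Fin d → ℂ) (M : Fin d → Fin d → ℂ) (w : Fin d → ℂ) (n : Fin d) :
    nonlin z M w n = -2 / (1 + ∑ l, z l ^ 2) *
      (2 * (∑ i, z i * w i) * w n - z n * ∑ i, w i ^ 2
        - 2 * (∑ m, (∑ i, z i * M i m) * M n m) + z n * ∑ i, ∑ m, M i m ^ 2) := by
  have key : ∀ B : Fin d → Fin d → ℂ, ∑ i, ∑ j, christoffel n i j z * B i j
      = -2 / (1 + ∑ l, z l ^ 2) *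
        (∑ i, z i * B i n + ∑ j, z j * B n j - z n * ∑ i, B i i) := by
    intro B
    simp only [christoffel, mul_assoc, ← Finset.mul_sum, sub_mul, add_mul, Finset.sum_sub_distrib,
      Finset.sum_add_distrib, ite_mul, one_mul, zero_mul, mul_ite, mul_zero,
      Finset.sum_ite_eq, Finset.sum_ite_eq', Finset.mem_univ, if_true]
    congr 2
    congr 1
    rw [Finset.sum_comm]
    simp
  have e1 : ∑ m, (∑ i, z i * M i m) * M n m = ∑ i, z i * ∑ m, M i m * M n m := by
    simp only [Finset.sum_mul, Finset.mul_sum]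
    rw [Finset.sum_comm]
    simp only [mul_assoc]
  rw [nonlin, key, e1]
  congr 1
  simp only [mul_sub, Finset.sum_sub_distrib, Finset.mul_sum, Finset.sum_mul, pow_two]
  have e2 : ∀ i m, z i * (M n m * M i m) = z i * (M i m * M n m) := fun i m => by ring
  simp only [e2]
  have e3 : ∑ i, z i * (w n * w i) = ∑ i, z i * (w i * w n) :=
    Finset.sum_congr rfl fun i _ => by ring
  have e4 : ∑ i, 2 * (z i * w i) * w n = 2 * ∑ i, z i * (w i * w n) := by
    rw [Finset.mul_sum]
    exact Finset.sum_congr rfl fun i _ => by ring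
  have e5 : ∑ i, ∑ m, 2 * (z i * (M i m * M n m)) = 2 * ∑ i, ∑ m, z i * (M i m * M n m) := by
    simp only [Finset.mul_sum]
  rw [e3, e4, e5]
  ring

/-- `L₀'` is the derivative of the nonlinearity at the blowup profile `(v₀, Λ v₀)`. -/
theorem perturb_eq_linearization {d : ℕ} (hd : 3 ≤ d) (f : SmoothPair d) {x : Euc d}
    (hx : x ∈ cball d) (n : Fin d) :
    HasDerivAt (fun s : ℂ => -nonlin
        (fun i => (profile d i : Euc d → ℂ) x + s * (f.1 i : Euc d → ℂ) x)
        (fun i m => (pd m (profile d i) : Euc d → ℂ) x + s * (pd m (f.1 i) : Euc d → ℂ) x)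
        (fun i => (lam (profile d) i : Euc d → ℂ) x + s * (f.2 i : Euc d → ℂ) x) n)
      (((perturb hd f).2 n : Euc d → ℂ) x) 0 := by
  have h3 : (3 : ℝ) ≤ d := by exact_mod_cast hd
  set a : ℂ := (((√((d : ℝ) - 2))⁻¹ : ℝ) : ℂ) with ha
  have ha2 : a ^ 2 * ((d : ℂ) - 2) = 1 := by
    have : ((√((d : ℝ) - 2))⁻¹) ^ 2 * ((d : ℝ) - 2) = 1 := by
      rw [inv_pow, Real.sq_sqrt (by linarith), inv_mul_cancel₀ (by linarith)]
    rw [ha]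
    exact_mod_cast this
  set y : Fin d → ℂ := fun i => ((x i : ℝ) : ℂ) with hy
  set u : Fin d → ℂ := fun i => (f.1 i : Euc d → ℂ) x with hu
  set g : Fin d → ℂ := fun i => (f.2 i : Euc d → ℂ) x with hg
  set D : Fin d → Fin d → ℂ := fun i m => (pd m (f.1 i) : Euc d → ℂ) x with hD
  have hp : ∀ i, (profile d i : Euc d → ℂ) x = a * y i := fun i => rfl
  have hpd : ∀ i m, (pd m (profile d i) : Euc d → ℂ) x = a * (if i = m then 1 else 0) := by
    intro i m
    rw [profile, map_smul, ← pd_coord m i hx]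
    rfl
  have hl : ∀ i, (lam (profile d) i : Euc d → ℂ) x = a * y i := by
    intro i
    have : (lam (profile d) i : Euc d → ℂ) x
        = ∑ j, y j * (pd j (profile d i) : Euc d → ℂ) x := by
      simp [lam, hy, coord]
    rw [this]
    simp [hpd, mul_comm]
  set R : ℂ := ∑ i, y i ^ 2 with hR
  have hRx : R = ((‖x‖ ^ 2 : ℝ) : ℂ) := by
    rw [EuclideanSpace.norm_sq_eq]
    simp [hR, hy]
  have hden : (d : ℂ) - 2 + R ≠ 0 := by
    have : 0 < (d : ℝ) - 2 + ‖x‖ ^ 2 := by nlinarith [sq_nonneg ‖x‖]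
    rw [hRx]
    exact_mod_cast this.ne'
  have ha0 : a ≠ 0 := by
    rintro h
    simp [h] at ha2
  have hval : ((perturb hd f).2 n : Euc d → ℂ) x
      = 2 * ((d : ℂ) - 2 - R) * ((d : ℂ) - 2 + R)⁻¹ * u n
        + 4 * ((d : ℂ) - 2 + R)⁻¹ * (R * g n - ∑ j, y j * D n j
          + (y n * (∑ j, D j j) - ∑ j, y j * D j n)) := by
    have hq : (pot hd : Euc d → ℂ) x = ((d : ℂ) - 2 + R)⁻¹ := by
      rw [hRx]
      simp [pot]
    have hn : (normSq d : Euc d → ℂ) x = R := by rw [normSq_apply, hRx]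
    have hlam : (lam f.1 n : Euc d → ℂ) x = ∑ j, y j * D n j := by
      simp [lam, hy, coord, hD]
    have hk : (kop f.1 n : Euc d → ℂ) x = y n * (∑ j, D j j) - ∑ j, y j * D j n := by
      simp [kop, hy, coord, hD, Finset.mul_sum]
    have : ((perturb hd f).2 n : Euc d → ℂ) x
        = 2 * ((d : ℂ) - 2 - (normSq d : Euc d → ℂ) x) * (pot hd : Euc d → ℂ) x * u n
          + 4 * (pot hd : Euc d → ℂ) x * ((normSq d : Euc d → ℂ) x * g n
            - (lam f.1 n : Euc d → ℂ) x + (kop f.1 n : Euc d → ℂ) x) := rfl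
    rw [this, hq, hn, hlam, hk]
  simp only [nonlin_eq, hp, hpd, hl]
  rw [hval]
  have lin : ∀ b c : ℂ, HasDerivAt (fun s : ℂ => b + s * c) c 0 := by
    intro b c
    simpa using ((hasDerivAt_id (0 : ℂ)).mul_const c).const_add b
  have h1 := (HasDerivAt.fun_sum (u := Finset.univ)
    fun i _ => (lin (a * y i) (u i)).fun_pow 2).const_add 1
  have h2 := HasDerivAt.fun_sum (u := Finset.univ)
    fun i _ => (lin (a * y i) (u i)).fun_mul (lin (a * y i) (g i))
  have h3' := HasDerivAt.fun_sum (u := Finset.univ) fun i _ => (lin (a * y i) (g i)).fun_pow 2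
  have h4 := HasDerivAt.fun_sum (u := Finset.univ) fun m _ =>
    (HasDerivAt.fun_sum (u := Finset.univ) fun i _ =>
      (lin (a * y i) (u i)).fun_mul (lin (a * (if i = m then 1 else 0)) (D i m))).fun_mul
      (lin (a * (if n = m then 1 else 0)) (D n m))
  have h5 := HasDerivAt.fun_sum (u := Finset.univ) fun i _ =>
    HasDerivAt.fun_sum (u := Finset.univ) fun m _ =>
      (lin (a * (if i = m then 1 else 0)) (D i m)).fun_pow 2
  have hQ : 1 + a ^ 2 * R ≠ 0 := by
    intro h
    apply hden
    have : a ^ 2 * ((d : ℂ) - 2 + R) = 0 := by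
      rw [mul_add, ha2, h]
    exact (mul_eq_zero.mp this).resolve_left (pow_ne_zero 2 ha0)
  have hQs : ∑ i, (a * y i) ^ 2 = a ^ 2 * R := by
    simp [mul_pow, hR, Finset.mul_sum]
  have H := ((((hasDerivAt_const (0 : ℂ) (-2 : ℂ)).fun_div h1
    (by simpa [hQs] using hQ)).fun_mul
    (((((h2.const_mul 2).fun_mul (lin (a * y n) (g n))).fun_sub
      ((lin (a * y n) (u n)).fun_mul h3')).fun_sub (h4.const_mul 2)).fun_add
      ((lin (a * y n) (u n)).fun_mul h5)))).fun_neg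
  refine H.congr_deriv ?_
  simp only [zero_mul, add_zero, Nat.cast_ofNat, Nat.add_one_sub_one, pow_one, zero_sub, mul_ite,
    mul_one, mul_zero, ite_mul, Finset.sum_ite_eq, Finset.sum_ite_eq', Finset.mem_univ, if_true,
    add_mul, mul_add, Finset.sum_add_distrib, ite_pow]
  have s1 : ∑ i, 2 * (a * y i) * u i = 2 * a * ∑ i, y i * u i := by
    rw [Finset.mul_sum]
    exact Finset.sum_congr rfl fun i _ => by ring
  have s2 : ∑ i, a * y i * (a * y i) = a ^ 2 * R := by
    rw [← hQs]
    exact Finset.sum_congr rfl fun i _ => by ring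
  have s3 : ∑ i, u i * (a * y i) = a * ∑ i, y i * u i := by
    rw [Finset.mul_sum]
    exact Finset.sum_congr rfl fun i _ => by ring
  have s4 : ∑ i, a * y i * g i = a * ∑ i, y i * g i := by
    rw [Finset.mul_sum]
    exact Finset.sum_congr rfl fun i _ => by ring
  have s5 : ∑ i, 2 * (a * y i) * g i = 2 * a * ∑ i, y i * g i := by
    rw [Finset.mul_sum]
    exact Finset.sum_congr rfl fun i _ => by ring
  have s6 : ∑ i, a * y i * D i n = a * ∑ i, y i * D i n := by
    rw [Finset.mul_sum]
    exact Finset.sum_congr rfl fun i _ => by ring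
  have s7 : ∑ i, a * y i * a * D n i = a ^ 2 * ∑ i, y i * D n i := by
    rw [Finset.mul_sum]
    exact Finset.sum_congr rfl fun i _ => by ring
  have s8 : ∑ i, 2 * a * D i i = 2 * a * ∑ i, D i i := by rw [Finset.mul_sum]
  have s9 : ∑ i : Fin d, ∑ j : Fin d, (if i = j then a ^ 2 else 0 ^ 2) = d * a ^ 2 := by
    simp
  rw [s1, s2, s3, s4, s5, s6, s7, s8, s9, hQs]
  have hde : (d : ℂ) = 2 + (a ^ 2)⁻¹ := by
    linear_combination eq_inv_of_mul_eq_one_right ha2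
  have hr : ((d : ℂ) - 2 + R)⁻¹ = a ^ 2 * (1 + a ^ 2 * R)⁻¹ := by
    have : (d : ℂ) - 2 + R = (a ^ 2)⁻¹ * (1 + a ^ 2 * R) := by
      rw [hde, mul_add, inv_mul_cancel_left₀ (pow_ne_zero 2 ha0)]
      ring
    rw [this, mul_inv, inv_inv]
  rw [hr, hde]
  field_simp
  ring

/-! ### Inner products -/

/-- `(f | g)_{L²}` on the unit ball. -/
def l2Ball {d : ℕ} (f g : Smooth d) : ℂ :=
  ∫ x in Metric.ball (0 : Euc d) 1, (f : Euc d → ℂ) x * conj ((g : Euc d → ℂ) x)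

/-- `(f | g)_{L²}` on the unit sphere, with its (not normalized) surface measure. -/
def l2Sphere {d : ℕ} (f g : Smooth d) : ℂ :=
  ∫ x : Metric.sphere (0 : Euc d) 1, (f : Euc d → ℂ) x * conj ((g : Euc d → ℂ) x)
    ∂(volume : Measure (Euc d)).toSphere

/-- The inner product
`(f₁ | g₁)_{Ḣ¹} + (f₂ | g₂)_{L²(ball)} + (f₁ | g₁)_{L²(sphere)}` on pairs. -/
def energyOne {d : ℕ} (f g : SmoothPair d) : ℂ :=
  ∑ i, ∑ j, l2Ball (pd i (f.1 j)) (pd i (g.1 j)) + ∑ j, l2Ball (f.2 j) (g.2 j)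
    + ∑ j, l2Sphere (f.1 j) (g.1 j)

/-- The homogeneous form of order `k` (used for `k ≥ 2`): the sum over all
`(i_1, …, i_{k-1})` of the first-order inner products of the iterated derivatives. -/
def energyDot {d : ℕ} (k : ℕ) (f g : SmoothPair d) : ℂ :=
  ∑ i : Fin (k - 1) → Fin d, energyOne (pdIter i f) (pdIter i g)

/-- The inner product of order `k ≥ 1`. -/
def energy {d : ℕ} (k : ℕ) (f g : SmoothPair d) : ℂ :=
  if k ≤ 1 then energyOne f g else energyDot k f g + energyOne f g

/-- Positive semidefinite Hermitian forms, linear in the first argument. -/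
structure IsSemiInner {V : Type*} [AddCommGroup V] [Module ℂ V] (B : V → V → ℂ) : Prop where
  symm : ∀ f g, conj (B f g) = B g f
  nonneg : ∀ f, 0 ≤ (B f f).re
  add : ∀ f g h, B (f + g) h = B f h + B g h
  smul : ∀ (c : ℂ) f g, B (c • f) g = c * B f g

namespace IsSemiInner

variable {V W : Type*} [AddCommGroup V] [Module ℂ V] [AddCommGroup W] [Module ℂ W]

theorem fsum {ι : Type*} [Fintype ι] {B : ι → V → V → ℂ} (hB : ∀ i, IsSemiInner (B i)) :
    IsSemiInner fun f g => ∑ i, B i f g where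
  symm f g := by simp [map_sum, (hB _).symm]
  nonneg f := by
    rw [Complex.re_sum]
    exact Finset.sum_nonneg fun i _ => (hB i).nonneg f
  add f g h := by simp [(hB _).add, Finset.sum_add_distrib]
  smul c f g := by simp [(hB _).smul, Finset.mul_sum]

theorem plus {B C : V → V → ℂ} (hB : IsSemiInner B) (hC : IsSemiInner C) :
    IsSemiInner fun f g => B f g + C f g where
  symm f g := by simp [hB.symm, hC.symm]
  nonneg f := by
    rw [Complex.add_re]
    exact add_nonneg (hB.nonneg f) (hC.nonneg f)
  add f g h := by rw [hB.add, hC.add]; ring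
  smul c f g := by rw [hB.smul, hC.smul]; ring

theorem pull {B : V → V → ℂ} (hB : IsSemiInner B) (T : W →ₗ[ℂ] V) :
    IsSemiInner fun f g => B (T f) (T g) where
  symm f g := hB.symm _ _
  nonneg f := hB.nonneg _
  add f g h := by simp [hB.add]
  smul c f g := by simp [hB.smul]

theorem add_right {B : V → V → ℂ} (hB : IsSemiInner B) (f g h : V) :
    B h (f + g) = B h f + B h g := by
  rw [← hB.symm, hB.add, map_add, hB.symm, hB.symm]

theorem smul_right {B : V → V → ℂ} (hB : IsSemiInner B) (c : ℂ) (f g : V) :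
    B g (c • f) = conj c * B g f := by
  rw [← hB.symm, hB.smul, map_mul, hB.symm]

/-- Mathlib's `inner` is linear in its second argument, hence the exchange of the arguments. -/
@[reducible]
def toCore {B : V → V → ℂ} (hB : IsSemiInner B) : PreInnerProductSpace.Core ℂ V where
  inner f g := B g f
  conj_inner_symm _ _ := hB.symm _ _
  re_inner_nonneg f := hB.nonneg f
  add_left f g h := hB.add_right f g h
  smul_left f g c := hB.smul_right c f g

end IsSemiInner

theorem continuousOn_mul_conj {d : ℕ} (f g : Smooth d) :
    ContinuousOn (fun x => (f : Euc d → ℂ) x * conj ((g : Euc d → ℂ) x)) (cball d) :=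
  ContinuousOn.mul (ContDiffOn.continuousOn f.2)
    (Complex.continuous_conj.comp_continuousOn (ContDiffOn.continuousOn g.2))

theorem integrable_ball {d : ℕ} (f g : Smooth d) :
    Integrable (fun x => (f : Euc d → ℂ) x * conj ((g : Euc d → ℂ) x))
      (volume.restrict (Metric.ball (0 : Euc d) 1)) :=
  ((continuousOn_mul_conj f g).integrableOn_compact (isCompact_closedBall 0 1)).mono_set
    Metric.ball_subset_closedBall

theorem integrable_sphere {d : ℕ} (f g : Smooth d) :
    Integrable (fun x : Metric.sphere (0 : Euc d) 1 =>
      (f : Euc d → ℂ) x * conj ((g : Euc d → ℂ) x)) (volume : Measure (Euc d)).toSphere := by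
  have h : Continuous (fun x : Metric.sphere (0 : Euc d) 1 =>
      (f : Euc d → ℂ) x * conj ((g : Euc d → ℂ) x)) :=
    (continuousOn_mul_conj f g).comp_continuous continuous_subtype_val
      fun x => Metric.sphere_subset_closedBall x.2
  exact h.integrable_of_hasCompactSupport (HasCompactSupport.of_compactSpace _)

theorem isSemiInner_integral {d : ℕ} {X : Type*} [MeasurableSpace X] (μ : Measure X)
    (p : X → Euc d)
    (hi : ∀ f g : Smooth d, Integrable
      (fun x => (f : Euc d → ℂ) (p x) * conj ((g : Euc d → ℂ) (p x))) μ) :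
    IsSemiInner fun f g : Smooth d =>
      ∫ x, (f : Euc d → ℂ) (p x) * conj ((g : Euc d → ℂ) (p x)) ∂μ where
  symm f g := by
    rw [← integral_conj]
    simp [mul_comm]
  nonneg f := by
    have h : ∀ x, (f : Euc d → ℂ) (p x) * conj ((f : Euc d → ℂ) (p x))
        = ((Complex.normSq ((f : Euc d → ℂ) (p x)) : ℝ) : ℂ) := fun x => Complex.mul_conj _
    simp only [h, integral_complex_ofReal, Complex.ofReal_re]
    exact integral_nonneg fun x => Complex.normSq_nonneg _
  add f g h := by
    rw [← integral_add (hi f h) (hi g h)]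
    simp [add_mul]
  smul c f g := by
    rw [← integral_const_mul]
    simp [mul_assoc]

theorem isSemiInner_l2Ball {d : ℕ} : IsSemiInner (l2Ball (d := d)) :=
  isSemiInner_integral _ (fun x => x) integrable_ball

theorem isSemiInner_l2Sphere {d : ℕ} : IsSemiInner (l2Sphere (d := d)) :=
  isSemiInner_integral _ (fun x : Metric.sphere (0 : Euc d) 1 => (x : Euc d)) integrable_sphere

theorem isSemiInner_energyOne {d : ℕ} : IsSemiInner (energyOne (d := d)) := by
  let u : Fin d → SmoothPair d →ₗ[ℂ] Smooth d := fun j =>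
    { toFun := fun f => f.1 j, map_add' := fun _ _ => rfl, map_smul' := fun _ _ => rfl }
  let v : Fin d → SmoothPair d →ₗ[ℂ] Smooth d := fun j =>
    { toFun := fun f => f.2 j, map_add' := fun _ _ => rfl, map_smul' := fun _ _ => rfl }
  have p1 : ∀ j : Fin d, IsSemiInner fun f g : SmoothPair d => l2Sphere (f.1 j) (g.1 j) :=
    fun j => isSemiInner_l2Sphere.pull (u j)
  have p2 : ∀ j : Fin d, IsSemiInner fun f g : SmoothPair d => l2Ball (f.2 j) (g.2 j) :=
    fun j => isSemiInner_l2Ball.pull (v j)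
  have p3 : ∀ i j : Fin d, IsSemiInner fun f g : SmoothPair d =>
      l2Ball (pd i (f.1 j)) (pd i (g.1 j)) :=
    fun i j => (isSemiInner_l2Ball.pull (pd i)).pull (u j)
  exact ((IsSemiInner.fsum fun i => IsSemiInner.fsum (p3 i)).plus (IsSemiInner.fsum p2)).plus
    (IsSemiInner.fsum p1)

theorem isSemiInner_energyDot {d : ℕ} (k : ℕ) : IsSemiInner (energyDot (d := d) k) :=
  IsSemiInner.fsum fun i => isSemiInner_energyOne.pull (pdIter i)

theorem isSemiInner_energy {d : ℕ} (k : ℕ) : IsSemiInner (energy (d := d) k) := by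
  unfold energy
  split_ifs
  · exact isSemiInner_energyOne
  · exact (isSemiInner_energyDot k).plus isSemiInner_energyOne

/-! ### The Hilbert spaces -/

/-- Smooth pairs, equipped below with the inner product of order `k`. -/
def PreSobolev (d _k : ℕ) : Type := SmoothPair d

instance (d k : ℕ) : SeminormedAddCommGroup (PreSobolev d k) :=
  @InnerProductSpace.Core.toSeminormedAddCommGroup ℂ (SmoothPair d) _ _ _
    (isSemiInner_energy (d := d) k).toCore

instance (d k : ℕ) : InnerProductSpace ℂ (PreSobolev d k) :=
  InnerProductSpace.ofCore (isSemiInner_energy (d := d) k).toCore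

/-- The Hilbert space of order `k`: the completion of the smooth pairs with respect to the
norm induced by `energy k`. -/
abbrev Sobolev (d k : ℕ) : Type := UniformSpace.Completion (PreSobolev d k)

/-- A smooth pair as an element of the Hilbert space of order `k`. -/
def toSobolev {d : ℕ} (k : ℕ) (f : SmoothPair d) : Sobolev d k :=
  let g : PreSobolev d k := f
  (g : UniformSpace.Completion (PreSobolev d k))

theorem inner_toSobolev {d : ℕ} (k : ℕ) (f g : SmoothPair d) :
    inner ℂ (toSobolev k g) (toSobolev k f) = energy k f g :=
  UniformSpace.Completion.inner_coe _ _

/-- `C > 0` bounds the contribution of `L₀'` to the highest-order terms: for every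
`k ≥ 2` there is `c_k > 0` such that
`|(L₀' f | f)_{Ḣ^k}| ≤ C ‖f‖²_{Ḣ^k} + c_k ‖f‖²_{H^{k-1}}` for all `f`.
The constant `C` does not depend on `k`. -/
def IsHighestOrderBound {d : ℕ} (hd : 3 ≤ d) (C : ℝ) : Prop :=
  0 < C ∧ ∀ k : ℕ, 2 ≤ k → ∃ c : ℝ, 0 < c ∧ ∀ f : SmoothPair d,
    ‖energyDot k (perturb hd f) f‖
      ≤ C * (energyDot k f f).re + c * (energy (k - 1) f f).re

end WaveMaps

end

/-!
The generator `L₀ = L + L₀'` is dissipative up to lower-order terms, and the lower-order terms are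
compact, so that finitely many directions suffice to absorb them.

*Dissipation.* On pairs, `L` satisfies `Re (L f | f)_{H¹} ≤ (d/2 - 1) ‖f‖²`: integrating by parts on
the ball leaves boundary terms that are bounded by `½ ‖f₁‖²` on the sphere after completing a square
(`re_energyOne_freeGen_le`). Since `∂_i L = (L - 1) ∂_i`, each derivative gains `-1`, which gives
`Re (L f | f) ≤ (d/2 - k) ‖f‖²` for the homogeneous form of order `k` (`re_energyDot_freeGen_le`).
The perturbation `L₀'` is of first order in `f₁` and of order zero in `f₂`; by Leibniz' rule the top
order of its derivatives has a bound independent of `k`, and the rest consists of derivatives of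
lower order (`IsFirstOrder`, `exists_derivSq_mul_le`). Together with an interpolation inequality for
intermediate derivatives (`exists_derivSq_le`), this proves the existence of `C`. For
`k ≥ d/2 + 1 + C` the two estimates add up to `Re (L₀ f | f)_{H^k} ≤ -‖f‖²_{H^k} + c ‖f‖²_{H^{k-1}}`
(`exists_re_energy_linGen_le`).

*Compactness.* On a convex set, the deviation of a function from its mean is controlled by the
diameter times the gradient (`integral_norm_mul_sub_sq_le`). On the cells of a fine grid this shows
that the `L²` norm is bounded by a small multiple of the `H¹` norm and finitely many means
(`relCompact_ballSq`). With the trace inequality for the boundary terms, the square of the norm of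
order `k - 1` is bounded by a small multiple of that of order `k` and the squares of finitely many
continuous linear functionals (`relCompact_energy`). The orthogonal projection onto the span of the
vectors which represent these functionals is the required `P` (`RelCompact.exists_projection`).

The divergence theorem on the ball (`intBall_pd`) is derived from its radial case, which is the
fundamental theorem of calculus in polar coordinates (`intSphere_eq`): it holds trivially for
functions with a double zero at the sphere, and multiplication by `1 - (1 - |ξ|^{2n})²` leaves the
defect unchanged, while the defect of `|ξ|^{2n} h` tends to zero as `n → ∞`.
-/

namespace WaveMaps

/-! ### Calculus in the algebra of smooth functions -/

theorem pd_off {d : ℕ} (i : Fin d) (f : Smooth d) {x : Euc d} (hx : x ∉ cball d) :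
    (pd i f : Euc d → ℂ) x = 0 := by
  change fderivWithin ℝ (f : Euc d → ℂ) (cball d) x (EuclideanSpace.single i 1) = 0
  rw [fderivWithin_off _ hx]
  rfl

/-- Since derivatives are set to zero off the closed ball, two of them agree as soon as they
agree on the ball. -/
theorem smooth_ext {d : ℕ} {f g : Smooth d}
    (h : ∀ x ∈ cball d, (f : Euc d → ℂ) x = (g : Euc d → ℂ) x)
    (hf : ∀ x ∉ cball d, (f : Euc d → ℂ) x = 0) (hg : ∀ x ∉ cball d, (g : Euc d → ℂ) x = 0) :
    f = g := by
  ext x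
  by_cases hx : x ∈ cball d
  · exact h x hx
  · rw [hf x hx, hg x hx]

theorem pd_mul {d : ℕ} (i : Fin d) (f g : Smooth d) :
    pd i (f * g) = pd i f * g + f * pd i g := by
  refine smooth_ext (fun x hx => ?_) (fun x hx => pd_off i _ hx) (fun x hx => ?_)
  · change fderivWithin ℝ ((f : Euc d → ℂ) * (g : Euc d → ℂ)) (cball d) x
      (EuclideanSpace.single i 1) = (pd i f : Euc d → ℂ) x * (g : Euc d → ℂ) x
        + (f : Euc d → ℂ) x * (pd i g : Euc d → ℂ) x
    rw [fderivWithin_mul (uniqueDiffOn_cball d x hx) (differentiableWithinAt f hx)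
      (differentiableWithinAt g hx)]
    simp only [add_apply, smul_apply, smul_eq_mul]
    rw [add_comm, mul_comm ((g : Euc d → ℂ) x)]
    rfl
  · change (pd i f : Euc d → ℂ) x * (g : Euc d → ℂ) x
        + (f : Euc d → ℂ) x * (pd i g : Euc d → ℂ) x = 0
    rw [pd_off i _ hx, pd_off i _ hx]
    ring

theorem pd_algebraMap {d : ℕ} (i : Fin d) (c : ℂ) : pd i (algebraMap ℂ (Smooth d) c) = 0 := by
  refine smooth_ext (fun x hx => ?_) (fun x hx => pd_off i _ hx) (fun x hx => rfl)
  change fderivWithin ℝ (fun _ => c) (cball d) x (EuclideanSpace.single i 1) = 0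
  simp

theorem pd_one {d : ℕ} (i : Fin d) : pd i (1 : Smooth d) = 0 := by
  rw [← map_one (algebraMap ℂ (Smooth d)), pd_algebraMap]

theorem pd_pd_apply {d : ℕ} (i j : Fin d) (f : Smooth d) {x : Euc d} (hx : x ∈ cball d) :
    (pd i (pd j f) : Euc d → ℂ) x = fderivWithin ℝ (fderivWithin ℝ (f : Euc d → ℂ) (cball d))
      (cball d) x (EuclideanSpace.single i 1) (EuclideanSpace.single j 1) := by
  change fderivWithin ℝ (fun y => fderivWithin ℝ (f : Euc d → ℂ) (cball d) y
    (EuclideanSpace.single j 1)) (cball d) x (EuclideanSpace.single i 1) = _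
  have h : DifferentiableWithinAt ℝ (fderivWithin ℝ (f : Euc d → ℂ) (cball d)) (cball d) x :=
    ((ContDiffOn.fderivWithin (m := ∞) f.2 (uniqueDiffOn_cball d)
      (by simp)).differentiableOn (by simp)) x hx
  rw [fderivWithin_clm_apply (uniqueDiffOn_cball d x hx) h (by fun_prop)]
  simp

theorem pd_comm {d : ℕ} (i j : Fin d) (f : Smooth d) : pd i (pd j f) = pd j (pd i f) := by
  refine smooth_ext (fun x hx => ?_) (fun x hx => pd_off i _ hx) (fun x hx => pd_off j _ hx)
  rw [pd_pd_apply i j f hx, pd_pd_apply j i f hx]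
  have hc : x ∈ closure (interior (cball d)) := by
    rw [interior_closedBall _ one_ne_zero, closure_ball _ one_ne_zero]
    exact hx
  exact (ContDiffOn.contDiffWithinAt f.2 hx).isSymmSndFDerivWithinAt
    (by simpa using WithTop.coe_le_coe.2 (le_top : (2 : ℕ∞) ≤ ⊤)) (uniqueDiffOn_cball d) hc hx _ _

theorem pd_coord_mul_pd {d : ℕ} (m n i : Fin d) (f : Smooth d) :
    pd m (coord n) * pd i f = if n = m then pd i f else 0 := by
  refine smooth_ext (fun x hx => ?_) (fun x hx => ?_) (fun x hx => ?_)
  · change (pd m (coord n) : Euc d → ℂ) x * (pd i f : Euc d → ℂ) x = _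
    rw [pd_coord m n hx]
    split_ifs <;> simp
  · change (pd m (coord n) : Euc d → ℂ) x * (pd i f : Euc d → ℂ) x = _
    rw [pd_off _ _ hx, zero_mul]
  · split_ifs
    · exact pd_off _ _ hx
    · rfl

/-- Complex conjugation of smooth functions. -/
noncomputable def conjS {d : ℕ} (f : Smooth d) : Smooth d :=
  ⟨fun x => conj ((f : Euc d → ℂ) x), by
    have h : ContDiff ℝ ∞ (fun z : ℂ => conj z) := Complex.conjCLE.contDiff
    exact h.comp_contDiffOn f.2⟩

theorem pd_conjS {d : ℕ} (i : Fin d) (f : Smooth d) : pd i (conjS f) = conjS (pd i f) := by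
  refine smooth_ext (fun x hx => ?_) (fun x hx => pd_off i _ hx) (fun x hx => ?_)
  · change fderivWithin ℝ (Complex.conjCLE ∘ (f : Euc d → ℂ)) (cball d) x
      (EuclideanSpace.single i 1) = _
    rw [Complex.conjCLE.comp_fderivWithin (uniqueDiffOn_cball d x hx)]
    rfl
  · change conj ((pd i f : Euc d → ℂ) x) = 0
    rw [pd_off _ _ hx, map_zero]

/-- The radial derivative `ξ^j ∂_j` of a single function. -/
noncomputable def rad {d : ℕ} (f : Smooth d) : Smooth d := ∑ j, coord j * pd j f

theorem rad_mul {d : ℕ} (f g : Smooth d) : rad (f * g) = rad f * g + f * rad g := by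
  simp only [rad, pd_mul, Finset.sum_mul, Finset.mul_sum, ← Finset.sum_add_distrib]
  exact Finset.sum_congr rfl fun j _ => by ring

theorem coe_sum {d : ℕ} {ι : Type*} (s : Finset ι) (f : ι → Smooth d) (x : Euc d) :
    ((∑ i ∈ s, f i : Smooth d) : Euc d → ℂ) x = ∑ i ∈ s, (f i : Euc d → ℂ) x := by
  simp

theorem conjS_coord_mul {d : ℕ} (j : Fin d) (f : Smooth d) :
    conjS (coord j * f) = coord j * conjS f := by
  ext x
  change conj (((x j : ℝ) : ℂ) * (f : Euc d → ℂ) x) = ((x j : ℝ) : ℂ) * conj ((f : Euc d → ℂ) x)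
  simp

theorem conjS_rad {d : ℕ} (f : Smooth d) : conjS (rad f) = rad (conjS f) := by
  have h : conjS (rad f) = ∑ j, conjS (coord j * pd j f) := by
    ext x
    rw [coe_sum]
    change conj ((rad f : Euc d → ℂ) x) = ∑ j, conj ((coord j * pd j f : Smooth d).1 x)
    rw [rad, coe_sum, map_sum]
  rw [h, rad]
  exact Finset.sum_congr rfl fun j _ => by rw [conjS_coord_mul, pd_conjS]

theorem pd_rad {d : ℕ} (i : Fin d) (f : Smooth d) : pd i (rad f) = rad (pd i f) + pd i f := by
  simp only [rad, map_sum, pd_mul, pd_coord_mul_pd, Finset.sum_add_distrib]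
  rw [add_comm]
  congr 1
  · exact Finset.sum_congr rfl fun j _ => by rw [pd_comm]
  · simp

theorem fderivWithin_apply_eq_sum {d : ℕ} (f : Smooth d) (x v : Euc d) :
    fderivWithin ℝ (f : Euc d → ℂ) (cball d) x v = ∑ j, ((v j : ℝ) : ℂ) * (pd j f).1 x := by
  have hs : v = ∑ j, v j • EuclideanSpace.single j (1 : ℝ) := by
    ext k
    simp [Finset.sum_apply, Pi.single_apply]
  conv_lhs => rw [hs, map_sum]
  refine Finset.sum_congr rfl fun j _ => ?_
  rw [map_smul, Complex.real_smul]
  rfl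

theorem rad_apply {d : ℕ} (f : Smooth d) (x : Euc d) :
    (rad f : Euc d → ℂ) x = fderivWithin ℝ (f : Euc d → ℂ) (cball d) x x := by
  rw [rad, coe_sum, fderivWithin_apply_eq_sum]
  rfl

/-! ### Integrals over the ball and the sphere -/

theorem continuousOn_smooth {d : ℕ} (f : Smooth d) : ContinuousOn (f : Euc d → ℂ) (cball d) :=
  ContDiffOn.continuousOn f.2

theorem integrableOn_ball {d : ℕ} (f : Smooth d) :
    IntegrableOn (f : Euc d → ℂ) (Metric.ball 0 1) :=
  ((continuousOn_smooth f).integrableOn_compact (isCompact_closedBall 0 1)).mono_set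
    Metric.ball_subset_closedBall

theorem integrable_sphere_coe {d : ℕ} (f : Smooth d) :
    Integrable (fun x : Metric.sphere (0 : Euc d) 1 => (f : Euc d → ℂ) x)
      (volume : Measure (Euc d)).toSphere := by
  have h : Continuous (fun x : Metric.sphere (0 : Euc d) 1 => (f : Euc d → ℂ) x) :=
    (continuousOn_smooth f).comp_continuous continuous_subtype_val
      fun x => Metric.sphere_subset_closedBall x.2
  exact h.integrable_of_hasCompactSupport (HasCompactSupport.of_compactSpace _)

/-- The integral over the ball. -/
noncomputable def intBall {d : ℕ} : Smooth d →ₗ[ℂ] ℂ where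
  toFun f := ∫ x in Metric.ball (0 : Euc d) 1, (f : Euc d → ℂ) x
  map_add' f g := integral_add (integrableOn_ball f) (integrableOn_ball g)
  map_smul' c _ := integral_const_mul c _

/-- The integral over the sphere. -/
noncomputable def intSphere {d : ℕ} : Smooth d →ₗ[ℂ] ℂ where
  toFun f := ∫ x : Metric.sphere (0 : Euc d) 1, (f : Euc d → ℂ) x
    ∂(volume : Measure (Euc d)).toSphere
  map_add' f g := integral_add (integrable_sphere_coe f) (integrable_sphere_coe g)
  map_smul' c _ := integral_const_mul c _

theorem l2Ball_eq {d : ℕ} (f g : Smooth d) : l2Ball f g = intBall (f * conjS g) := rfl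

theorem l2Sphere_eq {d : ℕ} (f g : Smooth d) : l2Sphere f g = intSphere (f * conjS g) := rfl

/-- The squared `L²` norm on the ball. -/
noncomputable def ballSq {d : ℕ} (f : Smooth d) : ℝ := (l2Ball f f).re

/-- The squared `L²` norm on the sphere. -/
noncomputable def sphSq {d : ℕ} (f : Smooth d) : ℝ := (l2Sphere f f).re

/-- The squared `L²` norm of the gradient. -/
noncomputable def gradSq {d : ℕ} (f : Smooth d) : ℝ := ∑ i, ballSq (pd i f)

theorem ballSq_nonneg {d : ℕ} (f : Smooth d) : 0 ≤ ballSq f := isSemiInner_l2Ball.nonneg f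

theorem sphSq_nonneg {d : ℕ} (f : Smooth d) : 0 ≤ sphSq f := isSemiInner_l2Sphere.nonneg f

theorem gradSq_nonneg {d : ℕ} (f : Smooth d) : 0 ≤ gradSq f :=
  Finset.sum_nonneg fun _ _ => ballSq_nonneg _

namespace IsSemiInner

variable {V : Type*} [AddCommGroup V] [Module ℂ V] {B : V → V → ℂ}

theorem norm_sq_le (hB : IsSemiInner B) (f g : V) :
    ‖B f g‖ ^ 2 ≤ (B f f).re * (B g g).re := by
  have h : ‖B g f‖ * ‖B f g‖ ≤ (B f f).re * (B g g).re :=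
    @InnerProductSpace.Core.inner_mul_inner_self_le ℂ V _ _ _ hB.toCore f g
  rwa [← hB.symm f g, Complex.norm_conj, ← pow_two] at h

theorem two_norm_le (hB : IsSemiInner B) (f g : V) :
    2 * ‖B f g‖ ≤ (B f f).re + (B g g).re := by
  have h := hB.norm_sq_le f g
  have h1 := hB.nonneg f
  have h2 := hB.nonneg g
  refine abs_le_of_sq_le_sq' ?_ (by positivity) |>.2
  nlinarith [sq_nonneg ((B f f).re - (B g g).re)]

theorem re_symm (hB : IsSemiInner B) (f g : V) : (B f g).re = (B g f).re := by
  rw [← hB.symm g f, Complex.conj_re]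

theorem neg (hB : IsSemiInner B) (f g : V) : B (-f) g = -B f g := by
  have := hB.smul (-1) f g
  simpa using this

theorem sub (hB : IsSemiInner B) (f g h : V) : B (f - g) h = B f h - B g h := by
  rw [sub_eq_add_neg, hB.add, hB.neg, sub_eq_add_neg]

theorem zero (hB : IsSemiInner B) (f : V) : B 0 f = 0 := by
  have := hB.smul 0 0 f
  simpa using this

theorem sum (hB : IsSemiInner B) {ι : Type*} (s : Finset ι) (F : ι → V) (g : V) :
    B (∑ i ∈ s, F i) g = ∑ i ∈ s, B (F i) g := by
  induction s using Finset.cons_induction with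
  | empty => simp [hB.zero]
  | cons a s ha ih => rw [Finset.sum_cons, Finset.sum_cons, hB.add, ih]

theorem re_add_self (hB : IsSemiInner B) (f g : V) :
    (B (f + g) (f + g)).re = (B f f).re + (B g g).re + 2 * (B f g).re := by
  rw [hB.add, hB.add_right, hB.add_right]
  simp only [Complex.add_re]
  rw [hB.re_symm g f]
  ring

theorem neg_self (hB : IsSemiInner B) (f : V) : (B (-f) (-f)).re = (B f f).re := by
  have h := hB.smul_right (-1) f (-f)
  rw [neg_smul, one_smul] at h
  rw [h, hB.neg]
  simp

end IsSemiInner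

theorem norm_l2Ball_sq_le {d : ℕ} (f g : Smooth d) : ‖l2Ball f g‖ ^ 2 ≤ ballSq f * ballSq g :=
  isSemiInner_l2Ball.norm_sq_le f g

theorem two_norm_l2Ball_le {d : ℕ} (f g : Smooth d) : 2 * ‖l2Ball f g‖ ≤ ballSq f + ballSq g :=
  isSemiInner_l2Ball.two_norm_le f g

theorem ballSq_neg {d : ℕ} (f : Smooth d) : ballSq (-f) = ballSq f :=
  isSemiInner_l2Ball.neg_self f

theorem ballSq_eq {d : ℕ} (f : Smooth d) :
    ballSq f = ∫ x in Metric.ball (0 : Euc d) 1, ‖(f : Euc d → ℂ) x‖ ^ 2 := by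
  rw [ballSq, l2Ball]
  have h : ∀ x, (f : Euc d → ℂ) x * conj ((f : Euc d → ℂ) x)
      = ((‖(f : Euc d → ℂ) x‖ ^ 2 : ℝ) : ℂ) := fun x => by
    rw [Complex.mul_conj, Complex.normSq_eq_norm_sq]
  simp only [h, integral_complex_ofReal, Complex.ofReal_re]

theorem sphSq_eq {d : ℕ} (f : Smooth d) :
    sphSq f = ∫ x : Metric.sphere (0 : Euc d) 1, ‖(f : Euc d → ℂ) x‖ ^ 2
      ∂(volume : Measure (Euc d)).toSphere := by
  rw [sphSq, l2Sphere]
  have h : ∀ x, (f : Euc d → ℂ) x * conj ((f : Euc d → ℂ) x)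
      = ((‖(f : Euc d → ℂ) x‖ ^ 2 : ℝ) : ℂ) := fun x => by
    rw [Complex.mul_conj, Complex.normSq_eq_norm_sq]
  simp only [h, integral_complex_ofReal, Complex.ofReal_re]

theorem integrableOn_ball_norm_sq {d : ℕ} (f : Smooth d) :
    IntegrableOn (fun x => ‖(f : Euc d → ℂ) x‖ ^ 2) (Metric.ball 0 1) :=
  (((continuousOn_smooth f).norm.pow 2).integrableOn_compact (isCompact_closedBall 0 1)).mono_set
    Metric.ball_subset_closedBall

theorem integrable_sphere_norm_sq {d : ℕ} (f : Smooth d) :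
    Integrable (fun x : Metric.sphere (0 : Euc d) 1 => ‖(f : Euc d → ℂ) x‖ ^ 2)
      (volume : Measure (Euc d)).toSphere := by
  have h : Continuous (fun x : Metric.sphere (0 : Euc d) 1 => ‖(f : Euc d → ℂ) x‖ ^ 2) :=
    ((continuousOn_smooth f).norm.pow 2).comp_continuous continuous_subtype_val
      fun x => Metric.sphere_subset_closedBall x.2
  exact h.integrable_of_hasCompactSupport (HasCompactSupport.of_compactSpace _)

theorem exists_bound {d : ℕ} (g : Smooth d) :
    ∃ M : ℝ, 0 ≤ M ∧ ∀ x ∈ cball d, ‖(g : Euc d → ℂ) x‖ ≤ M := by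
  obtain ⟨M, hM⟩ := (isCompact_closedBall (0 : Euc d) 1).exists_bound_of_continuousOn
    (continuousOn_smooth g)
  exact ⟨M, (norm_nonneg _).trans (hM 0 (by simp)), hM⟩

theorem exists_ballSq_mul_le {d : ℕ} (g : Smooth d) :
    ∃ M : ℝ, 0 ≤ M ∧ ∀ u : Smooth d, ballSq (g * u) ≤ M * ballSq u := by
  obtain ⟨M, hM0, hM⟩ := exists_bound g
  refine ⟨M ^ 2, by positivity, fun u => ?_⟩
  rw [ballSq_eq, ballSq_eq, ← integral_const_mul]
  refine setIntegral_mono_on (integrableOn_ball_norm_sq _)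
    ((integrableOn_ball_norm_sq _).const_mul _) measurableSet_ball fun x hx => ?_
  change ‖(g : Euc d → ℂ) x * (u : Euc d → ℂ) x‖ ^ 2 ≤ _
  rw [norm_mul, mul_pow]
  gcongr
  exact hM x (Metric.ball_subset_closedBall hx)

/-- Cauchy–Schwarz for the radial derivative, pointwise. -/
theorem norm_rad_sq_le {d : ℕ} (f : Smooth d) {x : Euc d} (hx : x ∈ cball d) :
    ‖(rad f : Euc d → ℂ) x‖ ^ 2 ≤ ∑ j, ‖(pd j f : Euc d → ℂ) x‖ ^ 2 := by
  have h1 : ‖(rad f : Euc d → ℂ) x‖ ≤ ∑ j, |x j| * ‖(pd j f : Euc d → ℂ) x‖ := by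
    rw [rad, coe_sum]
    refine (norm_sum_le _ _).trans (Finset.sum_le_sum fun j _ => ?_)
    change ‖((x j : ℝ) : ℂ) * (pd j f : Euc d → ℂ) x‖ ≤ _
    rw [norm_mul, Complex.norm_real, Real.norm_eq_abs]
  have h2 := Finset.sum_mul_sq_le_sq_mul_sq Finset.univ (fun j => |x j|)
    (fun j => ‖(pd j f : Euc d → ℂ) x‖)
  have h3 : ∑ j, |x j| ^ 2 ≤ 1 := by
    have := EuclideanSpace.norm_sq_eq x
    simp only [Real.norm_eq_abs] at this
    rw [← this]
    have hx' : ‖x‖ ≤ 1 := by simpa using hx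
    nlinarith [norm_nonneg x]
  calc ‖(rad f : Euc d → ℂ) x‖ ^ 2 ≤ (∑ j, |x j| * ‖(pd j f : Euc d → ℂ) x‖) ^ 2 := by gcongr
    _ ≤ _ := h2
    _ ≤ 1 * ∑ j, ‖(pd j f : Euc d → ℂ) x‖ ^ 2 := by gcongr
    _ = _ := one_mul _

theorem ballSq_rad_le {d : ℕ} (f : Smooth d) : ballSq (rad f) ≤ gradSq f := by
  simp only [gradSq, ballSq_eq]
  rw [← integral_finsetSum _ fun i _ => integrableOn_ball_norm_sq _]
  refine setIntegral_mono_on (integrableOn_ball_norm_sq _)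
    (integrable_finsetSum _ fun i _ => integrableOn_ball_norm_sq _) measurableSet_ball
    fun x hx => norm_rad_sq_le f (Metric.ball_subset_closedBall hx)

theorem sphSq_rad_le {d : ℕ} (f : Smooth d) : sphSq (rad f) ≤ ∑ i, sphSq (pd i f) := by
  simp only [sphSq_eq]
  rw [← integral_finsetSum _ fun i _ => integrable_sphere_norm_sq _]
  refine integral_mono (integrable_sphere_norm_sq _)
    (integrable_finsetSum _ fun i _ => integrable_sphere_norm_sq _)
    fun x => norm_rad_sq_le f (Metric.sphere_subset_closedBall x.2)

/-! ### Polar coordinates and the divergence theorem -/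

theorem integral_ball_polar {d : ℕ} (hd : 1 ≤ d) (f : Smooth d) :
    intBall f = ∫ θ : Metric.sphere (0 : Euc d) 1, (∫ r in Set.Ioo (0 : ℝ) 1,
      ((r ^ (d - 1) : ℝ) : ℂ) * (f : Euc d → ℂ) (r • (θ : Euc d)))
        ∂(volume : Measure (Euc d)).toSphere := by
  have : Nonempty (Fin d) := ⟨⟨0, hd⟩⟩
  set F : Euc d → ℂ := (Metric.ball (0 : Euc d) 1).indicator (f : Euc d → ℂ) with hF
  have hFi : Integrable F := (integrableOn_ball f).integrable_indicator measurableSet_ball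
  have hmp := (volume : Measure (Euc d)).measurePreserving_homeomorphUnitSphereProd
  have hdim : Module.finrank ℝ (Euc d) = d := by simp
  rw [hdim] at hmp
  let G : Metric.sphere (0 : Euc d) 1 × Set.Ioi (0 : ℝ) → ℂ :=
    fun p => F ((p.2 : ℝ) • (p.1 : Euc d))
  have hG : ∀ x : ({0}ᶜ : Set (Euc d)), G (homeomorphUnitSphereProd (Euc d) x) = F x := by
    intro x
    have hx : ‖(x : Euc d)‖ ≠ 0 := norm_ne_zero_iff.2 x.2
    simp only [G, homeomorphUnitSphereProd_apply_snd_coe, homeomorphUnitSphereProd_apply_fst_coe]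
    rw [smul_smul, mul_inv_cancel₀ hx, one_smul]
  have h1 : intBall f = ∫ p, G p
      ∂((volume : Measure (Euc d)).toSphere.prod (Measure.volumeIoiPow (d - 1))) := by
    rw [← hmp.integral_comp (Homeomorph.measurableEmbedding _)]
    simp only [hG]
    rw [integral_subtype_comap (measurableSet_singleton _).compl, restrict_compl_singleton, hF,
      integral_indicator measurableSet_ball]
    rfl
  have hGi : Integrable G
      ((volume : Measure (Euc d)).toSphere.prod (Measure.volumeIoiPow (d - 1))) := by
    rw [← hmp.integrable_comp_emb (Homeomorph.measurableEmbedding _)]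
    have : G ∘ homeomorphUnitSphereProd (Euc d) = F ∘ Subtype.val := funext hG
    rw [this, ← integrableOn_iff_comap_subtypeVal (measurableSet_singleton _).compl]
    exact hFi.integrableOn
  rw [h1, integral_prod _ hGi]
  refine integral_congr_ae (Filter.Eventually.of_forall fun θ => ?_)
  simp only [Measure.volumeIoiPow, ENNReal.ofReal]
  rw [integral_withDensity_eq_integral_smul (by fun_prop)]
  simp only [G]
  rw [integral_subtype_comap measurableSet_Ioi
      (fun r : ℝ => Real.toNNReal (r ^ (d - 1)) • F (r • (θ : Euc d))),
    ← Set.Ioi_inter_Iio, Set.inter_comm, ← Measure.restrict_restrict measurableSet_Iio,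
    ← integral_indicator measurableSet_Iio]
  refine setIntegral_congr_fun measurableSet_Ioi fun r hr => ?_
  have hr0 : (0 : ℝ) < r := hr
  have hn : ‖r • (θ : Euc d)‖ = r := by
    rw [norm_smul, mem_sphere_zero_iff_norm.1 θ.2, mul_one, Real.norm_of_nonneg hr0.le]
  by_cases h : r < 1
  · rw [Set.indicator_of_mem (show r ∈ Set.Iio (1 : ℝ) from h)]
    simp only [hF]
    rw [Set.indicator_of_mem (by simpa [hn] using h), NNReal.smul_def,
      Real.coe_toNNReal _ (pow_nonneg hr0.le _), Complex.real_smul]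
  · rw [Set.indicator_of_notMem (by simpa using h)]
    simp only [hF]
    rw [Set.indicator_of_notMem (by simpa [hn] using h), smul_zero]

theorem hasDerivAt_line {d : ℕ} (f : Smooth d) {a b : Euc d}
    (h : ∀ t ∈ Set.Icc (0 : ℝ) 1, a + t • b ∈ cball d) {t : ℝ} (ht : t ∈ Set.Ioo (0 : ℝ) 1) :
    HasDerivAt (fun t : ℝ => (f : Euc d → ℂ) (a + t • b))
      (fderivWithin ℝ (f : Euc d → ℂ) (cball d) (a + t • b) b) t := by
  have h1 := (differentiableWithinAt f (h t ⟨ht.1.le, ht.2.le⟩)).hasFDerivWithinAt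
  have h2 : HasDerivWithinAt (fun t : ℝ => a + t • b) b (Set.Icc 0 1) t := by
    simpa using (((hasDerivAt_id t).smul_const b).const_add a).hasDerivWithinAt
  exact (h1.comp_hasDerivWithinAt t h2 h).hasDerivAt (Icc_mem_nhds ht.1 ht.2)

theorem continuousOn_line {d : ℕ} (f : Smooth d) {a b : Euc d}
    (h : ∀ t ∈ Set.Icc (0 : ℝ) 1, a + t • b ∈ cball d) :
    ContinuousOn (fun t : ℝ => (f : Euc d → ℂ) (a + t • b)) (Set.Icc 0 1) :=
  (continuousOn_smooth f).comp (by fun_prop) h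

/-- The divergence theorem for the radial field `f(ξ) ξ`. -/
theorem intSphere_eq {d : ℕ} (hd : 1 ≤ d) (f : Smooth d) :
    intSphere f = (d : ℂ) * intBall f + intBall (rad f) := by
  have h0 : (d : ℂ) * intBall f + intBall (rad f) = intBall ((d : ℂ) • f + rad f) := by
    rw [map_add, map_smul, smul_eq_mul]
  rw [h0, integral_ball_polar hd]
  refine integral_congr_ae (Filter.Eventually.of_forall fun θ => ?_)
  have hθ : ‖(θ : Euc d)‖ = 1 := mem_sphere_zero_iff_norm.1 θ.2
  have hmem : ∀ t ∈ Set.Icc (0 : ℝ) 1, (0 : Euc d) + t • (θ : Euc d) ∈ cball d := by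
    intro t ht
    simp [norm_smul, hθ, abs_of_nonneg ht.1, ht.2]
  let g : ℝ → ℂ := fun r => ((r ^ d : ℝ) : ℂ) * (f : Euc d → ℂ) (0 + r • (θ : Euc d))
  let g' : ℝ → ℂ := fun r =>
    ((r ^ (d - 1) : ℝ) : ℂ) * (((d : ℂ) • f + rad f : Smooth d) : Euc d → ℂ) (0 + r • (θ : Euc d))
  have hpow : ∀ r : ℝ, HasDerivAt (fun r : ℝ => ((r ^ d : ℝ) : ℂ))
      (((d : ℝ) * r ^ (d - 1) : ℝ) : ℂ) r := fun r => (hasDerivAt_pow d r).ofReal_comp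
  have hder : ∀ r ∈ Set.Ioo (0 : ℝ) 1, HasDerivAt g (g' r) r := by
    intro r hr
    have h := (hpow r).mul (hasDerivAt_line f hmem hr)
    refine h.congr_deriv ?_
    have hrad := rad_apply f (0 + r • (θ : Euc d))
    simp only [zero_add, map_smul, Complex.real_smul] at hrad
    have hval : g' r = ((r ^ (d - 1) : ℝ) : ℂ) * ((d : ℂ) * (f : Euc d → ℂ) (0 + r • (θ : Euc d))
      + (rad f : Euc d → ℂ) (0 + r • (θ : Euc d))) := rfl
    rw [hval]
    simp only [zero_add] at *
    rw [hrad]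
    obtain ⟨m, rfl⟩ : ∃ m, d = m + 1 := ⟨d - 1, by omega⟩
    push_cast
    ring
  have hcont : ContinuousOn g (Set.Icc 0 1) :=
    ContinuousOn.mul (by fun_prop) (continuousOn_line f hmem)
  have hcont' : ContinuousOn g' (Set.Icc 0 1) :=
    ContinuousOn.mul (by fun_prop) (continuousOn_line _ hmem)
  have hint : IntervalIntegrable g' volume 0 1 := by
    apply ContinuousOn.intervalIntegrable
    rwa [Set.uIcc_of_le zero_le_one]
  have key := intervalIntegral.integral_eq_sub_of_hasDeriv_right_of_le zero_le_one hcont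
    (fun r hr => (hder r hr).hasDerivWithinAt) hint
  have hg1 : g 1 = (f : Euc d → ℂ) θ := by simp [g]
  have hg0 : g 0 = 0 := by
    simp [g, show d ≠ 0 by omega]
  rw [hg1, hg0, sub_zero, intervalIntegral.integral_of_le zero_le_one,
    integral_Ioc_eq_integral_Ioo] at key
  simp only [g', zero_add] at key
  exact key.symm

theorem intBall_congr {d : ℕ} {f g : Smooth d}
    (h : ∀ x ∈ Metric.ball (0 : Euc d) 1, (f : Euc d → ℂ) x = (g : Euc d → ℂ) x) :
    intBall f = intBall g :=
  setIntegral_congr_fun measurableSet_ball h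

theorem intSphere_congr {d : ℕ} {f g : Smooth d}
    (h : ∀ x : Euc d, ‖x‖ = 1 → (f : Euc d → ℂ) x = (g : Euc d → ℂ) x) :
    intSphere f = intSphere g :=
  integral_congr_ae (Filter.Eventually.of_forall fun x =>
    h x (mem_sphere_zero_iff_norm.1 x.2))

theorem pd_normSq_apply {d : ℕ} (i : Fin d) {x : Euc d} (hx : x ∈ cball d) :
    (pd i (normSq d) : Euc d → ℂ) x = 2 * ((x i : ℝ) : ℂ) := by
  rw [normSq, map_sum, coe_sum]
  have h : ∀ j, (pd i (coord j * coord j) : Euc d → ℂ) x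
      = if j = i then 2 * ((x i : ℝ) : ℂ) else 0 := by
    intro j
    rw [pd_mul]
    change (pd i (coord j) : Euc d → ℂ) x * ((x j : ℝ) : ℂ)
      + ((x j : ℝ) : ℂ) * (pd i (coord j) : Euc d → ℂ) x = _
    rw [pd_coord i j hx]
    split_ifs with hij
    · subst hij
      ring
    · ring
  simp only [h]
  simp

theorem pd_normSq_pow_apply {d : ℕ} (i : Fin d) (n : ℕ) {x : Euc d} (hx : x ∈ cball d) :
    (pd i (normSq d ^ (n + 1)) : Euc d → ℂ) x
      = 2 * (n + 1) * ((x i : ℝ) : ℂ) * (normSq d : Euc d → ℂ) x ^ n := by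
  induction n with
  | zero => simp [pd_normSq_apply i hx]
  | succ n ih =>
    rw [pow_succ, pd_mul]
    change (pd i (normSq d ^ (n + 1)) : Euc d → ℂ) x * (normSq d : Euc d → ℂ) x
      + (normSq d : Euc d → ℂ) x ^ (n + 1) * (pd i (normSq d) : Euc d → ℂ) x = _
    rw [ih, pd_normSq_apply i hx]
    push_cast
    ring

/-- The defect in the divergence theorem. -/
noncomputable def divDefect {d : ℕ} (i : Fin d) : Smooth d →ₗ[ℂ] ℂ :=
  intBall ∘ₗ pd i - intSphere ∘ₗ LinearMap.mulLeft ℂ (coord i)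

theorem divDefect_apply {d : ℕ} (i : Fin d) (h : Smooth d) :
    divDefect i h = intBall (pd i h) - intSphere (coord i * h) := rfl

/-- A function with a double zero on the sphere extends by zero to a differentiable function, so
that the integral of its derivative vanishes. -/
theorem divDefect_of_double_zero {d : ℕ} (i : Fin d) (k : Smooth d) :
    divDefect i ((1 - normSq d) ^ 2 * k) = 0 := by
  set f : Smooth d := (1 - normSq d) ^ 2 * k with hf
  have hfx : ∀ x : Euc d, (f : Euc d → ℂ) x
      = ((1 - ‖x‖ ^ 2 : ℝ) : ℂ) ^ 2 * (k : Euc d → ℂ) x := by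
    intro x
    change (1 - (normSq d : Euc d → ℂ) x) ^ 2 * (k : Euc d → ℂ) x = _
    rw [normSq_apply]
    push_cast
    rfl
  have hs : intSphere (coord i * f) = 0 := by
    rw [← map_zero (intSphere (d := d))]
    refine intSphere_congr fun x hx => ?_
    change ((x i : ℝ) : ℂ) * (f : Euc d → ℂ) x = 0
    rw [hfx, hx]
    simp
  rw [divDefect_apply, hs, sub_zero]
  set F : Euc d → ℂ := (cball d).indicator (f : Euc d → ℂ) with hF
  have hFi : Integrable F :=
    ((continuousOn_smooth f).integrableOn_compact
      (isCompact_closedBall 0 1)).integrable_indicator Metric.isClosed_closedBall.measurableSet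
  obtain ⟨M, hM0, hM⟩ := exists_bound k
  -- the derivative of the extension, region by region
  have hin : ∀ x ∈ Metric.ball (0 : Euc d) 1,
      HasFDerivAt F (fderivWithin ℝ (f : Euc d → ℂ) (cball d) x) x := by
    intro x hx
    have hn : cball d ∈ nhds x :=
      Filter.mem_of_superset (Metric.isOpen_ball.mem_nhds hx) Metric.ball_subset_closedBall
    have h1 := ((differentiableWithinAt f
      (Metric.ball_subset_closedBall hx)).hasFDerivWithinAt).hasFDerivAt hn
    refine h1.congr_of_eventuallyEq ?_
    filter_upwards [hn] with y hy
    exact Set.indicator_of_mem hy _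
  have hout : ∀ x ∉ Metric.ball (0 : Euc d) 1, HasFDerivAt F (0 : Euc d →L[ℝ] ℂ) x := by
    intro x hx
    have hx1 : 1 ≤ ‖x‖ := by simpa using hx
    have hFx : F x = 0 := by
      by_cases hxc : x ∈ cball d
      · have : ‖x‖ = 1 := le_antisymm (by simpa using hxc) hx1
        rw [hF, Set.indicator_of_mem hxc, hfx, this]
        simp
      · exact Set.indicator_of_notMem hxc _
    have hb : ∀ y, ‖F y‖ ≤ 4 * M * ‖y - x‖ ^ 2 := by
      intro y
      by_cases hy : y ∈ cball d
      · have hy1 : ‖y‖ ≤ 1 := by simpa using hy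
        have h2 : 1 - ‖y‖ ^ 2 ≤ 2 * ‖y - x‖ := by
          have := norm_sub_norm_le x y
          rw [norm_sub_rev] at this
          nlinarith [norm_nonneg y]
        have h3 : 0 ≤ 1 - ‖y‖ ^ 2 := by nlinarith [norm_nonneg y]
        rw [hF, Set.indicator_of_mem hy, hfx, norm_mul, norm_pow, Complex.norm_real,
          Real.norm_of_nonneg h3]
        have h4 := hM y hy
        calc (1 - ‖y‖ ^ 2) ^ 2 * ‖(k : Euc d → ℂ) y‖ ≤ (2 * ‖y - x‖) ^ 2 * M := by gcongr
          _ = _ := by ring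
      · rw [hF, Set.indicator_of_notMem hy, norm_zero]
        positivity
    have hO : F =O[nhds x] fun y => ‖y - x‖ ^ 2 := by
      refine Asymptotics.IsBigO.of_bound (4 * M) (Filter.Eventually.of_forall fun y => ?_)
      rw [Real.norm_of_nonneg (by positivity)]
      exact hb y
    exact hO.hasFDerivAt (by norm_num)
  have hdiff : Differentiable ℝ F := fun x => by
    by_cases hx : x ∈ Metric.ball (0 : Euc d) 1
    · exact (hin x hx).differentiableAt
    · exact (hout x hx).differentiableAt
  have hfd : (fun x => fderiv ℝ F x (EuclideanSpace.single i 1))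
      = (Metric.ball (0 : Euc d) 1).indicator (pd i f : Euc d → ℂ) := by
    funext x
    by_cases hx : x ∈ Metric.ball (0 : Euc d) 1
    · rw [Set.indicator_of_mem hx, (hin x hx).fderiv]
      rfl
    · rw [Set.indicator_of_notMem hx, (hout x hx).fderiv]
      rfl
  have hFi' : Integrable fun x => fderiv ℝ F x (EuclideanSpace.single i 1) := by
    rw [hfd]
    exact (integrableOn_ball _).integrable_indicator measurableSet_ball
  have key := integral_smul_fderiv_eq_neg_fderiv_smul_of_integrable (𝕜 := ℝ) (μ := volume)
    (f := fun _ : Euc d => (1 : ℝ)) (g := F) (v := EuclideanSpace.single i (1 : ℝ))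
    (by simp) (by simpa using hFi') (by simpa using hFi) (fun _ _ => by fun_prop) (fun x _ => hdiff x)
  simp only [one_smul, fderiv_fun_const, Pi.zero_apply, zero_apply, zero_smul, integral_zero,
    neg_zero] at key
  rw [hfd, integral_indicator measurableSet_ball] at key
  exact key

theorem divDefect_normSq_pow_mul {d : ℕ} (hd : 1 ≤ d) (i : Fin d) (h : Smooth d) (n : ℕ) :
    divDefect i (normSq d ^ (n + 1) * h) = intBall (normSq d ^ n *
      ((1 - (d : ℂ)) • (coord i * h) + normSq d * pd i h - coord i * rad h)) := by
  have h1 : intSphere (coord i * (normSq d ^ (n + 1) * h))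
      = intSphere (coord i * (normSq d ^ n * h)) := by
    refine intSphere_congr fun x hx => ?_
    change ((x i : ℝ) : ℂ) * ((normSq d : Euc d → ℂ) x ^ (n + 1) * (h : Euc d → ℂ) x)
      = ((x i : ℝ) : ℂ) * ((normSq d : Euc d → ℂ) x ^ n * (h : Euc d → ℂ) x)
    rw [normSq_apply, hx]
    simp
  rw [divDefect_apply, h1, intSphere_eq hd, ← smul_eq_mul (d : ℂ), ← map_smul, ← map_add,
    ← map_sub]
  refine intBall_congr fun x hx => ?_
  have hxc := Metric.ball_subset_closedBall hx
  have e1 : (pd i (normSq d ^ (n + 1) * h) : Euc d → ℂ) x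
      = 2 * (n + 1) * ((x i : ℝ) : ℂ) * (normSq d : Euc d → ℂ) x ^ n * (h : Euc d → ℂ) x
        + (normSq d : Euc d → ℂ) x ^ (n + 1) * (pd i h : Euc d → ℂ) x := by
    rw [pd_mul, ← pd_normSq_pow_apply i n hxc]
    rfl
  have e2 : (rad (coord i) : Euc d → ℂ) x = ((x i : ℝ) : ℂ) := by
    rw [rad, coe_sum]
    have : ∀ j, (coord j * pd j (coord i) : Smooth d).1 x
        = if i = j then ((x j : ℝ) : ℂ) else 0 := by
      intro j
      change ((x j : ℝ) : ℂ) * (pd j (coord i) : Euc d → ℂ) x = _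
      rw [pd_coord j i hxc]
      split_ifs <;> simp
    simp only [this]
    simp
  have e3 : (rad (normSq d ^ n) : Euc d → ℂ) x = 2 * n * (normSq d : Euc d → ℂ) x ^ n := by
    rw [rad, coe_sum]
    cases n with
    | zero => simp [pd_one]
    | succ n =>
      have : ∀ j, (coord j * pd j (normSq d ^ (n + 1)) : Smooth d).1 x
          = 2 * (n + 1) * (normSq d : Euc d → ℂ) x ^ n * (coord j * coord j : Smooth d).1 x := by
        intro j
        change ((x j : ℝ) : ℂ) * (pd j (normSq d ^ (n + 1)) : Euc d → ℂ) x
          = _ * (((x j : ℝ) : ℂ) * ((x j : ℝ) : ℂ))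
        rw [pd_normSq_pow_apply j n hxc]
        ring
      simp only [this]
      rw [← Finset.mul_sum, ← coe_sum]
      change _ * (normSq d : Euc d → ℂ) x = _
      push_cast
      ring
  have e4 : (rad (coord i * (normSq d ^ n * h)) : Euc d → ℂ) x
      = (rad (coord i) : Euc d → ℂ) x * ((normSq d : Euc d → ℂ) x ^ n * (h : Euc d → ℂ) x)
        + ((x i : ℝ) : ℂ) * ((rad (normSq d ^ n) : Euc d → ℂ) x * (h : Euc d → ℂ) x
          + (normSq d : Euc d → ℂ) x ^ n * (rad h : Euc d → ℂ) x) := by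
    rw [rad_mul, rad_mul]
    rfl
  change (pd i (normSq d ^ (n + 1) * h) : Euc d → ℂ) x - ((d : ℂ) * (((x i : ℝ) : ℂ)
      * ((normSq d : Euc d → ℂ) x ^ n * (h : Euc d → ℂ) x))
      + (rad (coord i * (normSq d ^ n * h)) : Euc d → ℂ) x)
    = (normSq d : Euc d → ℂ) x ^ n * ((1 - (d : ℂ)) * (((x i : ℝ) : ℂ) * (h : Euc d → ℂ) x)
      + (normSq d : Euc d → ℂ) x * (pd i h : Euc d → ℂ) x
      - ((x i : ℝ) : ℂ) * (rad h : Euc d → ℂ) x)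
  rw [e1, e4, e3, e2]
  ring

theorem tendsto_intBall_normSq_pow_mul {d : ℕ} (g : Smooth d) :
    Filter.Tendsto (fun n : ℕ => intBall (normSq d ^ n * g)) Filter.atTop (nhds 0) := by
  have h0 : (0 : ℂ) = ∫ _ in Metric.ball (0 : Euc d) 1, (0 : ℂ) := by simp
  rw [h0]
  refine tendsto_integral_of_dominated_convergence (fun x => ‖(g : Euc d → ℂ) x‖)
    (fun n => (integrableOn_ball _).aestronglyMeasurable) (integrableOn_ball g).norm
    (fun n => ?_) ?_
  · refine (ae_restrict_mem measurableSet_ball).mono fun x hx => ?_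
    have hx1 : ‖x‖ < 1 := by simpa using hx
    change ‖(normSq d : Euc d → ℂ) x ^ n * (g : Euc d → ℂ) x‖ ≤ _
    rw [norm_mul, norm_pow, normSq_apply, Complex.norm_real, Real.norm_of_nonneg (by positivity)]
    refine mul_le_of_le_one_left (norm_nonneg _) (pow_le_one₀ (by positivity) ?_)
    nlinarith [norm_nonneg x]
  · refine (ae_restrict_mem measurableSet_ball).mono fun x hx => ?_
    have hx1 : ‖x‖ < 1 := by simpa using hx
    change Filter.Tendsto (fun n => (normSq d : Euc d → ℂ) x ^ n * (g : Euc d → ℂ) x) _ _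
    have : Filter.Tendsto (fun n => (normSq d : Euc d → ℂ) x ^ n) Filter.atTop (nhds 0) := by
      apply tendsto_pow_atTop_nhds_zero_of_norm_lt_one
      rw [normSq_apply, Complex.norm_real, Real.norm_of_nonneg (by positivity)]
      nlinarith [norm_nonneg x]
    simpa using this.mul_const ((g : Euc d → ℂ) x)

/-- The divergence theorem on the ball. -/
theorem intBall_pd {d : ℕ} (hd : 1 ≤ d) (i : Fin d) (h : Smooth d) :
    intBall (pd i h) = intSphere (coord i * h) := by
  have key : ∀ n : ℕ, divDefect i h = 2 * divDefect i (normSq d ^ (n + 1) * h)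
      - divDefect i (normSq d ^ (2 * n + 1 + 1) * h) := by
    intro n
    have e : h = (1 - normSq d) ^ 2 * ((∑ j ∈ Finset.range (n + 1), normSq d ^ j) ^ 2 * h)
        + (2 : ℂ) • (normSq d ^ (n + 1) * h) - normSq d ^ (2 * n + 1 + 1) * h := by
      have hg := mul_neg_geom_sum (normSq d) (n + 1)
      have h2 : (2 : ℂ) • (normSq d ^ (n + 1) * h) = 2 * (normSq d ^ (n + 1) * h) := by
        rw [two_smul, two_mul]
      rw [h2, ← mul_assoc, ← mul_pow, hg]
      ring
    conv_lhs => rw [e]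
    rw [map_sub, map_add, map_smul, divDefect_of_double_zero, zero_add, smul_eq_mul]
  have l1 : Filter.Tendsto (fun n : ℕ => divDefect i (normSq d ^ (n + 1) * h))
      Filter.atTop (nhds 0) := by
    simp only [divDefect_normSq_pow_mul hd]
    exact tendsto_intBall_normSq_pow_mul _
  have l2 : Filter.Tendsto (fun n : ℕ => divDefect i (normSq d ^ (2 * n + 1 + 1) * h))
      Filter.atTop (nhds 0) :=
    l1.comp (Filter.tendsto_atTop_mono (fun n => by change n ≤ 2 * n + 1; omega) Filter.tendsto_id)
  have l3 := (l1.const_mul 2).sub l2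
  simp only [← key, mul_zero, sub_zero] at l3
  have := tendsto_nhds_unique tendsto_const_nhds l3
  rw [divDefect_apply] at this
  exact sub_eq_zero.1 this

/-! ### Poincaré inequalities -/

theorem norm_integral_sq_le {X : Type*} [MeasurableSpace X] {μ : Measure X} [IsFiniteMeasure μ]
    {f : X → ℂ} (hf : Integrable f μ) (hf2 : Integrable (fun x => ‖f x‖ ^ 2) μ) :
    ‖∫ x, f x ∂μ‖ ^ 2 ≤ μ.real Set.univ * ∫ x, ‖f x‖ ^ 2 ∂μ := by
  set c := ∫ x, f x ∂μ with hc
  set V := μ.real Set.univ with hV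
  have hV0 : 0 ≤ V := measureReal_nonneg
  rcases hV0.eq_or_lt with h0 | hpos
  · have hμ : μ = 0 := by
      rw [← Measure.measure_univ_eq_zero]
      exact (measureReal_eq_zero_iff (measure_ne_top μ _)).1 h0.symm
    have : c = 0 := by rw [hc, hμ, integral_zero_measure]
    rw [this, ← h0]
    simp
  · have h1 : ‖c‖ ^ 2 = ∫ x, (conj c * f x).re ∂μ := by
      have h2 : ∫ x, (conj c * f x).re ∂μ = (∫ x, conj c * f x ∂μ).re :=
        integral_re (hf.const_mul _)
      rw [h2, integral_const_mul, ← hc, mul_comm, Complex.mul_conj, Complex.normSq_eq_norm_sq,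
        Complex.ofReal_re]
    have h3 : ∫ x, (conj c * f x).re ∂μ
        ≤ ∫ x, (‖c‖ ^ 2 / (2 * V) + V / 2 * ‖f x‖ ^ 2) ∂μ := by
      refine integral_mono (hf.const_mul _).re ((integrable_const _).add (hf2.const_mul _))
        fun x => ?_
      have h4 : (conj c * f x).re ≤ ‖c‖ * ‖f x‖ := by
        refine (Complex.re_le_norm _).trans ?_
        rw [norm_mul, Complex.norm_conj]
      have h5 : ‖c‖ ^ 2 / (2 * V) + V / 2 * ‖f x‖ ^ 2 - ‖c‖ * ‖f x‖
          = (‖c‖ - V * ‖f x‖) ^ 2 / (2 * V) := by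
        field_simp
        ring
      have h6 : 0 ≤ (‖c‖ - V * ‖f x‖) ^ 2 / (2 * V) := by positivity
      change (conj c * f x).re ≤ _
      linarith
    rw [← h1, integral_add (integrable_const _) (hf2.const_mul _), integral_const,
      integral_const_mul, smul_eq_mul, ← hV] at h3
    have h7 : V * (‖c‖ ^ 2 / (2 * V)) = ‖c‖ ^ 2 / 2 := by
      field_simp
    rw [h7] at h3
    linarith

/-- The squared length of the gradient at a point. -/
noncomputable def gradNormSq {d : ℕ} (u : Smooth d) (x : Euc d) : ℝ :=
  ∑ j, ‖(pd j u : Euc d → ℂ) x‖ ^ 2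

theorem gradNormSq_nonneg {d : ℕ} (u : Smooth d) (x : Euc d) : 0 ≤ gradNormSq u x :=
  Finset.sum_nonneg fun _ _ => by positivity

theorem continuousOn_gradNormSq {d : ℕ} (u : Smooth d) :
    ContinuousOn (gradNormSq u) (cball d) :=
  continuousOn_finsetSum _ fun _ _ => (continuousOn_smooth _).norm.pow 2

theorem measurable_gradNormSq {d : ℕ} (u : Smooth d) : Measurable (gradNormSq u) := by
  classical
  have h : gradNormSq u = (cball d).piecewise (gradNormSq u) (fun _ => 0) := by
    funext x
    by_cases hx : x ∈ cball d
    · rw [Set.piecewise_eq_of_mem _ _ _ hx]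
    · rw [Set.piecewise_eq_of_notMem _ _ _ hx, gradNormSq]
      exact Finset.sum_eq_zero fun j _ => by simp [pd_off j u hx]
  rw [h]
  exact (continuousOn_gradNormSq u).measurable_piecewise continuousOn_const
    Metric.isClosed_closedBall.measurableSet

theorem norm_fderivWithin_sq_le {d : ℕ} (u : Smooth d) (x v : Euc d) :
    ‖fderivWithin ℝ (u : Euc d → ℂ) (cball d) x v‖ ^ 2 ≤ ‖v‖ ^ 2 * gradNormSq u x := by
  have h1 : ‖fderivWithin ℝ (u : Euc d → ℂ) (cball d) x v‖
      ≤ ∑ j, |v j| * ‖(pd j u : Euc d → ℂ) x‖ := by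
    rw [fderivWithin_apply_eq_sum]
    refine (norm_sum_le _ _).trans (Finset.sum_le_sum fun j _ => ?_)
    rw [norm_mul, Complex.norm_real, Real.norm_eq_abs]
  have h2 := Finset.sum_mul_sq_le_sq_mul_sq Finset.univ (fun j => |v j|)
    (fun j => ‖(pd j u : Euc d → ℂ) x‖)
  have h3 : ∑ j, |v j| ^ 2 = ‖v‖ ^ 2 := by
    rw [EuclideanSpace.norm_sq_eq]
    simp only [Real.norm_eq_abs]
  rw [h3] at h2
  exact (pow_le_pow_left₀ (norm_nonneg _) h1 2).trans h2

theorem norm_sub_sq_le_integral {d : ℕ} (u : Smooth d) {x y : Euc d} (hx : x ∈ cball d)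
    (hy : y ∈ cball d) :
    ‖(u : Euc d → ℂ) x - (u : Euc d → ℂ) y‖ ^ 2
      ≤ ‖y - x‖ ^ 2 * ∫ t in Set.Ioo (0 : ℝ) 1, gradNormSq u (x + t • (y - x)) := by
  have hmem : ∀ t ∈ Set.Icc (0 : ℝ) 1, x + t • (y - x) ∈ cball d := fun t ht =>
    (convex_closedBall (0 : Euc d) 1).add_smul_sub_mem hx hy ht
  let g' : ℝ → ℂ := fun t =>
    fderivWithin ℝ (u : Euc d → ℂ) (cball d) (x + t • (y - x)) (y - x)
  have hmaps : Set.MapsTo (fun t : ℝ => x + t • (y - x)) (Set.Icc 0 1) (cball d) := hmem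
  have hc' : ContinuousOn g' (Set.Icc 0 1) := by
    have h : g' = fun t => ∑ j, (((y - x) j : ℝ) : ℂ) * (pd j u).1 (x + t • (y - x)) :=
      funext fun t => fderivWithin_apply_eq_sum u _ _
    rw [h]
    exact continuousOn_finsetSum _ fun j _ =>
      continuousOn_const.mul (continuousOn_line (pd j u) hmem)
  have hcG : ContinuousOn (fun t : ℝ => gradNormSq u (x + t • (y - x))) (Set.Icc 0 1) :=
    (continuousOn_gradNormSq u).comp (by fun_prop) hmaps
  have hint : IntervalIntegrable g' volume 0 1 := by
    apply ContinuousOn.intervalIntegrable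
    rwa [Set.uIcc_of_le zero_le_one]
  have key := intervalIntegral.integral_eq_sub_of_hasDeriv_right_of_le zero_le_one
    (continuousOn_line u hmem) (fun t ht => (hasDerivAt_line u hmem ht).hasDerivWithinAt) hint
  rw [intervalIntegral.integral_of_le zero_le_one, integral_Ioc_eq_integral_Ioo] at key
  have hi : ∀ {F : Type} [NormedAddCommGroup F] {h : ℝ → F}, ContinuousOn h (Set.Icc 0 1) →
      Integrable h (volume.restrict (Set.Ioo 0 1)) := fun hh =>
    (hh.integrableOn_compact isCompact_Icc).mono_set Set.Ioo_subset_Icc_self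
  have h1 := norm_integral_sq_le (hi hc') (hi (hc'.norm.pow 2))
  rw [key] at h1
  simp only [one_smul, zero_smul, add_zero, add_sub_cancel] at h1
  rw [norm_sub_rev]
  refine h1.trans ?_
  have h2 : (volume.restrict (Set.Ioo (0 : ℝ) 1)).real Set.univ = 1 := by
    simp
  rw [h2, one_mul, ← integral_const_mul]
  exact integral_mono (hi (hc'.norm.pow 2)) ((hi hcG).const_mul _)
    fun t => norm_fderivWithin_sq_le u _ _

theorem lintegral_comp_add_smul {d : ℕ} {H : Euc d → ENNReal} (hH : Measurable H) (a : Euc d)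
    {t : ℝ} (ht : 1 / 2 ≤ t) : ∫⁻ y, H (a + t • y) ≤ 2 ^ d * ∫⁻ y, H y := by
  have ht0 : 0 < t := by linarith
  have h1 : ∫⁻ y, H (a + t • y) = ∫⁻ y, H (a + y) ∂(Measure.map (t • ·) volume) := by
    rw [lintegral_map (by fun_prop) (by fun_prop)]
  rw [h1, Measure.map_addHaar_smul _ ht0.ne', lintegral_smul_measure,
    lintegral_add_left_eq_self H a, smul_eq_mul]
  gcongr
  have h2 : |(t ^ Module.finrank ℝ (Euc d))⁻¹| ≤ 2 ^ d := by
    rw [finrank_euclideanSpace_fin, abs_of_pos (by positivity), ← inv_pow]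
    gcongr
    rw [inv_le_comm₀ ht0 two_pos]
    linarith
  calc ENNReal.ofReal |(t ^ Module.finrank ℝ (Euc d))⁻¹| ≤ ENNReal.ofReal (2 ^ d) :=
        ENNReal.ofReal_le_ofReal h2
    _ = 2 ^ d := by
      rw [ENNReal.ofReal_pow (by norm_num)]
      norm_num

/-- The averages of `H` over all segments between points of `D`: depending on the position on
the segment, one integrates in the farther end point first, so that the scaling factor is at
most `2 ^ d`. -/
theorem lintegral_segments_le {d : ℕ} {H : Euc d → ENNReal} (hH : Measurable H)
    (D : Set (Euc d)) :
    ∫⁻ x in D, ∫⁻ y in D, ∫⁻ t in Set.Ioo (0 : ℝ) 1, H (x + t • (y - x))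
      ≤ 2 ^ d * volume D * ∫⁻ y, H y := by
  set I := volume.restrict (Set.Ioo (0 : ℝ) 1) with hI
  set ν := (volume : Measure (Euc d)).restrict D with hν
  have e1 : ∀ x, ∫⁻ y, ∫⁻ t, H (x + t • (y - x)) ∂I ∂ν = ∫⁻ t, ∫⁻ y, H (x + t • (y - x)) ∂ν ∂I :=
    fun x => lintegral_lintegral_swap (by fun_prop)
  have hm : Measurable fun p : Euc d × ℝ => ∫⁻ y, H (p.1 + p.2 • (y - p.1)) ∂ν := by
    have : Measurable fun q : (Euc d × ℝ) × Euc d => H (q.1.1 + q.1.2 • (q.2 - q.1.1)) := by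
      fun_prop
    exact this.lintegral_prod_right'
  have e2 : ∫⁻ x, ∫⁻ t, ∫⁻ y, H (x + t • (y - x)) ∂ν ∂I ∂ν
      = ∫⁻ t, ∫⁻ x, ∫⁻ y, H (x + t • (y - x)) ∂ν ∂ν ∂I :=
    lintegral_lintegral_swap hm.aemeasurable
  simp only [e1]
  rw [e2]
  have hb : ∀ t ∈ Set.Ioo (0 : ℝ) 1, ∫⁻ x, ∫⁻ y, H (x + t • (y - x)) ∂ν ∂ν
      ≤ 2 ^ d * volume D * ∫⁻ y, H y := by
    intro t ht
    have hconst : ∀ c : ENNReal, ∫⁻ _, c ∂ν = c * volume D := fun c => by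
      rw [lintegral_const, hν, Measure.restrict_apply_univ]
    rcases le_total (1 / 2) t with h | h
    · calc ∫⁻ x, ∫⁻ y, H (x + t • (y - x)) ∂ν ∂ν ≤ ∫⁻ _ : Euc d, (2 ^ d * ∫⁻ y, H y) ∂ν := by
            refine lintegral_mono fun x => ?_
            refine (setLIntegral_le_lintegral _ _).trans ?_
            have e : ∀ y, x + t • (y - x) = (x - t • x) + t • y := fun y => by
              rw [smul_sub]
              abel
            simp only [e]
            exact lintegral_comp_add_smul hH _ h
        _ = _ := by
            rw [hconst]
            ring
    · rw [lintegral_lintegral_swap (by fun_prop)]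
      calc ∫⁻ y, ∫⁻ x, H (x + t • (y - x)) ∂ν ∂ν ≤ ∫⁻ _ : Euc d, (2 ^ d * ∫⁻ y, H y) ∂ν := by
            refine lintegral_mono fun y => ?_
            refine (setLIntegral_le_lintegral _ _).trans ?_
            have e : ∀ x, x + t • (y - x) = t • y + (1 - t) • x := fun x => by
              rw [smul_sub, sub_smul, one_smul]
              abel
            simp only [e]
            exact lintegral_comp_add_smul hH _ (by linarith)
        _ = _ := by
            rw [hconst]
            ring
  calc ∫⁻ t, ∫⁻ x, ∫⁻ y, H (x + t • (y - x)) ∂ν ∂ν ∂I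
      ≤ ∫⁻ _ : ℝ, (2 ^ d * volume D * ∫⁻ y, H y) ∂I :=
        setLIntegral_mono' measurableSet_Ioo hb
    _ = _ := by
      rw [lintegral_const, hI, Measure.restrict_apply_univ]
      simp

theorem integrableOn_of_subset_cball {d : ℕ} {F : Type*} [NormedAddCommGroup F] {h : Euc d → F}
    (hh : ContinuousOn h (cball d)) {D : Set (Euc d)} (hD : D ⊆ cball d) : IntegrableOn h D :=
  (hh.integrableOn_compact (isCompact_closedBall 0 1)).mono_set hD

theorem lintegral_norm_sub_sq_le {d : ℕ} (u : Smooth d) {D : Set (Euc d)} (hD : D ⊆ cball d)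
    (hDm : MeasurableSet D) (hDc : Convex ℝ D) {δ : ℝ}
    (hδ : ∀ x ∈ D, ∀ y ∈ D, ‖x - y‖ ^ 2 ≤ δ) :
    ∫⁻ x in D, ∫⁻ y in D, ENNReal.ofReal (‖(u : Euc d → ℂ) x - (u : Euc d → ℂ) y‖ ^ 2)
      ≤ ENNReal.ofReal δ * (2 ^ d * volume D * ∫⁻ x in D, ENNReal.ofReal (gradNormSq u x)) := by
  set H : Euc d → ENNReal := D.indicator fun z => ENNReal.ofReal (gradNormSq u z) with hH
  have hHm : Measurable H := ((measurable_gradNormSq u).ennreal_ofReal).indicator hDm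
  have hHint : ∫⁻ x in D, ENNReal.ofReal (gradNormSq u x) = ∫⁻ y, H y := by
    rw [hH, lintegral_indicator hDm]
  have hpt : ∀ x ∈ D, ∀ y ∈ D,
      ENNReal.ofReal (‖(u : Euc d → ℂ) x - (u : Euc d → ℂ) y‖ ^ 2)
        ≤ ENNReal.ofReal δ * ∫⁻ t in Set.Ioo (0 : ℝ) 1, H (x + t • (y - x)) := by
    intro x hx y hy
    have hδ0 : 0 ≤ δ := (by positivity : (0 : ℝ) ≤ ‖x - y‖ ^ 2).trans (hδ x hx y hy)
    have hmaps : Set.MapsTo (fun t : ℝ => x + t • (y - x)) (Set.Icc 0 1) D := fun t ht =>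
      hDc.add_smul_sub_mem hx hy ht
    have hi : Integrable (fun t : ℝ => gradNormSq u (x + t • (y - x)))
        (volume.restrict (Set.Ioo 0 1)) :=
      (((continuousOn_gradNormSq u).comp (by fun_prop) (hmaps.mono_right hD)).integrableOn_compact
        isCompact_Icc).mono_set Set.Ioo_subset_Icc_self
    have h1 : ∫⁻ t in Set.Ioo (0 : ℝ) 1, H (x + t • (y - x))
        = ENNReal.ofReal (∫ t in Set.Ioo (0 : ℝ) 1, gradNormSq u (x + t • (y - x))) := by
      rw [ofReal_integral_eq_lintegral_ofReal hi
        (Filter.Eventually.of_forall fun t => gradNormSq_nonneg u _)]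
      refine setLIntegral_congr_fun measurableSet_Ioo fun t ht => ?_
      exact Set.indicator_of_mem (hmaps ⟨ht.1.le, ht.2.le⟩) _
    rw [h1, ← ENNReal.ofReal_mul hδ0]
    refine ENNReal.ofReal_le_ofReal ((norm_sub_sq_le_integral u (hD hx) (hD hy)).trans ?_)
    refine mul_le_mul_of_nonneg_right ?_ (integral_nonneg fun t => gradNormSq_nonneg u _)
    rw [norm_sub_rev]
    exact hδ x hx y hy
  rw [hHint]
  calc _ ≤ ∫⁻ x in D, ∫⁻ y in D, ENNReal.ofReal δ *
        ∫⁻ t in Set.Ioo (0 : ℝ) 1, H (x + t • (y - x)) :=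
        setLIntegral_mono' hDm fun x hx => setLIntegral_mono' hDm fun y hy => hpt x hx y hy
    _ = ENNReal.ofReal δ * ∫⁻ x in D, ∫⁻ y in D,
        ∫⁻ t in Set.Ioo (0 : ℝ) 1, H (x + t • (y - x)) := by
        simp only [lintegral_const_mul' _ _ ENNReal.ofReal_ne_top]
    _ ≤ _ := by
        gcongr
        exact lintegral_segments_le hHm D

/-- A Poincaré inequality with a weight, on a convex subset `D` of the ball. -/
theorem integral_norm_mul_sub_sq_le {d : ℕ} (u φ : Smooth d) {D : Set (Euc d)} (hD : D ⊆ cball d)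
    (hDm : MeasurableSet D) (hDc : Convex ℝ D) {δ : ℝ} (hδ0 : 0 ≤ δ)
    (hδ : ∀ x ∈ D, ∀ y ∈ D, ‖x - y‖ ^ 2 ≤ δ) {M : ℝ}
    (hM : ∀ x ∈ D, ‖(φ : Euc d → ℂ) x‖ ≤ M) :
    ∫ x in D, ‖(∫ y in D, (φ : Euc d → ℂ) y) * (u : Euc d → ℂ) x
        - ∫ y in D, (φ : Euc d → ℂ) y * (u : Euc d → ℂ) y‖ ^ 2
      ≤ M ^ 2 * volume.real D ^ 2 * 2 ^ d * δ * ∫ x in D, gradNormSq u x := by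
  have hDfin : volume D ≠ ⊤ :=
    ((measure_mono hD).trans_lt (isCompact_closedBall (0 : Euc d) 1).measure_lt_top).ne
  have : IsFiniteMeasure (volume.restrict D) := isFiniteMeasure_restrict.2 hDfin
  set V := volume.real D with hV
  set c := ∫ y in D, (φ : Euc d → ℂ) y with hc
  set m := ∫ y in D, (φ : Euc d → ℂ) y * (u : Euc d → ℂ) y with hm
  have cu := continuousOn_smooth u
  have cφ := continuousOn_smooth φ
  have cφu : ContinuousOn (fun y => (φ : Euc d → ℂ) y * (u : Euc d → ℂ) y) (cball d) := cφ.mul cu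
  have ccu : ContinuousOn (fun x => ‖c * (u : Euc d → ℂ) x - m‖ ^ 2) (cball d) :=
    ((continuousOn_const.mul cu).sub continuousOn_const).norm.pow 2
  have cdiff : ∀ x, ContinuousOn
      (fun y => ‖(u : Euc d → ℂ) x - (u : Euc d → ℂ) y‖ ^ 2) (cball d) := fun x =>
    (continuousOn_const.sub cu).norm.pow 2
  have hpt : ∀ x ∈ D, ‖c * (u : Euc d → ℂ) x - m‖ ^ 2
      ≤ M ^ 2 * V * ∫ y in D, ‖(u : Euc d → ℂ) x - (u : Euc d → ℂ) y‖ ^ 2 := by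
    intro x hx
    have cf : ContinuousOn (fun y => (φ : Euc d → ℂ) y *
        ((u : Euc d → ℂ) x - (u : Euc d → ℂ) y)) (cball d) :=
      cφ.mul (continuousOn_const.sub cu)
    have h1 : c * (u : Euc d → ℂ) x - m
        = ∫ y in D, (φ : Euc d → ℂ) y * ((u : Euc d → ℂ) x - (u : Euc d → ℂ) y) := by
      simp only [mul_sub]
      rw [integral_sub ((integrableOn_of_subset_cball cφ hD).mul_const _)
        (integrableOn_of_subset_cball cφu hD), integral_mul_const]
    rw [h1]
    refine (norm_integral_sq_le (integrableOn_of_subset_cball cf hD)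
      (integrableOn_of_subset_cball (cf.norm.pow 2) hD)).trans ?_
    have h2 : (volume.restrict D).real Set.univ = V := by simp [hV]
    rw [h2, mul_comm (M ^ 2), mul_assoc, ← integral_const_mul (M ^ 2)]
    refine mul_le_mul_of_nonneg_left ?_ measureReal_nonneg
    refine setIntegral_mono_on (integrableOn_of_subset_cball (cf.norm.pow 2) hD)
      ((integrableOn_of_subset_cball (cdiff x) hD).const_mul _) hDm fun y hy => ?_
    change ‖(φ : Euc d → ℂ) y * ((u : Euc d → ℂ) x - (u : Euc d → ℂ) y)‖ ^ 2 ≤ _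
    rw [norm_mul, mul_pow]
    gcongr
    exact hM y hy
  have hV0 : 0 ≤ V := measureReal_nonneg
  have hMV : 0 ≤ M ^ 2 * V := by positivity
  have hG0 : 0 ≤ ∫ x in D, gradNormSq u x := integral_nonneg fun x => gradNormSq_nonneg u x
  rw [← ENNReal.ofReal_le_ofReal_iff (by positivity)]
  rw [ofReal_integral_eq_lintegral_ofReal
    (integrableOn_of_subset_cball ccu hD) (Filter.Eventually.of_forall fun x => by positivity)]
  calc ∫⁻ x in D, ENNReal.ofReal (‖c * (u : Euc d → ℂ) x - m‖ ^ 2)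
      ≤ ∫⁻ x in D, ENNReal.ofReal (M ^ 2 * V) *
        ∫⁻ y in D, ENNReal.ofReal (‖(u : Euc d → ℂ) x - (u : Euc d → ℂ) y‖ ^ 2) := by
        refine setLIntegral_mono' hDm fun x hx => ?_
        rw [← ofReal_integral_eq_lintegral_ofReal (integrableOn_of_subset_cball (cdiff x) hD)
          (Filter.Eventually.of_forall fun y => by positivity), ← ENNReal.ofReal_mul hMV]
        exact ENNReal.ofReal_le_ofReal (hpt x hx)
    _ = ENNReal.ofReal (M ^ 2 * V) * ∫⁻ x in D, ∫⁻ y in D,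
        ENNReal.ofReal (‖(u : Euc d → ℂ) x - (u : Euc d → ℂ) y‖ ^ 2) := by
        rw [lintegral_const_mul' _ _ ENNReal.ofReal_ne_top]
    _ ≤ ENNReal.ofReal (M ^ 2 * V) * (ENNReal.ofReal δ *
        (2 ^ d * volume D * ∫⁻ x in D, ENNReal.ofReal (gradNormSq u x))) := by
        gcongr
        exact lintegral_norm_sub_sq_le u hD hDm hDc hδ
    _ = _ := by
        rw [← ofReal_integral_eq_lintegral_ofReal
          (integrableOn_of_subset_cball (continuousOn_gradNormSq u) hD)
          (Filter.Eventually.of_forall fun x => gradNormSq_nonneg u x)]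
        have h2 : volume D = ENNReal.ofReal V := by
          rw [hV, ofReal_measureReal hDfin]
        have h3 : (2 : ENNReal) ^ d = ENNReal.ofReal (2 ^ d) := by
          rw [ENNReal.ofReal_pow (by norm_num)]
          norm_num
        rw [h2, h3, ← ENNReal.ofReal_mul (by positivity), ← ENNReal.ofReal_mul (by positivity),
          ← ENNReal.ofReal_mul (by positivity), ← ENNReal.ofReal_mul (by positivity)]
        congr 1
        ring

theorem integral_ball_gradNormSq {d : ℕ} (u : Smooth d) :
    ∫ x in Metric.ball (0 : Euc d) 1, gradNormSq u x = gradSq u := by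
  simp only [gradSq, ballSq_eq, gradNormSq]
  exact integral_finsetSum _ fun i _ => integrableOn_ball_norm_sq _

/-! ### Relative compactness of quadratic forms -/

/-- The quadratic form `q` is relatively compact with respect to `p`: up to an arbitrarily small
multiple of `p` it is controlled by finitely many linear functionals which are bounded with
respect to `p`. -/
def RelCompact {V : Type*} [AddCommGroup V] [Module ℂ V] (p q : V → ℝ) : Prop :=
  ∀ ε : ℝ, 0 < ε → ∃ L : List (V →ₗ[ℂ] ℂ), (∀ l ∈ L, ∃ C : ℝ, ∀ v, ‖l v‖ ^ 2 ≤ C * p v) ∧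
    ∃ K : ℝ, 0 ≤ K ∧ ∀ v, q v ≤ ε * p v + K * (L.map fun l => ‖l v‖ ^ 2).sum

namespace RelCompact

variable {V W : Type*} [AddCommGroup V] [Module ℂ V] [AddCommGroup W] [Module ℂ W]

theorem sum_nonneg (L : List (V →ₗ[ℂ] ℂ)) (v : V) : 0 ≤ (L.map fun l => ‖l v‖ ^ 2).sum :=
  List.sum_nonneg fun a ha => by
    obtain ⟨l, -, rfl⟩ := List.mem_map.1 ha
    positivity

theorem zero {p : V → ℝ} (hp : ∀ v, 0 ≤ p v) : RelCompact p fun _ => 0 := fun ε hε =>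
  ⟨[], by simp, 0, le_rfl, fun v => by simpa using mul_nonneg hε.le (hp v)⟩

theorem add {p q r : V → ℝ} (hq : RelCompact p q) (hr : RelCompact p r) :
    RelCompact p fun v => q v + r v := by
  intro ε hε
  obtain ⟨L, hL, K, hK, h1⟩ := hq (ε / 2) (by linarith)
  obtain ⟨L', hL', K', hK', h2⟩ := hr (ε / 2) (by linarith)
  refine ⟨L ++ L', fun l hl => (List.mem_append.1 hl).elim (hL l) (hL' l), K + K',
    by linarith, fun v => ?_⟩
  rw [List.map_append, List.sum_append]
  have a1 := sum_nonneg L v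
  have a2 := sum_nonneg L' v
  nlinarith [h1 v, h2 v, mul_nonneg hK a2, mul_nonneg hK' a1]

theorem sum {ι : Type*} (s : Finset ι) {p : V → ℝ} (hp : ∀ v, 0 ≤ p v) {q : ι → V → ℝ}
    (hq : ∀ i ∈ s, RelCompact p (q i)) : RelCompact p fun v => ∑ i ∈ s, q i v := by
  induction s using Finset.cons_induction with
  | empty => simpa using zero hp
  | cons a s ha ih =>
    simp only [Finset.sum_cons]
    exact (hq a (Finset.mem_cons_self a s)).add
      (ih fun i hi => hq i (Finset.mem_cons_of_mem hi))

theorem mono {p q r : V → ℝ} (hq : RelCompact p q) {c : ℝ} (hc : 0 < c)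
    (h : ∀ v, r v ≤ c * q v) : RelCompact p r := by
  intro ε hε
  obtain ⟨L, hL, K, hK, h1⟩ := hq (ε / c) (by positivity)
  refine ⟨L, hL, c * K, by positivity, fun v => (h v).trans ?_⟩
  have e : ε * p v = c * (ε / c * p v) := by
    field_simp
  rw [e, mul_assoc, ← mul_add]
  exact mul_le_mul_of_nonneg_left (h1 v) hc.le

theorem comap {p q : V → ℝ} (hq : RelCompact p q) {p' : W → ℝ} (T : W →ₗ[ℂ] V) {c : ℝ}
    (hc : 0 < c) (h : ∀ w, p (T w) ≤ c * p' w) (hp : ∀ v, 0 ≤ p v) :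
    RelCompact p' fun w => q (T w) := by
  intro ε hε
  obtain ⟨L, hL, K, hK, h1⟩ := hq (ε / c) (by positivity)
  refine ⟨L.map (fun l => l ∘ₗ T), fun l hl => ?_, K, hK, fun w => ?_⟩
  · obtain ⟨l', hl', rfl⟩ := List.mem_map.1 hl
    obtain ⟨C, hC⟩ := hL l' hl'
    refine ⟨|C| * c, fun w => (hC (T w)).trans ?_⟩
    calc C * p (T w) ≤ |C| * p (T w) := mul_le_mul_of_nonneg_right (le_abs_self C) (hp _)
      _ ≤ |C| * (c * p' w) := mul_le_mul_of_nonneg_left (h w) (abs_nonneg C)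
      _ = _ := by ring
  · rw [List.map_map]
    refine (h1 (T w)).trans ?_
    have : ε / c * p (T w) ≤ ε * p' w := by
      calc ε / c * p (T w) ≤ ε / c * (c * p' w) := by
            gcongr
            exact h w
        _ = _ := by field_simp
    change _ ≤ ε * p' w + K * (L.map fun l => ‖l (T w)‖ ^ 2).sum
    linarith

end RelCompact

/-! ### Compactness of the embedding of `H¹` into `L²` -/

/-- The part of the unit ball in a cell of the grid of mesh size `1 / N`. -/
def gridCell {d : ℕ} (N : ℕ) (m : Fin d → ℤ) : Set (Euc d) :=
  Metric.ball 0 1 ∩ {x | ∀ i, (m i : ℝ) ≤ N * x i ∧ N * x i < m i + 1}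

theorem gridCell_subset_ball {d : ℕ} (N : ℕ) (m : Fin d → ℤ) :
    gridCell N m ⊆ Metric.ball (0 : Euc d) 1 := Set.inter_subset_left

theorem gridCell_subset_cball {d : ℕ} (N : ℕ) (m : Fin d → ℤ) : gridCell N m ⊆ cball d :=
  (gridCell_subset_ball N m).trans Metric.ball_subset_closedBall

theorem mem_gridCell_iff {d : ℕ} (N : ℕ) (m : Fin d → ℤ) (x : Euc d) :
    x ∈ gridCell N m ↔ x ∈ Metric.ball (0 : Euc d) 1 ∧ m = fun i => ⌊N * x i⌋ := by
  refine and_congr_right fun _ => ?_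
  rw [funext_iff]
  exact forall_congr' fun i => by rw [eq_comm, Int.floor_eq_iff]

theorem measurableSet_gridCell {d : ℕ} (N : ℕ) (m : Fin d → ℤ) :
    MeasurableSet (gridCell N m) := by
  refine measurableSet_ball.inter ?_
  rw [Set.ofPred_forall]
  refine MeasurableSet.iInter fun i => ?_
  have hc : Measurable fun x : Euc d => (N : ℝ) * x i := by fun_prop
  exact (measurableSet_le measurable_const hc).inter (measurableSet_lt hc measurable_const)

theorem convex_gridCell {d : ℕ} (N : ℕ) (m : Fin d → ℤ) : Convex ℝ (gridCell N m) := by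
  refine (convex_ball (0 : Euc d) 1).inter ?_
  intro x hx y hy a b ha hb hab i
  obtain ⟨x1, x2⟩ := hx i
  obtain ⟨y1, y2⟩ := hy i
  have e : (N : ℝ) * (a • x + b • y) i = a * (N * x i) + b * (N * y i) := by
    simp only [PiLp.add_apply, PiLp.smul_apply, smul_eq_mul]
    ring
  rw [e]
  have hb' : b = 1 - a := by linarith
  subst hb'
  constructor
  · nlinarith
  · rcases ha.eq_or_lt with h | h
    · subst h
      linarith
    · nlinarith

theorem norm_sub_sq_le_of_mem_gridCell {d N : ℕ} (hN : 0 < N) {m : Fin d → ℤ} {x y : Euc d}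
    (hx : x ∈ gridCell N m) (hy : y ∈ gridCell N m) : ‖x - y‖ ^ 2 ≤ d / (N : ℝ) ^ 2 := by
  have hN' : (0 : ℝ) < N := by exact_mod_cast hN
  rw [EuclideanSpace.norm_sq_eq]
  have h : ∀ i, ‖(x - y) i‖ ^ 2 ≤ 1 / (N : ℝ) ^ 2 := by
    intro i
    obtain ⟨x1, x2⟩ := hx.2 i
    obtain ⟨y1, y2⟩ := hy.2 i
    rw [Real.norm_eq_abs, sq_abs, le_div_iff₀ (by positivity), ← mul_pow, PiLp.sub_apply]
    have e : |(x i - y i) * N| ≤ 1 := by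
      rw [abs_le]
      constructor <;> nlinarith
    rw [← sq_abs]
    exact pow_le_one₀ (abs_nonneg _) e
  refine (Finset.sum_le_sum fun i _ => h i).trans (le_of_eq ?_)
  simp [div_eq_mul_inv]

theorem integral_ball_eq_sum_gridCell {d : ℕ} (N : ℕ) {f : Euc d → ℝ}
    (hf : ContinuousOn f (cball d)) :
    ∫ x in Metric.ball (0 : Euc d) 1, f x
      = ∑ m ∈ Fintype.piFinset fun _ : Fin d => Finset.Icc (-(N : ℤ)) N,
          ∫ x in gridCell N m, f x := by
  rw [← integral_biUnion_finset _ (fun m _ => measurableSet_gridCell N m) ?_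
    fun m _ => integrableOn_of_subset_cball hf (gridCell_subset_cball N m)]
  · congr 2
    ext x
    simp only [Set.mem_iUnion, mem_gridCell_iff, exists_prop, Fintype.mem_piFinset]
    constructor
    · intro hx
      refine ⟨_, fun i => ?_, hx, rfl⟩
      have h1 : |x i| ≤ 1 := by
        have := PiLp.norm_apply_le x i
        rw [Real.norm_eq_abs] at this
        exact this.trans (by simpa using (Metric.ball_subset_closedBall hx : x ∈ cball d))
      obtain ⟨h2, h3⟩ := abs_le.1 h1
      have hN' : (0 : ℝ) ≤ N := Nat.cast_nonneg N
      rw [Finset.mem_Icc]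
      constructor
      · rw [Int.le_floor]
        push_cast
        nlinarith
      · rw [← Int.cast_le (R := ℝ)]
        refine (Int.floor_le _).trans ?_
        push_cast
        nlinarith
    · rintro ⟨_, _, hx, _⟩
      exact hx
  · intro m _ m' _ hne
    refine Set.disjoint_left.2 fun x hx hx' => hne ?_
    rw [((mem_gridCell_iff N m x).1 hx).2, ((mem_gridCell_iff N m' x).1 hx').2]

/-- The integral over a subset of the ball. -/
noncomputable def intOn {d : ℕ} (D : Set (Euc d)) (hD : D ⊆ cball d) : Smooth d →ₗ[ℂ] ℂ where
  toFun f := ∫ x in D, (f : Euc d → ℂ) x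
  map_add' f g := integral_add (integrableOn_of_subset_cball (continuousOn_smooth f) hD)
    (integrableOn_of_subset_cball (continuousOn_smooth g) hD)
  map_smul' c _ := integral_const_mul c _

theorem isFiniteMeasure_restrict_of_subset {d : ℕ} {D : Set (Euc d)} (hD : D ⊆ cball d) :
    IsFiniteMeasure ((volume : Measure (Euc d)).restrict D) :=
  isFiniteMeasure_restrict.2
    ((measure_mono hD).trans_lt (isCompact_closedBall (0 : Euc d) 1).measure_lt_top).ne

theorem continuousOn_norm_sq {d : ℕ} (u : Smooth d) :
    ContinuousOn (fun x => ‖(u : Euc d → ℂ) x‖ ^ 2) (cball d) :=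
  (continuousOn_smooth u).norm.pow 2

theorem integral_norm_sq_le_of_convex {d : ℕ} (u : Smooth d) {D : Set (Euc d)} (hD : D ⊆ cball d)
    (hDm : MeasurableSet D) (hDc : Convex ℝ D) {δ : ℝ} (hδ0 : 0 ≤ δ)
    (hδ : ∀ x ∈ D, ∀ y ∈ D, ‖x - y‖ ^ 2 ≤ δ) :
    ∫ x in D, ‖(u : Euc d → ℂ) x‖ ^ 2
      ≤ 2 ^ (d + 1) * δ * (∫ x in D, gradNormSq u x) + 2 / volume.real D * ‖intOn D hD u‖ ^ 2 := by
  have := isFiniteMeasure_restrict_of_subset hD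
  have h := integral_norm_mul_sub_sq_le u 1 hD hDm hDc hδ0 hδ (M := 1)
    (fun x _ => by simp)
  have hG0 : 0 ≤ ∫ x in D, gradNormSq u x := integral_nonneg fun x => gradNormSq_nonneg u x
  have e1 : ∫ y in D, ((1 : Smooth d) : Euc d → ℂ) y = ((volume.real D : ℝ) : ℂ) := by simp
  have e2 : ∫ y in D, ((1 : Smooth d) : Euc d → ℂ) y * (u : Euc d → ℂ) y = intOn D hD u := by
    simp [intOn]
  rw [e1, e2] at h
  set V := volume.real D with hV
  set m := intOn D hD u with hm
  have cu := continuousOn_smooth u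
  have hV0 : 0 ≤ V := measureReal_nonneg
  rcases hV0.eq_or_lt with h0 | hpos
  · have hz : volume.restrict D = 0 := by
      rw [Measure.restrict_eq_zero]
      refine (measureReal_eq_zero_iff ?_).1 h0.symm
      exact ((measure_mono hD).trans_lt (isCompact_closedBall (0 : Euc d) 1).measure_lt_top).ne
    rw [hz, ← h0]
    simp
  · have ci : ContinuousOn (fun x => ‖(V : ℂ) * (u : Euc d → ℂ) x - m‖ ^ 2) (cball d) :=
      ((continuousOn_const.mul cu).sub continuousOn_const).norm.pow 2
    have hpt : ∀ x ∈ D, ‖(u : Euc d → ℂ) x‖ ^ 2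
        ≤ 2 / V ^ 2 * ‖(V : ℂ) * (u : Euc d → ℂ) x - m‖ ^ 2 + 2 / V ^ 2 * ‖m‖ ^ 2 := by
      intro x _
      have h1 : V * ‖(u : Euc d → ℂ) x‖ ≤ ‖(V : ℂ) * (u : Euc d → ℂ) x - m‖ + ‖m‖ := by
        have := norm_sub_le ((V : ℂ) * (u : Euc d → ℂ) x - m) (-m)
        rwa [sub_neg_eq_add, sub_add_cancel, norm_mul, Complex.norm_real, norm_neg,
          Real.norm_of_nonneg hpos.le] at this
      have h2 : (V * ‖(u : Euc d → ℂ) x‖) ^ 2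
          ≤ 2 * ‖(V : ℂ) * (u : Euc d → ℂ) x - m‖ ^ 2 + 2 * ‖m‖ ^ 2 := by
        refine (pow_le_pow_left₀ (by positivity) h1 2).trans ?_
        nlinarith [sq_nonneg (‖(V : ℂ) * (u : Euc d → ℂ) x - m‖ - ‖m‖)]
      rw [← mul_add, div_mul_eq_mul_div, le_div_iff₀ (by positivity)]
      nlinarith
    have h1 := setIntegral_mono_on
      (integrableOn_of_subset_cball (continuousOn_norm_sq u) hD)
      (((integrableOn_of_subset_cball ci hD).const_mul (2 / V ^ 2)).add
        (integrable_const (2 / V ^ 2 * ‖m‖ ^ 2))) hDm hpt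
    refine h1.trans ?_
    simp only [Pi.add_apply]
    rw [integral_add ((integrableOn_of_subset_cball ci hD).const_mul (2 / V ^ 2))
      (integrable_const _), integral_const_mul, integral_const, smul_eq_mul]
    have h2 : (volume.restrict D).real Set.univ = V := by simp [hV]
    rw [h2]
    have h3 : V * (2 / V ^ 2 * ‖m‖ ^ 2) = 2 / V * ‖m‖ ^ 2 := by
      field_simp
    rw [h3]
    have h4 : 2 / V ^ 2 * (1 ^ 2 * V ^ 2 * 2 ^ d * δ * ∫ x in D, gradNormSq u x)
        = 2 ^ (d + 1) * δ * ∫ x in D, gradNormSq u x := by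
      field_simp
      ring
    have h5 := mul_le_mul_of_nonneg_left h (by positivity : 0 ≤ 2 / V ^ 2)
    rw [h4] at h5
    linarith

/-- Rellich's theorem on the ball, by Poincaré's inequality on the cells of a fine grid. -/
theorem relCompact_ballSq (d : ℕ) :
    RelCompact (fun u : Smooth d => gradSq u + ballSq u) ballSq := by
  intro ε hε
  obtain ⟨N, hN⟩ := exists_nat_gt (2 ^ (d + 1) * d / ε)
  have hN0 : (0 : ℝ) < N := lt_of_le_of_lt (by positivity) hN
  have hN1 : 0 < N := by exact_mod_cast hN0
  have hN1' : (1 : ℝ) ≤ N := by exact_mod_cast hN1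
  have hsmall : 2 ^ (d + 1) * (d / (N : ℝ) ^ 2) ≤ ε := by
    rw [div_lt_iff₀ hε] at hN
    rw [← mul_div_assoc, div_le_iff₀ (by positivity)]
    nlinarith [mul_le_mul_of_nonneg_left hN1' (mul_nonneg hε.le hN0.le)]
  set s := Fintype.piFinset fun _ : Fin d => Finset.Icc (-(N : ℤ)) N with hs
  set ℓ : (Fin d → ℤ) → Smooth d →ₗ[ℂ] ℂ :=
    fun m => intOn (gridCell N m) (gridCell_subset_cball N m) with hℓ
  set K : ℝ := ∑ m ∈ s, 2 / volume.real (gridCell N m) with hK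
  have hK0 : ∀ m, 0 ≤ 2 / volume.real (gridCell (d := d) N m) := fun m =>
    div_nonneg zero_le_two measureReal_nonneg
  refine ⟨s.toList.map ℓ, fun l hl => ?_, K, Finset.sum_nonneg fun m _ => hK0 m, fun u => ?_⟩
  · obtain ⟨m, -, rfl⟩ := List.mem_map.1 hl
    have := isFiniteMeasure_restrict_of_subset (gridCell_subset_cball (d := d) N m)
    refine ⟨volume.real (gridCell N m), fun u => ?_⟩
    have cu := continuousOn_smooth u
    have h1 := norm_integral_sq_le
      (integrableOn_of_subset_cball cu (gridCell_subset_cball N m))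
      (integrableOn_of_subset_cball (cu.norm.pow 2) (gridCell_subset_cball N m))
    have h2 : (volume.restrict (gridCell (d := d) N m)).real Set.univ
        = volume.real (gridCell N m) := by simp
    rw [h2] at h1
    refine h1.trans (mul_le_mul_of_nonneg_left ?_ measureReal_nonneg)
    have h3 : ∫ x in gridCell N m, ‖(u : Euc d → ℂ) x‖ ^ 2 ≤ ballSq u := by
      rw [ballSq_eq]
      exact setIntegral_mono_set (integrableOn_ball_norm_sq u)
        (Filter.Eventually.of_forall fun x => by positivity)
        (Filter.Eventually.of_forall (gridCell_subset_ball N m))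
    have := gradSq_nonneg u
    change ∫ x in gridCell N m, ‖(u : Euc d → ℂ) x‖ ^ 2 ≤ _
    linarith
  · have hsum : (List.map (fun l : Smooth d →ₗ[ℂ] ℂ => ‖l u‖ ^ 2) (s.toList.map ℓ)).sum
        = ∑ m ∈ s, ‖ℓ m u‖ ^ 2 := by
      rw [List.map_map, ← Finset.sum_map_toList]
      rfl
    rw [hsum, ballSq_eq, integral_ball_eq_sum_gridCell N (continuousOn_norm_sq u)]
    have h1 : ∀ m, ∫ x in gridCell N m, ‖(u : Euc d → ℂ) x‖ ^ 2
        ≤ ε * (∫ x in gridCell N m, gradNormSq u x)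
          + 2 / volume.real (gridCell N m) * ‖ℓ m u‖ ^ 2 := by
      intro m
      refine (integral_norm_sq_le_of_convex u (gridCell_subset_cball N m)
        (measurableSet_gridCell N m) (convex_gridCell N m) (by positivity)
        fun x hx y hy => norm_sub_sq_le_of_mem_gridCell hN1 hx hy).trans ?_
      refine add_le_add ?_ le_rfl
      exact mul_le_mul_of_nonneg_right hsmall (integral_nonneg fun x => gradNormSq_nonneg u x)
    refine (Finset.sum_le_sum fun m _ => h1 m).trans ?_
    rw [Finset.sum_add_distrib, ← Finset.mul_sum, ← hs,
      ← integral_ball_eq_sum_gridCell N (continuousOn_gradNormSq u), integral_ball_gradNormSq]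
    have h2 : ∑ m ∈ s, 2 / volume.real (gridCell N m) * ‖ℓ m u‖ ^ 2
        ≤ K * ∑ m ∈ s, ‖ℓ m u‖ ^ 2 := by
      rw [Finset.mul_sum]
      refine Finset.sum_le_sum fun m hm => mul_le_mul_of_nonneg_right ?_ (by positivity)
      exact Finset.single_le_sum (fun m _ => hK0 m) hm
    have := mul_nonneg hε.le (ballSq_nonneg u)
    linarith

/-! ### Boundary values -/

theorem two_re_l2Ball_rad {d : ℕ} (hd : 1 ≤ d) (u : Smooth d) :
    2 * (l2Ball (rad u) u).re = sphSq u - d * ballSq u := by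
  have h1 : sphSq u = (intSphere (u * conjS u)).re := rfl
  have h2 : l2Ball u (rad u) = intBall (u * conjS (rad u)) := rfl
  have h3 : l2Ball (rad u) u = intBall (rad u * conjS u) := rfl
  have h4 : ballSq u = (intBall (u * conjS u)).re := rfl
  have h5 := isSemiInner_l2Ball.re_symm u (rad u)
  rw [h1, intSphere_eq hd, rad_mul, map_add, ← conjS_rad, ← h2, ← h3, h4]
  simp only [Complex.add_re, Complex.mul_re, Complex.natCast_re, Complex.natCast_im, zero_mul,
    sub_zero]
  linarith

theorem two_mul_le_of_sq_le {a b c ε : ℝ} (ha : 0 ≤ a) (hb : 0 ≤ b) (hε : 0 < ε)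
    (h : c ^ 2 ≤ a * b) : 2 * c ≤ ε * a + ε⁻¹ * b := by
  refine (abs_le_of_sq_le_sq' ?_ (by positivity)).2
  have e : (ε * a + ε⁻¹ * b) ^ 2 - 4 * (a * b) = (ε * a - ε⁻¹ * b) ^ 2 := by
    field_simp
    ring
  nlinarith [sq_nonneg (ε * a - ε⁻¹ * b)]

/-- The trace inequality, with a small constant in front of the gradient. -/
theorem sphSq_le {d : ℕ} (hd : 1 ≤ d) (u : Smooth d) {ε : ℝ} (hε : 0 < ε) :
    sphSq u ≤ ε * gradSq u + (d + ε⁻¹) * ballSq u := by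
  have h1 := two_re_l2Ball_rad hd u
  have h2 := two_mul_le_of_sq_le (ballSq_nonneg (rad u)) (ballSq_nonneg u) hε
    (norm_l2Ball_sq_le (rad u) u)
  have h3 := Complex.re_le_norm (l2Ball (rad u) u)
  have h4 := mul_le_mul_of_nonneg_left (ballSq_rad_le u) hε.le
  linarith

theorem ballSq_le_sphSq_add_gradSq {d : ℕ} (hd : 2 ≤ d) (u : Smooth d) :
    ballSq u ≤ sphSq u + gradSq u := by
  have h1 := two_re_l2Ball_rad (by omega) u
  have h2 := two_norm_l2Ball_le (rad u) u
  have h3 := (abs_le.1 (Complex.abs_re_le_norm (l2Ball (rad u) u))).1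
  have h4 := ballSq_rad_le u
  have h5 : (2 : ℝ) ≤ d := by exact_mod_cast hd
  nlinarith [ballSq_nonneg u]

theorem relCompact_sphSq {d : ℕ} (hd : 1 ≤ d) :
    RelCompact (fun u : Smooth d => gradSq u + ballSq u) sphSq := by
  intro ε hε
  have hc : (0 : ℝ) < d + (ε / 2)⁻¹ := by positivity
  obtain ⟨L, hL, K, hK, h⟩ := relCompact_ballSq d (ε / 2 / (d + (ε / 2)⁻¹)) (by positivity)
  refine ⟨L, hL, (d + (ε / 2)⁻¹) * K, by positivity, fun u => ?_⟩
  have h1 := sphSq_le hd u (half_pos hε)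
  have h2 := mul_le_mul_of_nonneg_left (h u) hc.le
  have h3 : ((d : ℝ) + (ε / 2)⁻¹) * (ε / 2 / (d + (ε / 2)⁻¹) * (gradSq u + ballSq u)
      + K * (L.map fun l => ‖l u‖ ^ 2).sum) = ε / 2 * (gradSq u + ballSq u)
      + (d + (ε / 2)⁻¹) * K * (L.map fun l => ‖l u‖ ^ 2).sum := by
    field_simp
  have h4 := mul_nonneg hε.le (ballSq_nonneg u)
  simp only at h2
  rw [h3] at h2
  nlinarith

/-! ### Sums over iterated derivatives -/

/-- The sum of the values of `F` over all `n`-fold compositions of the maps `T i`. -/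
def iterSum {V ι M : Type*} [Fintype ι] [AddCommMonoid M] (T : ι → V → V) :
    ℕ → (V → M) → V → M
  | 0, F, v => F v
  | n + 1, F, v => ∑ i, iterSum T n F (T i v)

section iterSum

variable {V ι M : Type*} [Fintype ι]

theorem iterSum_succ [AddCommMonoid M] (T : ι → V → V) (n : ℕ) (F : V → M) (v : V) :
    iterSum T (n + 1) F v = ∑ i, iterSum T n F (T i v) := rfl

/-- The last map applied can be summed over first. -/
theorem iterSum_succ' [AddCommMonoid M] (T : ι → V → V) (n : ℕ) (F : V → M) (v : V) :
    iterSum T (n + 1) F v = iterSum T n (fun w => ∑ i, F (T i w)) v := by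
  induction n generalizing v with
  | zero => rfl
  | succ n ih =>
    rw [iterSum_succ, iterSum_succ]
    exact Finset.sum_congr rfl fun i _ => ih _

theorem iterSum_sum [AddCommMonoid M] {κ : Type*} (s : Finset κ) (T : ι → V → V) (n : ℕ)
    (F : κ → V → M) (v : V) :
    iterSum T n (fun w => ∑ j ∈ s, F j w) v = ∑ j ∈ s, iterSum T n (F j) v := by
  induction n generalizing v with
  | zero => rfl
  | succ n ih =>
    simp only [iterSum_succ, ih]
    exact Finset.sum_comm

theorem iterSum_add [AddCommMonoid M] (T : ι → V → V) (n : ℕ) (F G : V → M) (v : V) :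
    iterSum T n (fun w => F w + G w) v = iterSum T n F v + iterSum T n G v := by
  induction n generalizing v with
  | zero => rfl
  | succ n ih => simp only [iterSum_succ, ih, Finset.sum_add_distrib]

theorem iterSum_mul (T : ι → V → V) (n : ℕ) (c : ℝ) (F : V → ℝ) (v : V) :
    iterSum T n (fun w => c * F w) v = c * iterSum T n F v := by
  induction n generalizing v with
  | zero => rfl
  | succ n ih => simp only [iterSum_succ, ih, Finset.mul_sum]

theorem iterSum_mono (T : ι → V → V) (n : ℕ) {F G : V → ℝ} (h : ∀ v, F v ≤ G v) (v : V) :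
    iterSum T n F v ≤ iterSum T n G v := by
  induction n generalizing v with
  | zero => exact h v
  | succ n ih => exact Finset.sum_le_sum fun i _ => ih _

theorem iterSum_nonneg (T : ι → V → V) (n : ℕ) {F : V → ℝ} (h : ∀ v, 0 ≤ F v) (v : V) :
    0 ≤ iterSum T n F v := by
  induction n generalizing v with
  | zero => exact h v
  | succ n ih => exact Finset.sum_nonneg fun i _ => ih _

end iterSum

/-- The sum of the squared `L²` norms of all derivatives of order `n`. -/
noncomputable def derivSq {d : ℕ} (n : ℕ) (u : Smooth d) : ℝ := iterSum (fun i => pd i) n ballSq u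

theorem derivSq_zero {d : ℕ} (u : Smooth d) : derivSq 0 u = ballSq u := rfl

theorem derivSq_succ {d : ℕ} (n : ℕ) (u : Smooth d) :
    derivSq (n + 1) u = ∑ i, derivSq n (pd i u) := rfl

theorem iterSum_gradSq {d : ℕ} (n : ℕ) (u : Smooth d) :
    iterSum (fun i => pd i) n gradSq u = derivSq (n + 1) u :=
  (iterSum_succ' _ n ballSq u).symm

theorem derivSq_nonneg {d : ℕ} (n : ℕ) (u : Smooth d) : 0 ≤ derivSq n u :=
  iterSum_nonneg _ n ballSq_nonneg u

/-! ### Interpolation between derivatives -/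

theorem pd_pow {d : ℕ} (i : Fin d) (w : Smooth d) (m : ℕ) :
    pd i (w ^ (m + 1)) = (m + 1 : ℕ) * w ^ m * pd i w := by
  induction m with
  | zero => simp
  | succ m ih =>
    rw [pow_succ, pd_mul, ih]
    push_cast
    ring

/-- Integration by parts against a weight that vanishes to high order at the sphere moves all
derivatives onto the weight. -/
theorem exists_iterSum_intBall_le {d : ℕ} (hd : 1 ≤ d) (m : ℕ) (g : Smooth d) :
    ∃ C : ℝ, 0 ≤ C ∧ ∀ u : Smooth d,
      iterSum (fun i => pd i) m (fun v => ‖intBall ((1 - normSq d) ^ m * g * v)‖ ^ 2) u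
        ≤ C * ballSq u := by
  induction m generalizing g with
  | zero =>
    refine ⟨ballSq (conjS g), ballSq_nonneg _, fun u => ?_⟩
    have h := norm_l2Ball_sq_le u (conjS g)
    have e : l2Ball u (conjS g) = intBall ((1 - normSq d) ^ 0 * g * u) := by
      rw [l2Ball_eq]
      refine intBall_congr fun x _ => ?_
      change (u : Euc d → ℂ) x * conj (conj ((g : Euc d → ℂ) x)) = _
      rw [Complex.conj_conj, pow_zero, one_mul, mul_comm]
      rfl
    rw [e, mul_comm (ballSq u)] at h
    exact h
  | succ m ih =>
    let G : Fin d → Smooth d := fun i =>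
      (m + 1 : ℕ) * pd i (1 - normSq d) * g + (1 - normSq d) * pd i g
    have hG : ∀ i, ∃ C : ℝ, 0 ≤ C ∧ ∀ u : Smooth d,
      iterSum (fun i => pd i) m (fun v => ‖intBall ((1 - normSq d) ^ m * G i * v)‖ ^ 2) u
        ≤ C * ballSq u := fun i => ih (G i)
    choose C hC0 hC using hG
    refine ⟨∑ i, C i, Finset.sum_nonneg fun i _ => hC0 i, fun u => ?_⟩
    have key : ∀ i (v : Smooth d), ‖intBall ((1 - normSq d) ^ (m + 1) * g * pd i v)‖ ^ 2
        = ‖intBall ((1 - normSq d) ^ m * G i * v)‖ ^ 2 := by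
      intro i v
      have h1 := intBall_pd hd i ((1 - normSq d) ^ (m + 1) * g * v)
      have h2 : intSphere (coord i * ((1 - normSq d) ^ (m + 1) * g * v)) = 0 := by
        rw [← map_zero (intSphere (d := d))]
        refine intSphere_congr fun x hx => ?_
        change ((x i : ℝ) : ℂ) * ((1 - (normSq d : Euc d → ℂ) x) ^ (m + 1)
          * (g : Euc d → ℂ) x * (v : Euc d → ℂ) x) = 0
        rw [normSq_apply, hx]
        simp
      have h3 : pd i ((1 - normSq d) ^ (m + 1) * g * v)
          = (1 - normSq d) ^ m * G i * v + (1 - normSq d) ^ (m + 1) * g * pd i v := by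
        rw [pd_mul, pd_mul, pd_pow]
        simp only [G]
        ring
      rw [h2, h3, map_add] at h1
      rw [eq_neg_of_add_eq_zero_right h1, norm_neg]
    rw [iterSum_succ']
    simp only [key]
    rw [iterSum_sum, Finset.sum_mul]
    exact Finset.sum_le_sum fun i _ => hC i u

theorem intBall_weight_ne_zero (d m : ℕ) : intBall ((1 - normSq d) ^ m) ≠ 0 := by
  have h1 : intBall ((1 - normSq d) ^ m)
      = ((∫ x in Metric.ball (0 : Euc d) 1, (1 - ‖x‖ ^ 2) ^ m : ℝ) : ℂ) := by
    rw [← integral_complex_ofReal]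
    refine setIntegral_congr_fun measurableSet_ball fun x _ => ?_
    change (1 - (normSq d : Euc d → ℂ) x) ^ m = _
    rw [normSq_apply]
    push_cast
    rfl
  have hpos : ∀ x ∈ Metric.ball (0 : Euc d) 1, 0 < (1 - ‖x‖ ^ 2) ^ m := by
    intro x hx
    have hx1 : ‖x‖ < 1 := by simpa using hx
    have : 0 < 1 - ‖x‖ ^ 2 := by nlinarith [norm_nonneg x]
    positivity
  have hi : IntegrableOn (fun x : Euc d => (1 - ‖x‖ ^ 2) ^ m) (Metric.ball 0 1) :=
    integrableOn_of_subset_cball (by fun_prop) Metric.ball_subset_closedBall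
  rw [h1, Complex.ofReal_ne_zero]
  refine ne_of_gt ((setIntegral_pos_iff_support_of_nonneg_ae ?_ hi).2 ?_)
  · exact (ae_restrict_mem measurableSet_ball).mono fun x hx => (hpos x hx).le
  · rw [Set.inter_eq_right.2 fun x hx => Function.mem_support.2 (hpos x hx).ne']
    exact Metric.measure_ball_pos _ _ one_pos

theorem exists_ballSq_le_gradSq_add {d : ℕ} (m : ℕ) :
    ∃ C : ℝ, 0 ≤ C ∧ ∀ u : Smooth d,
      ballSq u ≤ C * (gradSq u + ‖intBall ((1 - normSq d) ^ m * u)‖ ^ 2) := by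
  set φ : Smooth d := (1 - normSq d) ^ m with hφ
  set c := intBall φ with hc
  have hc0 : 0 < ‖c‖ := norm_pos_iff.2 (intBall_weight_ne_zero d m)
  obtain ⟨M, -, hM⟩ := exists_bound φ
  set V := volume.real (Metric.ball (0 : Euc d) 1) with hV
  have hV0 : 0 ≤ V := measureReal_nonneg
  have : IsFiniteMeasure ((volume : Measure (Euc d)).restrict (Metric.ball 0 1)) :=
    isFiniteMeasure_restrict_of_subset Metric.ball_subset_closedBall
  refine ⟨2 * (M ^ 2 * V ^ 2 * 2 ^ d * 4 + V) / ‖c‖ ^ 2, by positivity, fun u => ?_⟩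
  have h1 := integral_norm_mul_sub_sq_le u φ (D := Metric.ball 0 1) Metric.ball_subset_closedBall
    measurableSet_ball (convex_ball 0 1) (δ := 4) (by norm_num) (fun x hx y hy => by
      have hx1 : ‖x‖ < 1 := by simpa using hx
      have hy1 : ‖y‖ < 1 := by simpa using hy
      have := norm_sub_le x y
      nlinarith [norm_nonneg (x - y)]) (fun x hx => hM x (Metric.ball_subset_closedBall hx))
  rw [integral_ball_gradNormSq] at h1
  set I := intBall (φ * u) with hI
  change ∫ x in Metric.ball (0 : Euc d) 1, ‖c * (u : Euc d → ℂ) x - I‖ ^ 2 ≤ _ at h1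
  have ci : ContinuousOn (fun x => ‖c * (u : Euc d → ℂ) x - I‖ ^ 2) (cball d) :=
    ((continuousOn_const.mul (continuousOn_smooth u)).sub continuousOn_const).norm.pow 2
  have h2 : ‖c‖ ^ 2 * ballSq u
      ≤ ∫ x in Metric.ball (0 : Euc d) 1, (2 * ‖c * (u : Euc d → ℂ) x - I‖ ^ 2 + 2 * ‖I‖ ^ 2) := by
    rw [ballSq_eq, ← integral_const_mul]
    refine integral_mono ((integrableOn_ball_norm_sq u).const_mul _)
      (((integrableOn_of_subset_cball ci Metric.ball_subset_closedBall).const_mul 2).add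
        (integrable_const _)) fun x => ?_
    have h3 : ‖c‖ * ‖(u : Euc d → ℂ) x‖ ≤ ‖c * (u : Euc d → ℂ) x - I‖ + ‖I‖ := by
      have := norm_sub_le (c * (u : Euc d → ℂ) x - I) (-I)
      rwa [sub_neg_eq_add, sub_add_cancel, norm_mul, norm_neg] at this
    change ‖c‖ ^ 2 * ‖(u : Euc d → ℂ) x‖ ^ 2 ≤ 2 * ‖c * (u : Euc d → ℂ) x - I‖ ^ 2 + 2 * ‖I‖ ^ 2
    rw [← mul_pow]
    refine (pow_le_pow_left₀ (by positivity) h3 2).trans ?_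
    nlinarith [sq_nonneg (‖c * (u : Euc d → ℂ) x - I‖ - ‖I‖)]
  rw [integral_add
    ((integrableOn_of_subset_cball ci Metric.ball_subset_closedBall).const_mul 2)
    (integrable_const _), integral_const_mul, integral_const, smul_eq_mul] at h2
  have h3 : (volume.restrict (Metric.ball (0 : Euc d) 1)).real Set.univ = V := by simp [hV]
  rw [h3] at h2
  rw [div_mul_eq_mul_div, le_div_iff₀ (by positivity), mul_comm (ballSq u)]
  have h4 := gradSq_nonneg u
  have h5 : 0 ≤ M ^ 2 * V ^ 2 * 2 ^ d * 4 := by positivity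
  nlinarith [mul_nonneg h5 (sq_nonneg ‖I‖), mul_nonneg hV0 h4]

theorem exists_derivSq_le_succ {d : ℕ} (hd : 1 ≤ d) (m : ℕ) :
    ∃ C : ℝ, 0 ≤ C ∧ ∀ u : Smooth d, derivSq m u ≤ C * (derivSq (m + 1) u + ballSq u) := by
  obtain ⟨C, hC0, hC⟩ := exists_ballSq_le_gradSq_add (d := d) m
  obtain ⟨C', hC'0, hC'⟩ := exists_iterSum_intBall_le hd m 1
  simp only [mul_one] at hC'
  refine ⟨C * (1 + C'), by positivity, fun u => ?_⟩
  have h1 := iterSum_mono (fun i => pd (d := d) i) m hC u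
  rw [iterSum_mul, iterSum_add, iterSum_gradSq] at h1
  refine h1.trans ?_
  rw [mul_assoc]
  refine mul_le_mul_of_nonneg_left ?_ hC0
  nlinarith [hC' u, mul_nonneg hC'0 (derivSq_nonneg (m + 1) u), ballSq_nonneg u]

/-- Derivatives of intermediate order are controlled by those of the highest order and by the
function itself. -/
theorem exists_derivSq_le {d : ℕ} (hd : 1 ≤ d) {m n : ℕ} (hmn : m ≤ n) :
    ∃ C : ℝ, 0 ≤ C ∧ ∀ u : Smooth d, derivSq m u ≤ C * (derivSq n u + ballSq u) := by
  induction n, hmn using Nat.le_induction with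
  | base => exact ⟨1, zero_le_one, fun u => by linarith [ballSq_nonneg u]⟩
  | succ n hmn ih =>
    obtain ⟨C, hC0, hC⟩ := ih
    obtain ⟨C', hC'0, hC'⟩ := exists_derivSq_le_succ hd n
    refine ⟨C * (C' + 1), by positivity, fun u => (hC u).trans ?_⟩
    rw [mul_assoc]
    refine mul_le_mul_of_nonneg_left ?_ hC0
    linarith [hC' u, derivSq_nonneg (n + 1) u]

/-! ### The homogeneous forms -/

theorem pdIter_succ {d n : ℕ} (i : Fin (n + 1) → Fin d) (f : SmoothPair d) :
    pdIter i f = pdPair (i 0) (pdIter (fun a => i a.succ) f) := by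
  rw [pdIter, List.ofFn_succ, List.prod_cons]
  rfl

theorem sum_pdIter {d : ℕ} {M : Type*} [AddCommMonoid M] (n : ℕ) (F : SmoothPair d → M)
    (f : SmoothPair d) :
    ∑ i : Fin n → Fin d, F (pdIter i f) = iterSum (fun i => pdPair i) n F f := by
  induction n generalizing F with
  | zero =>
    rw [Fintype.sum_unique]
    simp [pdIter, iterSum]
  | succ n ih =>
    rw [iterSum_succ', ← ih, ← (Fin.consEquiv fun _ => Fin d).sum_comp, Fintype.sum_prod_type,
      Finset.sum_comm]
    refine Finset.sum_congr rfl fun i _ => Finset.sum_congr rfl fun j _ => ?_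
    rw [pdIter_succ]
    rfl

theorem iterSum_pdPair_fst {d : ℕ} {M : Type*} [AddCommMonoid M] (n : ℕ) (F : Smooth d → M)
    (j : Fin d) (f : SmoothPair d) :
    iterSum (fun i => pdPair i) n (fun h => F (h.1 j)) f = iterSum (fun i => pd i) n F (f.1 j) := by
  induction n generalizing f with
  | zero => rfl
  | succ n ih => exact Finset.sum_congr rfl fun i _ => ih _

theorem iterSum_pdPair_snd {d : ℕ} {M : Type*} [AddCommMonoid M] (n : ℕ) (F : Smooth d → M)
    (j : Fin d) (f : SmoothPair d) :
    iterSum (fun i => pdPair i) n (fun h => F (h.2 j)) f = iterSum (fun i => pd i) n F (f.2 j) := by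
  induction n generalizing f with
  | zero => rfl
  | succ n ih => exact Finset.sum_congr rfl fun i _ => ih _

theorem energyOne_self {d : ℕ} (f : SmoothPair d) :
    (energyOne f f).re
      = ∑ j, gradSq (f.1 j) + ∑ j, ballSq (f.2 j) + ∑ j, sphSq (f.1 j) := by
  simp only [energyOne, Complex.add_re, Complex.re_sum]
  rw [Finset.sum_comm]
  rfl

theorem energyDot_self {d : ℕ} (n : ℕ) (f : SmoothPair d) :
    (energyDot (n + 1) f f).re = ∑ j, derivSq (n + 1) (f.1 j) + ∑ j, derivSq n (f.2 j)
      + ∑ j, iterSum (fun i => pd i) n sphSq (f.1 j) := by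
  have h : (energyDot (n + 1) f f).re
      = ∑ i : Fin n → Fin d, (energyOne (pdIter i f) (pdIter i f)).re := by
    rw [energyDot, Complex.re_sum]
    rfl
  rw [h, sum_pdIter n fun g : SmoothPair d => (energyOne g g).re]
  simp only [energyOne_self, iterSum_add, iterSum_sum]
  simp only [iterSum_pdPair_fst n gradSq, iterSum_pdPair_snd n ballSq,
    iterSum_pdPair_fst n sphSq, iterSum_gradSq]
  rfl

theorem energyDot_one {d : ℕ} (f g : SmoothPair d) : energyDot 1 f g = energyOne f g := by
  change ∑ i : Fin 0 → Fin d, energyOne (pdIter i f) (pdIter i g) = energyOne f g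
  rw [Fintype.sum_unique]
  simp [pdIter]

theorem energyDot_le_energy {d k : ℕ} (hk : 1 ≤ k) (f : SmoothPair d) :
    (energyDot k f f).re ≤ (energy k f f).re := by
  unfold energy
  split_ifs with h
  · obtain rfl : k = 1 := by omega
    rw [energyDot_one]
  · rw [Complex.add_re]
    linarith [isSemiInner_energyOne.nonneg f]

theorem energyOne_le_energy {d : ℕ} (k : ℕ) (f : SmoothPair d) :
    (energyOne f f).re ≤ (energy k f f).re := by
  unfold energy
  split_ifs with h
  · rfl
  · rw [Complex.add_re]
    linarith [(isSemiInner_energyDot k).nonneg f]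

/-! ### The free generator -/

/-- Green's formula. -/
theorem sum_l2Ball_pd_add {d : ℕ} (hd : 1 ≤ d) (u v : Smooth d) :
    ∑ i, l2Ball (pd i u) (pd i v) + l2Ball (∑ i, pd i (pd i u)) v = l2Sphere (rad u) v := by
  rw [isSemiInner_l2Ball.sum, ← Finset.sum_add_distrib, rad, isSemiInner_l2Sphere.sum]
  refine Finset.sum_congr rfl fun i _ => ?_
  have h := intBall_pd hd i (pd i u * conjS v)
  rw [pd_mul, map_add, pd_conjS, ← mul_assoc] at h
  rw [l2Ball_eq, l2Ball_eq, l2Sphere_eq, ← h, add_comm]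

/-- The energy identity for one component; the boundary terms form, up to the last term, a
negative square. -/
theorem re_freeGen_component_le {d : ℕ} (hd : 3 ≤ d) (u v : Smooth d) :
    (∑ i, l2Ball (pd i (-rad u + v)) (pd i u)).re
        + (l2Ball ((∑ i, pd i (pd i u)) - rad v - v) v).re + (l2Sphere (-rad u + v) u).re
      ≤ ((d : ℝ) / 2 - 1) * (gradSq u + ballSq v + sphSq u) := by
  have hd1 : 1 ≤ d := by omega
  have h3 : (3 : ℝ) ≤ d := by exact_mod_cast hd
  have hB := isSemiInner_l2Ball (d := d)
  have hS := isSemiInner_l2Sphere (d := d)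
  have e1 : (∑ i, l2Ball (pd i (-rad u + v)) (pd i u)).re
      = ((d : ℝ) / 2 - 1) * gradSq u - 2⁻¹ * ∑ i, sphSq (pd i u)
        + (∑ i, l2Ball (pd i v) (pd i u)).re := by
    simp only [Complex.re_sum, gradSq, Finset.mul_sum, ← Finset.sum_sub_distrib,
      ← Finset.sum_add_distrib]
    refine Finset.sum_congr rfl fun i _ => ?_
    rw [map_add, map_neg, pd_rad, hB.add, hB.neg, hB.add]
    have h := two_re_l2Ball_rad hd1 (pd i u)
    have h' : ballSq (pd i u) = (l2Ball (pd i u) (pd i u)).re := rfl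
    simp only [Complex.add_re, Complex.neg_re]
    rw [← h']
    linarith
  have e2 : (l2Ball ((∑ i, pd i (pd i u)) - rad v - v) v).re
      = (l2Ball (∑ i, pd i (pd i u)) v).re + ((d : ℝ) / 2 - 1) * ballSq v - 2⁻¹ * sphSq v := by
    rw [hB.sub, hB.sub]
    have h := two_re_l2Ball_rad hd1 v
    have h' : ballSq v = (l2Ball v v).re := rfl
    simp only [Complex.sub_re]
    rw [← h']
    linarith
  have e3 : (∑ i, l2Ball (pd i v) (pd i u)).re + (l2Ball (∑ i, pd i (pd i u)) v).re
      = (l2Sphere (rad u) v).re := by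
    rw [← sum_l2Ball_pd_add hd1 u v, Complex.add_re, Complex.re_sum, Complex.re_sum]
    congr 1
    exact Finset.sum_congr rfl fun i _ => hB.re_symm _ _
  have e4 : (l2Sphere (-rad u + v) u).re = -(l2Sphere (rad u) u).re + (l2Sphere v u).re := by
    rw [hS.add, hS.neg, Complex.add_re, Complex.neg_re]
  have e5 : 0 ≤ sphSq v + sphSq (rad u) + sphSq u - 2 * (l2Sphere (rad u) v).re
      - 2 * (l2Sphere v u).re + 2 * (l2Sphere (rad u) u).re := by
    have h := hS.nonneg (v - rad u - u)
    rw [hS.sub, hS.sub, ← hS.symm (v - rad u - u) v, ← hS.symm (v - rad u - u) (rad u),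
      ← hS.symm (v - rad u - u) u] at h
    simp only [hS.sub, Complex.sub_re, map_sub, Complex.conj_re] at h
    have s1 := hS.re_symm v (rad u)
    have s2 := hS.re_symm u v
    have s3 := hS.re_symm u (rad u)
    have q1 : sphSq v = (l2Sphere v v).re := rfl
    have q2 : sphSq u = (l2Sphere u u).re := rfl
    have q3 : sphSq (rad u) = (l2Sphere (rad u) (rad u)).re := rfl
    linarith
  have e6 := sphSq_rad_le u
  have e7 := sphSq_nonneg u
  rw [e1, e2, e4]
  nlinarith

theorem re_energyOne_freeGen_le {d : ℕ} (hd : 3 ≤ d) (f : SmoothPair d) :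
    (energyOne (freeGen f) f).re ≤ ((d : ℝ) / 2 - 1) * (energyOne f f).re := by
  have h1 : (energyOne (freeGen f) f).re
      = ∑ j, ((∑ i, l2Ball (pd i (-rad (f.1 j) + f.2 j)) (pd i (f.1 j))).re
        + (l2Ball ((∑ i, pd i (pd i (f.1 j))) - rad (f.2 j) - f.2 j) (f.2 j)).re
        + (l2Sphere (-rad (f.1 j) + f.2 j) (f.1 j)).re) := by
    simp only [energyOne, Complex.add_re, Complex.re_sum, Finset.sum_add_distrib]
    rw [Finset.sum_comm]
    rfl
  rw [h1, energyOne_self, ← Finset.sum_add_distrib, ← Finset.sum_add_distrib, Finset.mul_sum]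
  exact Finset.sum_le_sum fun j _ => re_freeGen_component_le hd _ _

theorem pdPair_freeGen {d : ℕ} (i : Fin d) (f : SmoothPair d) :
    pdPair i (freeGen f) = freeGen (pdPair i f) - pdPair i f := by
  refine Prod.ext ?_ ?_
  · funext n
    change pd i (-rad (f.1 n) + f.2 n) = -rad (pd i (f.1 n)) + pd i (f.2 n) - pd i (f.1 n)
    rw [map_add, map_neg, pd_rad]
    ring
  · funext n
    change pd i ((∑ j, pd j (pd j (f.1 n))) - rad (f.2 n) - f.2 n)
      = (∑ j, pd j (pd j (pd i (f.1 n)))) - rad (pd i (f.2 n)) - pd i (f.2 n) - pd i (f.2 n)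
    rw [map_sub, map_sub, map_sum, pd_rad]
    have h : ∀ j, pd i (pd j (pd j (f.1 n))) = pd j (pd j (pd i (f.1 n))) := fun j => by
      rw [pd_comm i j, pd_comm i j]
    simp only [h]
    ring

theorem pdIter_freeGen {d n : ℕ} (i : Fin n → Fin d) (f : SmoothPair d) :
    pdIter i (freeGen f) = freeGen (pdIter i f) - (n : ℂ) • pdIter i f := by
  induction n with
  | zero => simp [pdIter]
  | succ n ih =>
    rw [pdIter_succ, pdIter_succ, ih, map_sub, map_smul, pdPair_freeGen]
    push_cast
    rw [add_smul, one_smul]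
    abel

theorem re_energyDot_freeGen_le {d : ℕ} (hd : 3 ≤ d) {k : ℕ} (hk : 1 ≤ k) (f : SmoothPair d) :
    (energyDot k (freeGen f) f).re ≤ ((d : ℝ) / 2 - k) * (energyDot k f f).re := by
  simp only [energyDot, Complex.re_sum, Finset.mul_sum]
  refine Finset.sum_le_sum fun i _ => ?_
  have h := re_energyOne_freeGen_le hd (pdIter i f)
  rw [pdIter_freeGen, isSemiInner_energyOne.sub, isSemiInner_energyOne.smul, Complex.sub_re,
    Complex.mul_re, Complex.natCast_re, Complex.natCast_im, zero_mul, sub_zero, Nat.cast_sub hk,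
    Nat.cast_one]
  linarith

/-! ### The perturbation -/

/-- The sum of the squared `L²` norms of all derivatives of order less than `n`. -/
noncomputable def lowSq {d : ℕ} (n : ℕ) (u : Smooth d) : ℝ := ∑ m ∈ Finset.range n, derivSq m u

theorem lowSq_nonneg {d : ℕ} (n : ℕ) (u : Smooth d) : 0 ≤ lowSq n u :=
  Finset.sum_nonneg fun _ _ => derivSq_nonneg _ _

theorem lowSq_mono {d m n : ℕ} (h : m ≤ n) (u : Smooth d) : lowSq m u ≤ lowSq n u :=
  Finset.sum_le_sum_of_subset_of_nonneg (Finset.range_subset_range.2 h)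
    fun _ _ _ => derivSq_nonneg _ _

theorem derivSq_le_lowSq {d m n : ℕ} (h : m < n) (u : Smooth d) : derivSq m u ≤ lowSq n u :=
  Finset.single_le_sum (f := fun m => derivSq m u) (fun _ _ => derivSq_nonneg _ _)
    (Finset.mem_range.2 h)

theorem sum_lowSq_pd_le {d : ℕ} (n : ℕ) (u : Smooth d) :
    ∑ i, lowSq n (pd i u) ≤ lowSq (n + 1) u := by
  simp only [lowSq]
  rw [Finset.sum_comm, Finset.sum_range_succ']
  simp only [← derivSq_succ]
  linarith [derivSq_nonneg 0 u]

theorem ballSq_add_le_weighted {d : ℕ} {η : ℝ} (hη : 0 < η) (a b : Smooth d) :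
    ballSq (a + b) ≤ (1 + η) * ballSq a + (1 + η⁻¹) * ballSq b := by
  have h1 : ballSq (a + b) = ballSq a + ballSq b + 2 * (l2Ball a b).re :=
    isSemiInner_l2Ball.re_add_self a b
  have h2 := two_mul_le_of_sq_le (ballSq_nonneg a) (ballSq_nonneg b) hη (norm_l2Ball_sq_le a b)
  have h3 := Complex.re_le_norm (l2Ball a b)
  linarith

theorem derivSq_add_le_weighted {d : ℕ} {η : ℝ} (hη : 0 < η) (n : ℕ) (a b : Smooth d) :
    derivSq n (a + b) ≤ (1 + η) * derivSq n a + (1 + η⁻¹) * derivSq n b := by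
  induction n generalizing a b with
  | zero => exact ballSq_add_le_weighted hη a b
  | succ n ih =>
    simp only [derivSq_succ, Finset.mul_sum, map_add]
    rw [← Finset.sum_add_distrib]
    exact Finset.sum_le_sum fun i _ => ih _ _

theorem derivSq_add_le {d : ℕ} (n : ℕ) (a b : Smooth d) :
    derivSq n (a + b) ≤ 2 * derivSq n a + 2 * derivSq n b := by
  have h := derivSq_add_le_weighted one_pos n a b
  norm_num at h
  linarith

theorem derivSq_neg {d : ℕ} (n : ℕ) (a : Smooth d) : derivSq n (-a) = derivSq n a := by
  induction n generalizing a with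
  | zero => exact ballSq_neg a
  | succ n ih => simp only [derivSq_succ, map_neg, ih]

theorem derivSq_fun_zero {d : ℕ} (n : ℕ) : derivSq n (0 : Smooth d) = 0 := by
  induction n with
  | zero =>
    change (l2Ball (0 : Smooth d) 0).re = 0
    rw [isSemiInner_l2Ball.zero, Complex.zero_re]
  | succ n ih => simp only [derivSq_succ, map_zero, ih, Finset.sum_const_zero]

/-- Leibniz' rule: up to terms of lower order, multiplication by `g` is bounded on derivatives of
order `n` by a constant that does not depend on `n`. Each of the `n` steps costs an arbitrarily
small part of the gap between `M` and `K`. -/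
theorem exists_derivSq_mul_le {d : ℕ} (n : ℕ) (g : Smooth d) {M K : ℝ} (hM0 : 0 ≤ M)
    (hM : ∀ u : Smooth d, ballSq (g * u) ≤ M * ballSq u) (hMK : M < K) :
    ∃ c : ℝ, 0 ≤ c ∧ ∀ u : Smooth d, derivSq n (g * u) ≤ K * derivSq n u + c * lowSq n u := by
  induction n generalizing g M K with
  | zero =>
    refine ⟨0, le_rfl, fun u => ?_⟩
    have := mul_le_mul_of_nonneg_right hMK.le (ballSq_nonneg u)
    rw [zero_mul, add_zero]
    exact (hM u).trans this
  | succ n ih =>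
    set K' := (M + K) / 2 with hK'
    have hMK' : M < K' := by rw [hK']; linarith
    have hK'K : K' < K := by rw [hK']; linarith
    have hK'0 : 0 < K' := by linarith
    obtain ⟨c₀, hc₀, h₀⟩ := ih g hM0 hM hMK'
    choose N hN0 hN using fun i => exists_ballSq_mul_le (pd i g)
    choose c₁ hc₁ h₁ using fun i => ih (pd i g) (hN0 i) (hN i) (lt_add_one (N i))
    set η := K / K' - 1 with hη
    have hη0 : 0 < η := by
      rw [hη, sub_pos, lt_div_iff₀ hK'0]
      linarith
    have hηK : (1 + η) * K' = K := by
      rw [hη]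
      field_simp
      ring
    set R := ∑ i, (N i + 1 + c₁ i) with hR
    have hR0 : 0 ≤ R := Finset.sum_nonneg fun i _ => by linarith [hN0 i, hc₁ i]
    refine ⟨(1 + η) * c₀ + (1 + η⁻¹) * R, by positivity, fun u => ?_⟩
    have hi : ∀ i, derivSq n (pd i (g * u)) ≤ K * derivSq n (pd i u)
        + (1 + η) * c₀ * lowSq n (pd i u) + (1 + η⁻¹) * (N i + 1 + c₁ i) * lowSq (n + 1) u := by
      intro i
      rw [pd_mul, add_comm]
      refine (derivSq_add_le_weighted hη0 n _ _).trans ?_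
      have a1 := mul_le_mul_of_nonneg_left (h₀ (pd i u)) (by positivity : 0 ≤ 1 + η)
      have a2 : derivSq n (pd i g * u) ≤ (N i + 1 + c₁ i) * lowSq (n + 1) u := by
        have b1 := derivSq_le_lowSq (Nat.lt_succ_self n) u
        have b2 := lowSq_mono (Nat.le_succ n) u
        have b3 := mul_le_mul_of_nonneg_left b1 (by linarith [hN0 i] : 0 ≤ N i + 1)
        have b4 := mul_le_mul_of_nonneg_left b2 (hc₁ i)
        have b5 := h₁ i u
        rw [add_mul _ (c₁ i)]
        exact b5.trans (add_le_add b3 b4)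
      have a3 := mul_le_mul_of_nonneg_left a2 (by positivity : 0 ≤ 1 + η⁻¹)
      have a4 : (1 + η) * (K' * derivSq n (pd i u) + c₀ * lowSq n (pd i u))
          = K * derivSq n (pd i u) + (1 + η) * c₀ * lowSq n (pd i u) := by
        rw [← hηK]
        ring
      linarith
    rw [derivSq_succ, derivSq_succ]
    refine (Finset.sum_le_sum fun i _ => hi i).trans ?_
    rw [Finset.sum_add_distrib, Finset.sum_add_distrib, ← Finset.mul_sum, ← Finset.mul_sum,
      ← Finset.sum_mul, ← Finset.mul_sum, ← hR]
    have := mul_le_mul_of_nonneg_left (sum_lowSq_pd_le n u)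
      (by positivity : 0 ≤ (1 + η) * c₀)
    linarith

/-- The derivatives of a pair that enter the top order of the energy. -/
noncomputable def topPair {d : ℕ} (n : ℕ) (f : SmoothPair d) : ℝ :=
  ∑ j, derivSq (n + 1) (f.1 j) + ∑ j, derivSq n (f.2 j)

/-- The derivatives of a pair that are of lower order than those in `topPair n`. -/
noncomputable def lowPair {d : ℕ} (n : ℕ) (f : SmoothPair d) : ℝ :=
  ∑ j, lowSq (n + 1) (f.1 j) + ∑ j, lowSq n (f.2 j)

theorem topPair_le_lowPair {d m n : ℕ} (h : m < n) (f : SmoothPair d) :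
    topPair m f ≤ lowPair n f :=
  add_le_add (Finset.sum_le_sum fun _ _ => derivSq_le_lowSq (by omega) _)
    (Finset.sum_le_sum fun _ _ => derivSq_le_lowSq h _)

theorem lowPair_mono {d m n : ℕ} (h : m ≤ n) (f : SmoothPair d) : lowPair m f ≤ lowPair n f :=
  add_le_add (Finset.sum_le_sum fun _ _ => lowSq_mono (by omega) _)
    (Finset.sum_le_sum fun _ _ => lowSq_mono h _)

/-- A map on pairs behaves like a differential operator of order one in the first component and
of order zero in the second, with a bound on the top order that does not depend on the number of
derivatives. -/
def IsFirstOrder {d : ℕ} (T : SmoothPair d → Smooth d) : Prop :=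
  ∃ K : ℝ, 0 ≤ K ∧ ∀ n : ℕ, ∃ c : ℝ, 0 ≤ c ∧ ∀ f : SmoothPair d,
    derivSq n (T f) ≤ K * topPair n f + c * lowPair n f

namespace IsFirstOrder

variable {d : ℕ} {S T : SmoothPair d → Smooth d}

theorem fst (j : Fin d) : IsFirstOrder fun f : SmoothPair d => f.1 j := by
  refine ⟨0, le_rfl, fun n => ⟨1, zero_le_one, fun f => ?_⟩⟩
  rw [zero_mul, zero_add, one_mul]
  have h1 := derivSq_le_lowSq (Nat.lt_succ_self n) (f.1 j)
  have h2 : lowSq (n + 1) (f.1 j) ≤ ∑ j, lowSq (n + 1) (f.1 j) :=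
    Finset.single_le_sum (f := fun j => lowSq (n + 1) (f.1 j)) (fun _ _ => lowSq_nonneg _ _)
      (Finset.mem_univ j)
  have h3 : 0 ≤ ∑ j, lowSq n (f.2 j) := Finset.sum_nonneg fun _ _ => lowSq_nonneg _ _
  rw [lowPair]
  linarith

theorem snd (j : Fin d) : IsFirstOrder fun f : SmoothPair d => f.2 j := by
  refine ⟨1, zero_le_one, fun n => ⟨0, le_rfl, fun f => ?_⟩⟩
  rw [zero_mul, add_zero, one_mul]
  have h2 : derivSq n (f.2 j) ≤ ∑ j, derivSq n (f.2 j) :=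
    Finset.single_le_sum (f := fun j => derivSq n (f.2 j)) (fun _ _ => derivSq_nonneg _ _)
      (Finset.mem_univ j)
  have h3 : 0 ≤ ∑ j, derivSq (n + 1) (f.1 j) := Finset.sum_nonneg fun _ _ => derivSq_nonneg _ _
  rw [topPair]
  linarith

theorem pd_fst (i j : Fin d) : IsFirstOrder fun f : SmoothPair d => pd i (f.1 j) := by
  refine ⟨1, zero_le_one, fun n => ⟨0, le_rfl, fun f => ?_⟩⟩
  rw [zero_mul, add_zero, one_mul]
  have h1 : derivSq n (pd i (f.1 j)) ≤ derivSq (n + 1) (f.1 j) :=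
    Finset.single_le_sum (f := fun i => derivSq n (pd i (f.1 j)))
      (fun _ _ => derivSq_nonneg _ _) (Finset.mem_univ i)
  have h2 : derivSq (n + 1) (f.1 j) ≤ ∑ j, derivSq (n + 1) (f.1 j) :=
    Finset.single_le_sum (f := fun j => derivSq (n + 1) (f.1 j)) (fun _ _ => derivSq_nonneg _ _)
      (Finset.mem_univ j)
  have h3 : 0 ≤ ∑ j, derivSq n (f.2 j) := Finset.sum_nonneg fun _ _ => derivSq_nonneg _ _
  rw [topPair]
  linarith

theorem zero : IsFirstOrder fun _ : SmoothPair d => (0 : Smooth d) :=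
  ⟨0, le_rfl, fun n => ⟨0, le_rfl, fun f => by simp [derivSq_fun_zero]⟩⟩

theorem add (hS : IsFirstOrder S) (hT : IsFirstOrder T) : IsFirstOrder fun f => S f + T f := by
  obtain ⟨K, hK, h⟩ := hS
  obtain ⟨K', hK', h'⟩ := hT
  refine ⟨2 * (K + K'), by positivity, fun n => ?_⟩
  obtain ⟨c, hc, h1⟩ := h n
  obtain ⟨c', hc', h2⟩ := h' n
  refine ⟨2 * (c + c'), by positivity, fun f => (derivSq_add_le n _ _).trans ?_⟩
  linarith [h1 f, h2 f]

theorem neg (hT : IsFirstOrder T) : IsFirstOrder fun f => -T f := by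
  simpa only [IsFirstOrder, derivSq_neg] using hT

theorem sub (hS : IsFirstOrder S) (hT : IsFirstOrder T) : IsFirstOrder fun f => S f - T f := by
  simpa only [sub_eq_add_neg] using hS.add hT.neg

theorem sum {ι : Type*} (s : Finset ι) {F : ι → SmoothPair d → Smooth d}
    (hF : ∀ i, IsFirstOrder (F i)) : IsFirstOrder fun f => ∑ i ∈ s, F i f := by
  induction s using Finset.cons_induction with
  | empty => simpa using zero
  | cons a s ha ih =>
    simp only [Finset.sum_cons]
    exact (hF a).add ih

theorem mul (g : Smooth d) (hT : IsFirstOrder T) : IsFirstOrder fun f => g * T f := by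
  obtain ⟨K, hK, h⟩ := hT
  obtain ⟨M, hM0, hM⟩ := exists_ballSq_mul_le g
  refine ⟨(M + 1) * K, by positivity, fun n => ?_⟩
  choose c hc hcT using h
  obtain ⟨c', hc', h'⟩ := exists_derivSq_mul_le n g hM0 hM (lt_add_one M)
  refine ⟨(M + 1) * c n + c' * ∑ m ∈ Finset.range n, (K + c m), ?_, fun f => ?_⟩
  · have : 0 ≤ ∑ m ∈ Finset.range n, (K + c m) :=
      Finset.sum_nonneg fun m _ => add_nonneg hK (hc m)
    have := hc n
    positivity
  · have h1 : lowSq n (T f) ≤ (∑ m ∈ Finset.range n, (K + c m)) * lowPair n f := by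
      rw [lowSq, Finset.sum_mul]
      refine Finset.sum_le_sum fun m hm => (hcT m f).trans ?_
      have hmn := Finset.mem_range.1 hm
      rw [add_mul]
      exact add_le_add (mul_le_mul_of_nonneg_left (topPair_le_lowPair hmn f) hK)
        (mul_le_mul_of_nonneg_left (lowPair_mono hmn.le f) (hc m))
    have h2 := mul_le_mul_of_nonneg_left h1 hc'
    have h3 := mul_le_mul_of_nonneg_left (hcT n f) (by linarith : 0 ≤ M + 1)
    refine (h' (T f)).trans ?_
    linarith

end IsFirstOrder

theorem isFirstOrder_perturb {d : ℕ} (hd : 3 ≤ d) (n : Fin d) :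
    IsFirstOrder fun f : SmoothPair d => (perturb hd f).2 n := by
  have hlam : IsFirstOrder fun f : SmoothPair d => lam f.1 n :=
    IsFirstOrder.sum _ fun j => (IsFirstOrder.pd_fst j n).mul _
  have hkop : IsFirstOrder fun f : SmoothPair d => kop f.1 n :=
    IsFirstOrder.sum _ fun j =>
      ((IsFirstOrder.pd_fst j j).mul _).sub ((IsFirstOrder.pd_fst n j).mul _)
  exact ((IsFirstOrder.fst n).mul _).add
    (((((IsFirstOrder.snd n).mul _).sub hlam).add hkop).mul _)

theorem exists_sum_derivSq_perturb_le {d : ℕ} (hd : 3 ≤ d) :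
    ∃ K : ℝ, 0 ≤ K ∧ ∀ n : ℕ, ∃ c : ℝ, 0 ≤ c ∧ ∀ f : SmoothPair d,
      ∑ j, derivSq n ((perturb hd f).2 j) ≤ K * topPair n f + c * lowPair n f := by
  choose K hK h using isFirstOrder_perturb hd
  refine ⟨∑ j, K j, Finset.sum_nonneg fun j _ => hK j, fun n => ?_⟩
  choose c hc hb using fun j => h j n
  refine ⟨∑ j, c j, Finset.sum_nonneg fun j _ => hc j, fun f => ?_⟩
  rw [Finset.sum_mul, Finset.sum_mul, ← Finset.sum_add_distrib]
  exact Finset.sum_le_sum fun j _ => hb j f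

/-! ### Control of all derivatives by the energy -/

theorem sum_sphSq_iter_nonneg {d : ℕ} (n : ℕ) (f : SmoothPair d) :
    0 ≤ ∑ j, iterSum (fun i => pd i) n sphSq (f.1 j) :=
  Finset.sum_nonneg fun _ _ => iterSum_nonneg _ n sphSq_nonneg _

theorem topPair_le_energyDot {d : ℕ} (n : ℕ) (f : SmoothPair d) :
    topPair n f ≤ (energyDot (n + 1) f f).re := by
  rw [energyDot_self, topPair]
  linarith [sum_sphSq_iter_nonneg n f]

theorem sum_ballSq_le_energyOne {d : ℕ} (hd : 2 ≤ d) (f : SmoothPair d) :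
    ∑ j, ballSq (f.1 j) + ∑ j, ballSq (f.2 j) ≤ (energyOne f f).re := by
  rw [energyOne_self]
  have h := Finset.sum_le_sum fun j (_ : j ∈ Finset.univ) =>
    ballSq_le_sphSq_add_gradSq hd (f.1 j)
  rw [Finset.sum_add_distrib] at h
  linarith

theorem exists_lowSq_le {d : ℕ} (hd : 1 ≤ d) (n : ℕ) :
    ∃ C : ℝ, 0 ≤ C ∧ ∀ u : Smooth d, lowSq (n + 1) u ≤ C * (derivSq n u + ballSq u) := by
  choose! C hC0 hC using fun m (hm : m ≤ n) => exists_derivSq_le hd hm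
  refine ⟨∑ m ∈ Finset.range (n + 1), C m,
    Finset.sum_nonneg fun m hm => hC0 m (Finset.mem_range_succ_iff.1 hm), fun u => ?_⟩
  rw [lowSq, Finset.sum_mul]
  exact Finset.sum_le_sum fun m hm => hC m (Finset.mem_range_succ_iff.1 hm) u

theorem exists_lowPair_le_energy {d : ℕ} (hd : 2 ≤ d) (n : ℕ) :
    ∃ C : ℝ, 0 ≤ C ∧ ∀ f : SmoothPair d, lowPair (n + 1) f ≤ C * (energy (n + 1) f f).re := by
  obtain ⟨C, hC0, hC⟩ := exists_lowSq_le (d := d) (by omega) (n + 1)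
  obtain ⟨C', hC'0, hC'⟩ := exists_lowSq_le (d := d) (by omega) n
  refine ⟨2 * (C + C'), by positivity, fun f => ?_⟩
  have h1 := (topPair_le_energyDot n f).trans (energyDot_le_energy (by omega) f)
  have h2 := (sum_ballSq_le_energyOne hd f).trans (energyOne_le_energy (n + 1) f)
  have h3 := Finset.sum_le_sum fun j (_ : j ∈ Finset.univ) => hC (f.1 j)
  have h4 := Finset.sum_le_sum fun j (_ : j ∈ Finset.univ) => hC' (f.2 j)
  rw [← Finset.mul_sum, Finset.sum_add_distrib] at h3 h4
  rw [topPair] at h1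
  have p1 : 0 ≤ ∑ j, derivSq (n + 1) (f.1 j) := Finset.sum_nonneg fun _ _ => derivSq_nonneg _ _
  have p2 : 0 ≤ ∑ j, derivSq n (f.2 j) := Finset.sum_nonneg fun _ _ => derivSq_nonneg _ _
  have p3 : 0 ≤ ∑ j, ballSq (f.1 j) := Finset.sum_nonneg fun _ _ => ballSq_nonneg _
  have p4 : 0 ≤ ∑ j, ballSq (f.2 j) := Finset.sum_nonneg fun _ _ => ballSq_nonneg _
  have q1 : ∑ j, derivSq (n + 1) (f.1 j) + ∑ j, ballSq (f.1 j)
      ≤ 2 * (energy (n + 1) f f).re := by linarith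
  have q2 : ∑ j, derivSq n (f.2 j) + ∑ j, ballSq (f.2 j)
      ≤ 2 * (energy (n + 1) f f).re := by linarith
  have r1 := mul_le_mul_of_nonneg_left q1 hC0
  have r2 := mul_le_mul_of_nonneg_left q2 hC'0
  rw [lowPair]
  linarith

theorem energyOne_of_fst_eq_zero {d : ℕ} {f : SmoothPair d} (h : f.1 = 0) (g : SmoothPair d) :
    energyOne f g = ∑ j, l2Ball (f.2 j) (g.2 j) := by
  rw [energyOne, h]
  simp [isSemiInner_l2Ball.zero, isSemiInner_l2Sphere.zero]

theorem pdIter_fst_eq_zero {d n : ℕ} (i : Fin n → Fin d) {f : SmoothPair d} (h : f.1 = 0) :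
    (pdIter i f).1 = 0 := by
  induction n with
  | zero => simpa [pdIter] using h
  | succ n ih =>
    rw [pdIter_succ]
    funext j
    change pd (i 0) ((pdIter (fun a => i a.succ) f).1 j) = 0
    rw [ih, Pi.zero_apply, map_zero]

theorem two_norm_energyDot_perturb_le {d : ℕ} (hd : 3 ≤ d) (n : ℕ) (f : SmoothPair d) :
    2 * ‖energyDot (n + 1) (perturb hd f) f‖
      ≤ ∑ j, derivSq n ((perturb hd f).2 j) + ∑ j, derivSq n (f.2 j) := by
  have hsum : ∀ g : SmoothPair d, ∑ j, derivSq n (g.2 j)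
      = ∑ i : Fin n → Fin d, ∑ j, ballSq ((pdIter i g).2 j) := by
    intro g
    rw [sum_pdIter n fun g : SmoothPair d => ∑ j, ballSq (g.2 j), iterSum_sum]
    simp only [iterSum_pdPair_snd n ballSq]
    rfl
  rw [hsum, hsum, ← Finset.sum_add_distrib]
  change 2 * ‖∑ i : Fin n → Fin d, energyOne (pdIter i (perturb hd f)) (pdIter i f)‖ ≤ _
  refine (mul_le_mul_of_nonneg_left (norm_sum_le _ _) zero_le_two).trans ?_
  rw [Finset.mul_sum]
  refine Finset.sum_le_sum fun i _ => ?_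
  rw [energyOne_of_fst_eq_zero (pdIter_fst_eq_zero i rfl), ← Finset.sum_add_distrib]
  refine (mul_le_mul_of_nonneg_left (norm_sum_le _ _) zero_le_two).trans ?_
  rw [Finset.mul_sum]
  exact Finset.sum_le_sum fun j _ => two_norm_l2Ball_le _ _

theorem exists_isHighestOrderBound {d : ℕ} (hd : 3 ≤ d) : ∃ C : ℝ, IsHighestOrderBound hd C := by
  obtain ⟨K, hK, h⟩ := exists_sum_derivSq_perturb_le hd
  refine ⟨K + 1, by positivity, fun k hk => ?_⟩
  obtain ⟨n, rfl⟩ : ∃ n, k = n + 1 + 1 := ⟨k - 2, by omega⟩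
  obtain ⟨c, hc, hb⟩ := h (n + 1)
  obtain ⟨C, hC, hl⟩ := exists_lowPair_le_energy (d := d) (by omega) n
  refine ⟨c * C + 1, by positivity, fun f => ?_⟩
  have h1 := two_norm_energyDot_perturb_le hd (n + 1) f
  have h2 := hb f
  have h3 := topPair_le_energyDot (n + 1) f
  have h4 : ∑ j, derivSq (n + 1) (f.2 j) ≤ topPair (n + 1) f :=
    le_add_of_nonneg_left (Finset.sum_nonneg fun _ _ => derivSq_nonneg _ _)
  have h5 := mul_le_mul_of_nonneg_left (hl f) hc
  have h6 := mul_le_mul_of_nonneg_left h3 (by linarith : 0 ≤ K + 1)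
  have h7 := (isSemiInner_energy (d := d) (n + 1)).nonneg f
  have h8 : 0 ≤ (K + 1) * (energyDot (n + 1 + 1) f f).re :=
    mul_nonneg (by linarith) ((isSemiInner_energyDot _).nonneg f)
  have h9 : 0 ≤ c * C * (energy (n + 1) f f).re := by positivity
  have e : n + 1 + 1 - 1 = n + 1 := rfl
  rw [e]
  have : 2 * ‖energyDot (n + 1 + 1) (perturb hd f) f‖
      ≤ (K + 1) * (energyDot (n + 1 + 1) f f).re + c * C * (energy (n + 1) f f).re := by
    nlinarith
  linarith

theorem exists_re_energyOne_linGen_le {d : ℕ} (hd : 3 ≤ d) :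
    ∃ C : ℝ, 0 ≤ C ∧ ∀ f : SmoothPair d,
      (energyOne (linGen hd f) f).re ≤ C * (energyOne f f).re := by
  obtain ⟨K, hK, h⟩ := exists_sum_derivSq_perturb_le hd
  obtain ⟨c, hc, hb⟩ := h 0
  refine ⟨d / 2 + (K + 1 + c), by positivity, fun f => ?_⟩
  have h0 := re_energyOne_freeGen_le hd f
  have h1 := two_norm_energyDot_perturb_le hd 0 f
  have h2 := hb f
  have h3 := topPair_le_energyDot 0 f
  have h4 : ∑ j, derivSq 0 (f.2 j) ≤ topPair 0 f :=
    le_add_of_nonneg_left (Finset.sum_nonneg fun _ _ => derivSq_nonneg _ _)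
  have h5 : lowPair 0 f ≤ (energyOne f f).re := by
    have h6 := sum_ballSq_le_energyOne (d := d) (by omega) f
    have h7 : lowPair 0 f = ∑ j, ballSq (f.1 j) := by
      simp [lowPair, lowSq, derivSq_zero]
    have h8 : 0 ≤ ∑ j, ballSq (f.2 j) := Finset.sum_nonneg fun _ _ => ballSq_nonneg _
    linarith
  rw [zero_add, energyDot_one] at h1 h3
  have h6 := Complex.re_le_norm (energyOne (perturb hd f) f)
  have h7 := mul_le_mul_of_nonneg_left h5 hc
  have h8 := mul_le_mul_of_nonneg_left h3 (by linarith : 0 ≤ K + 1)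
  have h9 := isSemiInner_energyOne.nonneg f
  have h10 : 0 ≤ ‖energyOne (perturb hd f) f‖ := norm_nonneg _
  rw [linGen, isSemiInner_energyOne.add, Complex.add_re]
  nlinarith

/-! ### The compact remainder -/

theorem iterSum_relCompact {d : ℕ} {p : SmoothPair d → ℝ} (hp : ∀ f, 0 ≤ p f) {q : Smooth d → ℝ}
    (hq : RelCompact (fun u : Smooth d => gradSq u + ballSq u) q) (n : ℕ)
    (T : SmoothPair d →ₗ[ℂ] Smooth d) {c : ℝ} (hc : 0 < c)
    (h : ∀ f, derivSq (n + 1) (T f) + derivSq n (T f) ≤ c * p f) :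
    RelCompact p fun f => iterSum (fun i => pd i) n q (T f) := by
  induction n generalizing T with
  | zero =>
    exact hq.comap T hc h fun u => add_nonneg (gradSq_nonneg u) (ballSq_nonneg u)
  | succ n ih =>
    refine RelCompact.sum Finset.univ hp fun i _ => ih (pd i ∘ₗ T) fun f => ?_
    refine le_trans ?_ (h f)
    rw [derivSq_succ (n + 1), derivSq_succ n (T f)]
    exact add_le_add
      (Finset.single_le_sum (f := fun i => derivSq (n + 1) (pd i (T f)))
        (fun _ _ => derivSq_nonneg _ _) (Finset.mem_univ i))
      (Finset.single_le_sum (f := fun i => derivSq n (pd i (T f)))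
        (fun _ _ => derivSq_nonneg _ _) (Finset.mem_univ i))

/-- The embedding of the energy space of order `n + 2` into that of order `n + 1` is compact. -/
theorem relCompact_energy {d : ℕ} (hd : 2 ≤ d) (n : ℕ) :
    RelCompact (fun f : SmoothPair d => (energy (n + 2) f f).re)
      fun f => (energy (n + 1) f f).re := by
  have hd1 : 1 ≤ d := by omega
  obtain ⟨C, hC, hl⟩ := exists_lowPair_le_energy hd (n + 1)
  set p : SmoothPair d → ℝ := fun f => (energy (n + 2) f f).re with hp
  have hp0 : ∀ f, 0 ≤ p f := (isSemiInner_energy (n + 2)).nonneg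
  let T₁ : Fin d → SmoothPair d →ₗ[ℂ] Smooth d := fun j =>
    { toFun := fun f => f.1 j, map_add' := fun _ _ => rfl, map_smul' := fun _ _ => rfl }
  let T₂ : Fin d → SmoothPair d →ₗ[ℂ] Smooth d := fun j =>
    { toFun := fun f => f.2 j, map_add' := fun _ _ => rfl, map_smul' := fun _ _ => rfl }
  have hlow : ∀ f, lowPair (n + 2) f ≤ C * p f := hl
  have b1 : ∀ m j (f : SmoothPair d), m ≤ n + 2 → derivSq m (f.1 j) ≤ lowPair (n + 2) f := by
    intro m j f hm
    have h1 := derivSq_le_lowSq (Nat.lt_succ_of_le hm) (f.1 j)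
    have h2 := Finset.single_le_sum (f := fun j => lowSq (n + 2 + 1) (f.1 j))
      (fun _ _ => lowSq_nonneg _ _) (Finset.mem_univ j)
    have h3 : 0 ≤ ∑ j, lowSq (n + 2) (f.2 j) := Finset.sum_nonneg fun _ _ => lowSq_nonneg _ _
    exact (h1.trans h2).trans (le_add_of_nonneg_right h3)
  have b2 : ∀ m j (f : SmoothPair d), m ≤ n + 1 → derivSq m (f.2 j) ≤ lowPair (n + 2) f := by
    intro m j f hm
    have h1 := derivSq_le_lowSq (Nat.lt_succ_of_le hm) (f.2 j)
    have h2 := Finset.single_le_sum (f := fun j => lowSq (n + 2) (f.2 j))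
      (fun _ _ => lowSq_nonneg _ _) (Finset.mem_univ j)
    have h3 : 0 ≤ ∑ j, lowSq (n + 2 + 1) (f.1 j) := Finset.sum_nonneg fun _ _ => lowSq_nonneg _ _
    exact (h1.trans h2).trans (le_add_of_nonneg_left h3)
  have hc : 0 < 2 * C + 1 := by positivity
  have hcp : ∀ f, 2 * (C * p f) ≤ (2 * C + 1) * p f := fun f => by linarith [hp0 f]
  have k1 : ∀ m ≤ n + 1, ∀ j, RelCompact p fun f => derivSq m (f.1 j) := fun m hm j =>
    iterSum_relCompact hp0 (relCompact_ballSq d) m (T₁ j) hc fun f => by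
      have := b1 (m + 1) j f (by omega)
      have := b1 m j f (by omega)
      change derivSq (m + 1) (f.1 j) + derivSq m (f.1 j) ≤ _
      linarith [hcp f, hlow f]
  have k2 : ∀ m ≤ n, ∀ j, RelCompact p fun f => derivSq m (f.2 j) := fun m hm j =>
    iterSum_relCompact hp0 (relCompact_ballSq d) m (T₂ j) hc fun f => by
      have := b2 (m + 1) j f (by omega)
      have := b2 m j f (by omega)
      change derivSq (m + 1) (f.2 j) + derivSq m (f.2 j) ≤ _
      linarith [hcp f, hlow f]
  have k3 : ∀ m ≤ n + 1, ∀ j, RelCompact p fun f => iterSum (fun i => pd i) m sphSq (f.1 j) :=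
    fun m hm j => iterSum_relCompact hp0 (relCompact_sphSq hd1) m (T₁ j) hc fun f => by
      have := b1 (m + 1) j f (by omega)
      have := b1 m j f (by omega)
      change derivSq (m + 1) (f.1 j) + derivSq m (f.1 j) ≤ _
      linarith [hcp f, hlow f]
  have hdot : ∀ m ≤ n, RelCompact p fun f => (energyDot (m + 1) f f).re := by
    intro m hm
    simp only [energyDot_self]
    exact ((RelCompact.sum _ hp0 fun j _ => k1 (m + 1) (by omega) j).add
      (RelCompact.sum _ hp0 fun j _ => k2 m hm j)).add
      (RelCompact.sum _ hp0 fun j _ => k3 m (by omega) j)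
  have h1 := hdot 0 (Nat.zero_le n)
  simp only [zero_add, energyDot_one] at h1
  refine ((hdot n le_rfl).add h1).mono one_pos fun f => ?_
  rw [one_mul]
  have h2 := isSemiInner_energyOne.nonneg f
  have h3 := (isSemiInner_energyDot (n + 1)).nonneg f
  unfold energy
  split_ifs
  · linarith
  · rw [Complex.add_re]

/-! ### The projection -/

theorem norm_toSobolev_sq {d : ℕ} (k : ℕ) (f : SmoothPair d) :
    ‖toSobolev k f‖ ^ 2 = (energy k f f).re := by
  rw [← inner_toSobolev, ← inner_self_eq_norm_sq (𝕜 := ℂ)]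
  rfl

/-- A functional that is bounded in the energy norm is represented by an element of the Hilbert
space. -/
theorem exists_inner_toSobolev_eq {d : ℕ} (k : ℕ) (l : SmoothPair d →ₗ[ℂ] ℂ)
    (hl : ∃ C : ℝ, ∀ f, ‖l f‖ ^ 2 ≤ C * (energy k f f).re) :
    ∃ v : Sobolev d k, ∀ f, inner ℂ v (toSobolev k f) = l f := by
  obtain ⟨C, hC⟩ := hl
  let g : PreSobolev d k →ₗ[ℂ] ℂ :=
    { toFun := fun f => l f
      map_add' := fun f h => map_add l f h
      map_smul' := fun c f => map_smul l c f }
  have hn : ∀ f : PreSobolev d k, ‖f‖ ^ 2 = (energy k f f).re := fun f =>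
    (congrArg (· ^ 2) (UniformSpace.Completion.norm_coe f).symm).trans (norm_toSobolev_sq k f)
  have hg : ∀ f, ‖g f‖ ≤ √|C| * ‖f‖ := fun f => by
    refine abs_le_of_sq_le_sq' ?_ (by positivity) |>.2
    rw [mul_pow, Real.sq_sqrt (abs_nonneg C)]
    refine (hC f).trans ((mul_le_mul_of_nonneg_right (le_abs_self C)
      ((isSemiInner_energy k).nonneg f)).trans_eq ?_)
    exact congrArg (|C| * ·) (hn f).symm
  let G : PreSobolev d k →L[ℂ] ℂ := g.mkContinuous _ hg
  let e : PreSobolev d k →L[ℂ] Sobolev d k := UniformSpace.Completion.toComplL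
  have hd : DenseRange e := UniformSpace.Completion.denseRange_coe
  have hu : IsUniformInducing e := UniformSpace.Completion.isUniformInducing_coe _
  refine ⟨(InnerProductSpace.toDual ℂ (Sobolev d k)).symm (G.extend e), fun f => ?_⟩
  rw [InnerProductSpace.toDual_symm_apply]
  exact ContinuousLinearMap.extend_eq G hd hu f

/-- A relatively compact form is controlled, up to a small multiple of the energy, by a
finite-rank orthogonal projection: project onto the span of the vectors that represent the
functionals. -/
theorem RelCompact.exists_projection {d k : ℕ} {q : SmoothPair d → ℝ}
    (hq : RelCompact (fun f => (energy k f f).re) q) {ε : ℝ} (hε : 0 < ε) :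
    ∃ P : Sobolev d k →L[ℂ] Sobolev d k, IsStarProjection P ∧ FiniteDimensional ℂ P.range ∧
      (∀ F, 0 ≤ (inner ℂ F (P F)).re) ∧ ∃ M : ℝ, 0 ≤ M ∧ ∀ f, q f ≤ ε * (energy k f f).re
        + M * (inner ℂ (toSobolev k f) (P (toSobolev k f))).re := by
  obtain ⟨L, hL, K, hK, h⟩ := hq ε hε
  choose! v hv using fun l (hl : l ∈ L) => exists_inner_toSobolev_eq k l (hL l hl)
  set U : Submodule ℂ (Sobolev d k) := Submodule.span ℂ (v '' {l | l ∈ L}) with hU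
  have hfin : FiniteDimensional ℂ U :=
    FiniteDimensional.span_of_finite ℂ ((List.finite_toSet L).image v)
  have horth : ∀ F, ∀ w ∈ U, inner ℂ w F = inner ℂ w (U.starProjection F) := by
    intro F w hw
    have := Submodule.starProjection_inner_eq_zero (K := U) F w hw
    rw [← inner_conj_symm, map_eq_zero, inner_sub_right, sub_eq_zero] at this
    exact this
  have hP : ∀ F, (inner ℂ F (U.starProjection F)).re = ‖U.starProjection F‖ ^ 2 := by
    intro F
    have h1 := horth F _ (Submodule.starProjection_apply_mem U F)
    rw [← inner_conj_symm, Complex.conj_re, h1]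
    exact inner_self_eq_norm_sq (𝕜 := ℂ) _
  refine ⟨U.starProjection, isStarProjection_starProjection, ?_, fun F => ?_,
    K * (L.map fun l => ‖v l‖ ^ 2).sum, ?_, fun f => ?_⟩
  · rw [Submodule.range_starProjection]
    exact hfin
  · rw [hP]
    positivity
  · refine mul_nonneg hK (List.sum_nonneg fun a ha => ?_)
    obtain ⟨l, -, rfl⟩ := List.mem_map.1 ha
    positivity
  set F := toSobolev k f with hF
  have hl : ∀ l ∈ L, ‖l f‖ ^ 2 ≤ ‖v l‖ ^ 2 * ‖U.starProjection F‖ ^ 2 := by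
    intro l hl
    rw [← hv l hl f, horth F _ (Submodule.subset_span ⟨l, hl, rfl⟩), ← mul_pow]
    exact pow_le_pow_left₀ (norm_nonneg _) (norm_inner_le_norm _ _) 2
  have hsum : (L.map fun l => ‖l f‖ ^ 2).sum
      ≤ (L.map fun l => ‖v l‖ ^ 2).sum * ‖U.starProjection F‖ ^ 2 := by
    rw [← List.sum_map_mul_right]
    exact List.sum_le_sum hl
  rw [hP, mul_assoc]
  exact (h f).trans (add_le_add le_rfl (mul_le_mul_of_nonneg_left hsum hK))

/-- Gårding-type inequality: up to a form of lower order, the generator is dissipative. -/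
theorem exists_re_energy_linGen_le {d : ℕ} (hd : 3 ≤ d) {C : ℝ} (hC : IsHighestOrderBound hd C)
    {k : ℕ} (hk2 : 2 ≤ k) (hk : (d : ℝ) / 2 + 1 + C ≤ k) :
    ∃ c : ℝ, 0 < c ∧ ∀ f : SmoothPair d, (energy k (linGen hd f) f).re
      ≤ -(energy k f f).re + c * (energy (k - 1) f f).re := by
  obtain ⟨c, hc, hb⟩ := hC.2 k hk2
  obtain ⟨C₁, hC₁, h₁⟩ := exists_re_energyOne_linGen_le hd
  refine ⟨c + (C₁ + 1), by positivity, fun f => ?_⟩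
  have hk' : ¬k ≤ 1 := by omega
  have e : ∀ g h : SmoothPair d, energy k g h = energyDot k g h + energyOne g h := fun g h => by
    rw [energy, if_neg hk']
  have e2 : (energyDot k (linGen hd f) f).re
      = (energyDot k (freeGen f) f).re + (energyDot k (perturb hd f) f).re := by
    rw [linGen, (isSemiInner_energyDot k).add, Complex.add_re]
  rw [e, e, Complex.add_re, Complex.add_re, e2]
  have h2 := re_energyDot_freeGen_le hd (by omega : 1 ≤ k) f
  have h3 := (Complex.re_le_norm _).trans (hb f)
  have h4 := (isSemiInner_energyDot (d := d) k).nonneg f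
  have h5 := mul_le_mul_of_nonneg_left (energyOne_le_energy (k - 1) f) (by positivity : 0 ≤ C₁ + 1)
  have h6 := h₁ f
  nlinarith

end WaveMaps

theorem theorem2p5 (d : ℕ) (hd : 3 ≤ d) :
    (∃ C : ℝ, WaveMaps.IsHighestOrderBound hd C) ∧
    ∀ C : ℝ, WaveMaps.IsHighestOrderBound hd C →
      ∀ k : ℕ, ⌈(d : ℝ) / 2 + 1 + C⌉₊ ≤ k →
        ∃ Ck : ℝ, 0 < Ck ∧ ∃ wk : ℝ, 0 < wk ∧
        ∃ P : WaveMaps.Sobolev d k →L[ℂ] WaveMaps.Sobolev d k,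
          IsStarProjection P ∧ FiniteDimensional ℂ P.range ∧
          ∀ f : WaveMaps.SmoothPair d,
            (inner ℂ (WaveMaps.toSobolev k f)
              (WaveMaps.toSobolev k (WaveMaps.linGen hd f)
                - (Ck : ℂ) • P (WaveMaps.toSobolev k f))).re
              ≤ -wk * ‖WaveMaps.toSobolev k f‖ ^ 2 := by
  refine ⟨WaveMaps.exists_isHighestOrderBound hd, fun C hC k hk => ?_⟩
  have hk' : (d : ℝ) / 2 + 1 + C ≤ k := Nat.ceil_le.1 hk
  have h3 : (3 : ℝ) ≤ d := by exact_mod_cast hd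
  have hk2 : 2 ≤ k := by
    have : (2 : ℝ) ≤ k := by linarith [hC.1]
    exact_mod_cast this
  obtain ⟨c, hc, hg⟩ := WaveMaps.exists_re_energy_linGen_le hd hC hk2 hk'
  obtain ⟨n, rfl⟩ : ∃ n, k = n + 2 := ⟨k - 2, by omega⟩
  -- the lower-order term may absorb half of the dissipation
  obtain ⟨P, hP, hfin, hP0, M, hM, hq⟩ :=
    (WaveMaps.relCompact_energy (d := d) (by omega) n).exists_projection
      (ε := 1 / (2 * c)) (by positivity)
  refine ⟨c * M + 1, by positivity, 1 / 2, by norm_num, P, hP, hfin, fun f => ?_⟩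
  have h1 := hg f
  have h2 := mul_le_mul_of_nonneg_left (hq f) hc.le
  have h4 := hP0 (WaveMaps.toSobolev (n + 2) f)
  have h5 : c * (1 / (2 * c) * (WaveMaps.energy (n + 2) f f).re
      + M * (inner ℂ (WaveMaps.toSobolev (n + 2) f) (P (WaveMaps.toSobolev (n + 2) f))).re)
      = 1 / 2 * (WaveMaps.energy (n + 2) f f).re + c * M
        * (inner ℂ (WaveMaps.toSobolev (n + 2) f) (P (WaveMaps.toSobolev (n + 2) f))).re := by
    field_simp
  rw [h5] at h2
  rw [inner_sub_right, inner_smul_right, Complex.sub_re, Complex.re_ofReal_mul,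
    WaveMaps.inner_toSobolev, WaveMaps.norm_toSobolev_sq]
  have e : n + 2 - 1 = n + 1 := rfl
  rw [e] at h1
  linarith
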